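/- Let $\ell\ge 0$ and let $\mathfrak h=\mathbb C^\ell$ with the nondegenerate symmetric bilinear form $(\cdot,\cdot)$ for which the standard basis $h_1,\dots,h_\ell$ is orthonormal. Let $\hat{\mathfrak h}=\mathfrak h\otimes\mathbb C[t,t^{-1}]\oplus\mathbb CK$ be the Heisenberg Lie algebra: $K$ is central and $[a(m),b(n)]=m\,\delta_{m+n,0}(a,b)K$, where $a(n)=a\otimes t^n$. Put $\mathfrak n=\mathfrak h\otimes\mathbb C[t]\oplus\mathbb CK$. For a sequence $\boldsymbol\lambda=(\lambda_0,\lambda_1,\dots)$ in $\mathfrak h$ with $\lambda_n=0$ for $n\gg0$, let $\Lambda:\mathfrak n\to\mathbb C$ be the Whittaker function $\Lambda(h(n))=(h,\lambda_n)$ for $n\ge 0$, $\Lambda(K)=1$, and let $M(1,\boldsymbol\lambda)=U(\hat{\mathfrak h})\otimes_{U(\mathfrak n)}\mathbb C_\Lambda$ be the standard Whittaker module. For $\boldsymbol\lambda=0$ this is the space of the Heisenberg vertex operator algebra $M(1)$, with vacuum $\mathbf 1=1\otimes 1$. The algebra $M(1)$ acts on $M(1,\boldsymbol\lambda)$ by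 the vertex operators $$Y\big(a^{(1)}(n_1)\cdots a^{(r)}(n_r)\mathbf 1,z\big)=a^{(1)}(z)_{n_1}\cdots a^{(r)}(z)_{n_r}\,\mathrm{Id},\qquad a(z)=\sum_{n\in\mathbb Z}a(n)z^{-n-1},$$ where $a(z)_nb(z)=\operatorname{Res}_{z_1}\big((z_1-z)^na(z_1)b(z)-(-z+z_1)^nb(z)a(z_1)\big)$. The orthogonal group $O(\ell)$ of $(\mathfrak h,(\cdot,\cdot))$ acts on $M(1)$ by $a^{(1)}(n_1)\cdots a^{(r)}(n_r)\mathbf 1\mapsto (ga^{(1)})(n_1)\cdots(ga^{(r)})(n_r)\mathbf 1$. For $g\in O(\ell)$ let $M(1)^{\langle g\rangle}$ be the vertex subalgebra of vectors fixed by $\langle g\rangle$, and define $\Lambda\circ g:\mathfrak n\to\mathbb C$ by $(\Lambda\circ g)(h(n))=\Lambda((gh)(n))$, $(\Lambda\circ g)(K)=1$. The symmetric group $S_\ell$ embeds in $O(\ell)$ by $\sigma h_i=h_{\sigma(i)}$. 1. Let $g\in O(\ell)$ have finite order $p$, and assume that $\Lambda\circ g^i\ne\Lambda$ for all $1\le i<p$.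 Then $M(1,\boldsymbol\lambda)$ is an irreducible weak $M(1)^{\langle g\rangle}$-module. In particular, let $\theta=-1\in O(\ell)$ and $M(1)^+=\{v\in M(1)\mid\theta v=v\}$; if $\boldsymbol\lambda\neq 0$, then $M(1,\boldsymbol\lambda)$ is an irreducible weak $M(1)^+$-module. 2. Assume that $\Lambda\circ\sigma\neq\Lambda$ for every transposition $\sigma\in S_\ell$. Then, for every $g\in S_\ell$, $M(1,\boldsymbol\lambda)$ is an irreducible weak $M(1)^{\langle g\rangle}$-module. Here an irreducible weak module is a nonzero weak module (lower truncation, vacuum property and Jacobi identity) with no proper nonzero subspace stable under all modes of the vertex operators. -/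

import Mathlib

noncomputable section

attribute [local instance 100] LieRing.ofAssociativeRing

/-! ## The Heisenberg Lie algebra -/

/-- The Heisenberg Lie algebra `𝔥 ⊗ ℂ[t, t⁻¹] ⊕ ℂ K`, where `𝔥 = ℂ^ℓ` carries the standard symmetric
bilinear form `(a, b) = a ⬝ᵥ b`, so that the standard basis of `𝔥` is orthonormal.  The first component
sends `n` to the coefficient of `t^n`, the second one is the coefficient of `K`. -/
def Heis (ℓ : ℕ) : Type := (ℤ →₀ (Fin ℓ → ℂ)) × ℂ

namespace Heis

variable {ℓ : ℕ}

instance : AddCommGroup (Heis ℓ) := inferInstanceAs (AddCommGroup ((ℤ →₀ (Fin ℓ → ℂ)) × ℂ))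

instance : Module ℂ (Heis ℓ) := inferInstanceAs (Module ℂ ((ℤ →₀ (Fin ℓ → ℂ)) × ℂ))

/-- The projection to `𝔥 ⊗ ℂ[t, t⁻¹]`. -/
def loop : Heis ℓ →ₗ[ℂ] (ℤ →₀ (Fin ℓ → ℂ)) := LinearMap.fst ℂ _ _

/-- The coefficient of `K`. -/
def central : Heis ℓ →ₗ[ℂ] ℂ := LinearMap.snd ℂ _ _

/-- The inclusion of `𝔥 ⊗ ℂ[t, t⁻¹]`. -/
def ofLoop : (ℤ →₀ (Fin ℓ → ℂ)) →ₗ[ℂ] Heis ℓ := LinearMap.inl ℂ _ _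

/-- The element `a(n) = a ⊗ t^n`. -/
def mode (n : ℤ) : (Fin ℓ → ℂ) →ₗ[ℂ] Heis ℓ :=
  ofLoop ∘ₗ Finsupp.lsingle n

/-- The central element `K`. -/
def K : Heis ℓ := ((0, 1) : (ℤ →₀ (Fin ℓ → ℂ)) × ℂ)

@[ext]
theorem ext {x y : Heis ℓ} (h₁ : loop x = loop y) (h₂ : central x = central y) : x = y :=
  Prod.ext h₁ h₂

@[simp] theorem loop_mode (n : ℤ) (a : Fin ℓ → ℂ) : loop (mode n a) = Finsupp.single n a := rfl

@[simp] theorem central_mode (n : ℤ) (a : Fin ℓ → ℂ) : central (mode n a) = 0 := rfl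

@[simp] theorem loop_K : loop (K : Heis ℓ) = 0 := rfl

@[simp] theorem central_K : central (K : Heis ℓ) = 1 := rfl

/-- The cocycle `(a(m), b(n)) ↦ m δ_{m+n,0} (a, b)`. -/
def cocycle (x y : Heis ℓ) : ℂ :=
  (loop x).sum fun m a => (m : ℂ) * (a ⬝ᵥ loop y (-m))

theorem cocycle_add_left (x x' y : Heis ℓ) :
    cocycle (x + x') y = cocycle x y + cocycle x' y := by
  unfold cocycle
  rw [map_add, Finsupp.sum_add_index']
  · intro a; simp
  · intro a b c; rw [add_dotProduct, mul_add]

theorem cocycle_smul_left (c : ℂ) (x y : Heis ℓ) :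
    cocycle (c • x) y = c * cocycle x y := by
  unfold cocycle
  rw [map_smul, Finsupp.sum_smul_index', Finsupp.sum, Finsupp.sum, Finset.mul_sum]
  · refine Finset.sum_congr rfl fun m _ => ?_
    rw [smul_dotProduct, smul_eq_mul]; ring
  · intro a; simp

theorem cocycle_add_right (x y y' : Heis ℓ) :
    cocycle x (y + y') = cocycle x y + cocycle x y' := by
  unfold cocycle
  simp only [Finsupp.sum, ← Finset.sum_add_distrib]
  refine Finset.sum_congr rfl fun m _ => ?_
  rw [map_add, Finsupp.add_apply, dotProduct_add, mul_add]

theorem cocycle_smul_right (c : ℂ) (x y : Heis ℓ) :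
    cocycle x (c • y) = c * cocycle x y := by
  unfold cocycle
  simp only [Finsupp.sum, Finset.mul_sum]
  refine Finset.sum_congr rfl fun m _ => ?_
  rw [map_smul, Finsupp.smul_apply, dotProduct_smul, smul_eq_mul]; ring

theorem cocycle_mode_mode (m n : ℤ) (a b : Fin ℓ → ℂ) :
    cocycle (mode m a) (mode n b) = if m + n = 0 then (m : ℂ) * (a ⬝ᵥ b) else 0 := by
  unfold cocycle
  rw [loop_mode, loop_mode, Finsupp.sum_single_index (by simp), Finsupp.single_apply]
  by_cases h : m + n = 0
  · rw [if_pos h, if_pos (by omega)]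
  · rw [if_neg h, if_neg (by omega)]; simp

@[simp] theorem cocycle_K_left (y : Heis ℓ) : cocycle K y = 0 := by
  simp [cocycle]

@[simp] theorem cocycle_K_right (y : Heis ℓ) : cocycle y K = 0 := by
  simp [cocycle]

/-- Elements `a(n)` and `K` span. -/
theorem induction {p : Heis ℓ → Prop} (hm : ∀ n a, p (mode n a)) (hK : p K)
    (ha : ∀ x y, p x → p y → p (x + y)) (hs : ∀ (c : ℂ) x, p x → p (c • x)) (x : Heis ℓ) : p x := by
  have h1 : ∀ f : ℤ →₀ (Fin ℓ → ℂ), p (ofLoop f) := by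
    intro f
    induction f using Finsupp.induction_linear with
    | zero =>
      have := hs 0 K hK
      rw [zero_smul] at this
      rwa [map_zero]
    | add f g hf hg => rw [map_add]; exact ha _ _ hf hg
    | single n a => exact hm n a
  have e : x = ofLoop (loop x) + central x • K := by
    apply ext
    · rw [map_add, map_smul, loop_K, smul_zero, add_zero]; rfl
    · rw [map_add, map_smul, central_K, smul_eq_mul, mul_one]
      exact (zero_add _).symm
  rw [e]
  exact ha _ _ (h1 _) (hs _ _ hK)

theorem cocycle_swap (x y : Heis ℓ) : cocycle y x = - cocycle x y := by
  induction x using induction with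
  | hK => simp
  | ha x x' h h' => rw [cocycle_add_left, cocycle_add_right, h, h']; ring
  | hs c x h => rw [cocycle_smul_left, cocycle_smul_right, h]; ring
  | hm n a =>
    induction y using induction with
    | hK => simp
    | ha x x' h h' => rw [cocycle_add_left, cocycle_add_right, h, h']; ring
    | hs c x h => rw [cocycle_smul_left, cocycle_smul_right, h]; ring
    | hm m b =>
      rw [cocycle_mode_mode, cocycle_mode_mode]
      by_cases h : m + n = 0
      · rw [if_pos h, if_pos (by omega), dotProduct_comm]
        have : (m : ℂ) = -n := by
          have : m = -n := by omega
          rw [this]; push_cast; ring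
        rw [this]; ring
      · rw [if_neg h, if_neg (by omega)]; simp

/-- The bracket `[x, y] = cocycle(x, y) K`, that is, `[a(m), b(n)] = m δ_{m+n,0} (a, b) K`
and `K` is central. -/
instance : Bracket (Heis ℓ) (Heis ℓ) := ⟨fun x y => cocycle x y • K⟩

theorem bracket_def (x y : Heis ℓ) : ⁅x, y⁆ = cocycle x y • K := rfl

instance : LieRing (Heis ℓ) where
  add_lie x y z := by simp only [bracket_def, cocycle_add_left, add_smul]
  lie_add x y z := by simp only [bracket_def, cocycle_add_right, add_smul]
  lie_self x := by
    have h := cocycle_swap x x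
    have h0 : cocycle x x = 0 := by linear_combination h / 2
    rw [bracket_def, h0, zero_smul]
  leibniz_lie x y z := by
    simp only [bracket_def, cocycle_smul_left, cocycle_smul_right, cocycle_K_left,
      cocycle_K_right, mul_zero, zero_smul, add_zero]

instance : LieAlgebra ℂ (Heis ℓ) where
  lie_smul c x y := by simp only [bracket_def, cocycle_smul_right, mul_smul]

/-- The subalgebra `𝔫 = 𝔥 ⊗ ℂ[t] ⊕ ℂ K`. -/
def nonneg (ℓ : ℕ) : LieSubalgebra ℂ (Heis ℓ) where
  carrier := {x | ∀ m : ℤ, m < 0 → loop x m = 0}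
  zero_mem' := by intro m _; simp
  add_mem' := by
    intro x y hx hy m hm
    rw [map_add, Finsupp.add_apply, hx m hm, hy m hm, add_zero]
  smul_mem' := by
    intro c x hx m hm
    rw [map_smul, Finsupp.smul_apply, hx m hm, smul_zero]
  lie_mem' := by
    intro x y _ _ m _
    change loop (cocycle x y • K) m = 0
    simp

end Heis

/-! ## Standard Whittaker modules -/

/-- The left ideal of `U(ĥ)` generated by the elements `x - Λ(x)`, `x ∈ 𝔫`. -/
def whittakerIdeal {ℓ : ℕ} (Λ : Heis.nonneg ℓ →ₗ⁅ℂ⁆ ℂ) :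
    Submodule (UniversalEnvelopingAlgebra ℂ (Heis ℓ)) (UniversalEnvelopingAlgebra ℂ (Heis ℓ)) :=
  Submodule.span _ (Set.range fun x : Heis.nonneg ℓ =>
    UniversalEnvelopingAlgebra.ι ℂ (x : Heis ℓ) - algebraMap ℂ _ (Λ x))

/-- The standard (universal) Whittaker module `U(ĥ) ⊗_{U(𝔫)} ℂ_Λ`, realized as the quotient of
`U(ĥ)` by the left ideal generated by all `x - Λ(x)`, `x ∈ 𝔫`. -/
abbrev StdWhittaker {ℓ : ℕ} (Λ : Heis.nonneg ℓ →ₗ⁅ℂ⁆ ℂ) : Type :=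
  UniversalEnvelopingAlgebra ℂ (Heis ℓ) ⧸ whittakerIdeal Λ

/-- The Whittaker function of a finitely supported sequence `λ = (λ₀, λ₁, …)` in `𝔥`:
`h(n) ↦ (h, λ_n)` for `n ≥ 0`, and `K ↦ 1`. -/
def whittakerFunction {ℓ : ℕ} (lam : ℕ →₀ (Fin ℓ → ℂ)) : Heis.nonneg ℓ →ₗ⁅ℂ⁆ ℂ where
  toFun x := (lam.sum fun n v => Heis.loop (x : Heis ℓ) (n : ℤ) ⬝ᵥ v) + Heis.central (x : Heis ℓ)
  map_add' x y := by
    rw [show ((x + y : Heis.nonneg ℓ) : Heis ℓ) = (x : Heis ℓ) + (y : Heis ℓ) from rfl]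
    simp only [map_add, Finsupp.add_apply, add_dotProduct, Finsupp.sum, Finset.sum_add_distrib]
    ring
  map_smul' c x := by
    rw [show ((c • x : Heis.nonneg ℓ) : Heis ℓ) = c • (x : Heis ℓ) from rfl]
    simp only [map_smul, Finsupp.smul_apply, smul_dotProduct, Finsupp.sum,
      RingHom.id_apply, smul_eq_mul, mul_add, Finset.mul_sum]
  map_lie' := by
    intro x y
    have h : Heis.cocycle (x : Heis ℓ) (y : Heis ℓ) = 0 := by
      unfold Heis.cocycle
      refine Finset.sum_eq_zero fun m _ => ?_
      beta_reduce
      rcases lt_trichotomy m 0 with h | h | h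
      · rw [x.2 m h]; simp
      · simp [h]
      · rw [y.2 (-m) (by omega)]; simp
    rw [LieRing.of_associative_ring_bracket, mul_comm, sub_self]
    simp only [LieSubalgebra.coe_bracket, Heis.bracket_def, h, zero_smul, map_zero,
      Finsupp.coe_zero, Pi.zero_apply, zero_dotProduct, add_zero]
    simp [Finsupp.sum]

/-- The Whittaker module `M(1, λ)`: its generator `e^λ` satisfies `h(n) e^λ = (h, λ_n) e^λ` for
`n ≥ 0` and `K e^λ = e^λ`. -/
abbrev WhittakerM1 {ℓ : ℕ} (lam : ℕ →₀ (Fin ℓ → ℂ)) : Type := StdWhittaker (whittakerFunction lam)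

/-- The underlying space of the Heisenberg vertex operator algebra `M(1)`: its generator `e⁰`
satisfies `h(n) e⁰ = 0` for `n ≥ 0` and `K e⁰ = e⁰`. -/
abbrev M1 (ℓ : ℕ) : Type := WhittakerM1 (0 : ℕ →₀ (Fin ℓ → ℂ))

/-- The generator `1 ⊗ 1` of a standard Whittaker module. -/
def whittakerGen {ℓ : ℕ} (Λ : Heis.nonneg ℓ →ₗ⁅ℂ⁆ ℂ) : StdWhittaker Λ :=
  Submodule.Quotient.mk 1

/-- The vacuum vector `𝟏 = e⁰` of `M(1)`. -/
def M1.vacuum (ℓ : ℕ) : M1 ℓ := whittakerGen _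

/-! ## Fields and their residue products -/

/-- The fields on `W`: families `(f_n)` of operators, standing for `f(z) = ∑ f_n z^{-n-1}`, such that
for each `w` one has `f_n w = 0` for `n` sufficiently large. -/
def fieldSubmodule (W : Type*) [AddCommGroup W] [Module ℂ W] : Submodule ℂ (ℤ → Module.End ℂ W) where
  carrier := {f | ∀ w, ∃ N : ℤ, ∀ n, N ≤ n → f n w = 0}
  zero_mem' := fun w => ⟨0, fun n _ => rfl⟩
  add_mem' := by
    intro f g hf hg w
    obtain ⟨N, hN⟩ := hf w
    obtain ⟨M, hM⟩ := hg w
    refine ⟨max N M, fun n hn => ?_⟩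
    rw [Pi.add_apply, LinearMap.add_apply, hN n (le_trans (le_max_left _ _) hn),
      hM n (le_trans (le_max_right _ _) hn), add_zero]
  smul_mem' := by
    intro c f hf w
    obtain ⟨N, hN⟩ := hf w
    refine ⟨N, fun n hn => ?_⟩
    rw [Pi.smul_apply, LinearMap.smul_apply, hN n hn, smul_zero]

/-- The space of fields on `W`. -/
def FieldSpace (W : Type*) [AddCommGroup W] [Module ℂ W] : Type _ := fieldSubmodule W

namespace FieldSpace

theorem finsum_eq_range {W : Type*} [AddCommGroup W] {f : ℕ → W} (N : ℕ)
    (h : ∀ j, N ≤ j → f j = 0) : ∑ᶠ j, f j = ∑ j ∈ Finset.range N, f j := by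
  apply finsum_eq_sum_of_support_subset
  intro j hj
  by_contra hc
  exact hj (h j (by simpa using hc))

variable {W : Type*} [AddCommGroup W] [Module ℂ W]

instance : AddCommGroup (FieldSpace W) := inferInstanceAs (AddCommGroup (fieldSubmodule W))

instance : Module ℂ (FieldSpace W) := inferInstanceAs (Module ℂ (fieldSubmodule W))

/-- The `n`-th mode of a field. -/
def coeff (f : FieldSpace W) (n : ℤ) : Module.End ℂ W := f.1 n

@[ext]
theorem ext {f g : FieldSpace W} (h : ∀ n w, f.coeff n w = g.coeff n w) : f = g :=
  Subtype.ext (funext fun n => LinearMap.ext fun w => h n w)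

@[simp] theorem coeff_add (f g : FieldSpace W) (n : ℤ) (w : W) :
    (f + g).coeff n w = f.coeff n w + g.coeff n w := rfl

@[simp] theorem coeff_sub (f g : FieldSpace W) (n : ℤ) (w : W) :
    (f - g).coeff n w = f.coeff n w - g.coeff n w := rfl

@[simp] theorem coeff_smul (c : ℂ) (f : FieldSpace W) (n : ℤ) (w : W) :
    (c • f).coeff n w = c • f.coeff n w := rfl

@[simp] theorem coeff_zero (n : ℤ) (w : W) : (0 : FieldSpace W).coeff n w = 0 := rfl

theorem exists_bound (f : FieldSpace W) (w : W) : ∃ N : ℤ, ∀ n, N ≤ n → f.coeff n w = 0 := f.2 w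

theorem exists_nat_bound (f : FieldSpace W) (m : ℤ) (w : W) :
    ∃ N : ℕ, ∀ j : ℕ, N ≤ j → f.coeff (m + j) w = 0 := by
  obtain ⟨N, hN⟩ := f.exists_bound w
  exact ⟨(N - m).toNat, fun j hj => hN _ (by omega)⟩

theorem exists_uniform_bound (f : FieldSpace W) (v : ℕ → W) (J : ℕ) :
    ∃ N : ℤ, ∀ j < J, ∀ n, N ≤ n → f.coeff n (v j) = 0 := by
  induction J with
  | zero => exact ⟨0, fun j hj => absurd hj (Nat.not_lt_zero j)⟩
  | succ J ih =>
    obtain ⟨N, hN⟩ := ih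
    obtain ⟨M, hM⟩ := f.exists_bound (v J)
    refine ⟨max N M, fun j hj n hn => ?_⟩
    rcases Nat.lt_succ_iff_lt_or_eq.mp hj with h | h
    · exact hN j h n (le_trans (le_max_left _ _) hn)
    · rw [h]; exact hM n (le_trans (le_max_right _ _) hn)

/-- The identity field `Id_W z^0`. -/
def one (W : Type*) [AddCommGroup W] [Module ℂ W] : FieldSpace W :=
  ⟨fun n => if n = -1 then LinearMap.id else 0, fun w => ⟨0, fun n hn => by
    change (if n = -1 then LinearMap.id else 0 : Module.End ℂ W) w = 0
    rw [if_neg (by omega)]; rfl⟩⟩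

theorem coeff_one (n : ℤ) (w : W) : (one W).coeff n w = if n = -1 then w else 0 := by
  change (if n = -1 then LinearMap.id else 0 : Module.End ℂ W) w = _
  split_ifs <;> rfl

/-- The coefficient `(-1)^j * binom(n, j)`, `n ∈ ℤ`. -/
def sbinom (n : ℤ) (j : ℕ) : ℂ := (-1) ^ j * ((Ring.choose n j : ℤ) : ℂ)

/-- The modes of `Res_{z₁} (z₁ - z)^n a(z₁) b(z)`, expanded in nonnegative powers of `z`:
the `m`-th mode is `∑_{j ≥ 0} (-1)^j binom(n, j) a_{n-j} b_{m+j}`. -/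
def leftCoeff (n : ℤ) (a b : FieldSpace W) (m : ℤ) (w : W) : W :=
  ∑ᶠ j : ℕ, sbinom n j • a.coeff (n - j) (b.coeff (m + j) w)

/-- The modes of `Res_{z₁} (-z + z₁)^n b(z) a(z₁)`, expanded in nonnegative powers of `z₁`:
the `m`-th mode is `∑_{j ≥ 0} (-1)^{n+j} binom(n, j) b_{n+m-j} a_j`. -/
def rightCoeff (n : ℤ) (a b : FieldSpace W) (m : ℤ) (w : W) : W :=
  ∑ᶠ j : ℕ, ((-1 : ℂ) ^ n * sbinom n j) • b.coeff (n + m - j) (a.coeff j w)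

theorem leftCoeff_eq (n : ℤ) (a b : FieldSpace W) (m : ℤ) (w : W) (N : ℕ)
    (hN : ∀ j : ℕ, N ≤ j → b.coeff (m + j) w = 0) :
    leftCoeff n a b m w =
      ∑ j ∈ Finset.range N, sbinom n j • a.coeff (n - j) (b.coeff (m + j) w) :=
  finsum_eq_range N fun j hj => by rw [hN j hj, map_zero, smul_zero]

theorem rightCoeff_eq (n : ℤ) (a b : FieldSpace W) (m : ℤ) (w : W) (N : ℕ)
    (hN : ∀ j : ℕ, N ≤ j → a.coeff j w = 0) :
    rightCoeff n a b m w = ∑ j ∈ Finset.range N,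
      ((-1 : ℂ) ^ n * sbinom n j) • b.coeff (n + m - j) (a.coeff j w) :=
  finsum_eq_range N fun j hj => by rw [hN j hj, map_zero, smul_zero]

theorem exists_nat_bound' (f : FieldSpace W) (w : W) :
    ∃ N : ℕ, ∀ j : ℕ, N ≤ j → f.coeff j w = 0 := by
  simpa using f.exists_nat_bound 0 w

/-- `leftCoeff` as a field. -/
def leftField (n : ℤ) (a b : FieldSpace W) : FieldSpace W :=
  ⟨fun m =>
    { toFun := leftCoeff n a b m
      map_add' := fun w w' => by
        obtain ⟨N, hN⟩ := b.exists_nat_bound m w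
        obtain ⟨M, hM⟩ := b.exists_nat_bound m w'
        have h1 := fun j (hj : max N M ≤ j) => hN j (le_trans (le_max_left _ _) hj)
        have h2 := fun j (hj : max N M ≤ j) => hM j (le_trans (le_max_right _ _) hj)
        rw [leftCoeff_eq n a b m w _ h1, leftCoeff_eq n a b m w' _ h2,
          leftCoeff_eq n a b m (w + w') (max N M)
            (fun j hj => by rw [map_add, h1 j hj, h2 j hj, add_zero]),
          ← Finset.sum_add_distrib]
        exact Finset.sum_congr rfl fun j _ => by simp only [map_add, smul_add]
      map_smul' := fun c w => by
        obtain ⟨N, hN⟩ := b.exists_nat_bound m w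
        rw [leftCoeff_eq n a b m w _ hN, leftCoeff_eq n a b m (c • w) N
            (fun j hj => by rw [map_smul, hN j hj, smul_zero]), Finset.smul_sum]
        exact Finset.sum_congr rfl fun j _ => by
          simp only [map_smul, RingHom.id_apply, smul_comm c] },
    fun w => by
      obtain ⟨N, hN⟩ := b.exists_bound w
      refine ⟨N, fun m hm => ?_⟩
      change leftCoeff n a b m w = 0
      rw [leftCoeff_eq n a b m w 0 (fun j _ => hN _ (by omega)), Finset.sum_range_zero]⟩

/-- `rightCoeff` as a field. -/
def rightField (n : ℤ) (a b : FieldSpace W) : FieldSpace W :=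
  ⟨fun m =>
    { toFun := rightCoeff n a b m
      map_add' := fun w w' => by
        obtain ⟨N, hN⟩ := a.exists_nat_bound' w
        obtain ⟨M, hM⟩ := a.exists_nat_bound' w'
        have h1 := fun j (hj : max N M ≤ j) => hN j (le_trans (le_max_left _ _) hj)
        have h2 := fun j (hj : max N M ≤ j) => hM j (le_trans (le_max_right _ _) hj)
        rw [rightCoeff_eq n a b m w _ h1, rightCoeff_eq n a b m w' _ h2,
          rightCoeff_eq n a b m (w + w') (max N M)
            (fun j hj => by rw [map_add, h1 j hj, h2 j hj, add_zero]),
          ← Finset.sum_add_distrib]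
        exact Finset.sum_congr rfl fun j _ => by simp only [map_add, smul_add]
      map_smul' := fun c w => by
        obtain ⟨N, hN⟩ := a.exists_nat_bound' w
        rw [rightCoeff_eq n a b m w _ hN, rightCoeff_eq n a b m (c • w) N
            (fun j hj => by rw [map_smul, hN j hj, smul_zero]), Finset.smul_sum]
        exact Finset.sum_congr rfl fun j _ => by
          simp only [map_smul, RingHom.id_apply, smul_comm c] },
    fun w => by
      obtain ⟨J, hJ⟩ := a.exists_nat_bound' w
      obtain ⟨N, hN⟩ := b.exists_uniform_bound (fun j => a.coeff j w) J
      refine ⟨N - n + J, fun m hm => ?_⟩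
      change rightCoeff n a b m w = 0
      rw [rightCoeff_eq n a b m w J hJ]
      refine Finset.sum_eq_zero fun j hj => ?_
      have hj' := Finset.mem_range.mp hj
      rw [hN j hj' _ (by omega), smul_zero]⟩

theorem coeff_leftField (n : ℤ) (a b : FieldSpace W) (m : ℤ) (w : W) :
    (leftField n a b).coeff m w = leftCoeff n a b m w := rfl

theorem coeff_rightField (n : ℤ) (a b : FieldSpace W) (m : ℤ) (w : W) :
    (rightField n a b).coeff m w = rightCoeff n a b m w := rfl

/-- `leftField` as a bilinear map. -/
def left (n : ℤ) : FieldSpace W →ₗ[ℂ] FieldSpace W →ₗ[ℂ] FieldSpace W :=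
  LinearMap.mk₂ ℂ (leftField n)
    (fun a a' b => by
      ext m w
      obtain ⟨N, hN⟩ := b.exists_nat_bound m w
      simp only [coeff_add, coeff_leftField, leftCoeff_eq n _ b m w N hN,
        ← Finset.sum_add_distrib, smul_add])
    (fun c a b => by
      ext m w
      obtain ⟨N, hN⟩ := b.exists_nat_bound m w
      simp only [coeff_smul, coeff_leftField, leftCoeff_eq n _ b m w N hN,
        Finset.smul_sum, smul_comm c])
    (fun a b b' => by
      ext m w
      obtain ⟨N, hN⟩ := b.exists_nat_bound m w
      obtain ⟨M, hM⟩ := b'.exists_nat_bound m w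
      have h1 := fun j (hj : max N M ≤ j) => hN j (le_trans (le_max_left _ _) hj)
      have h2 := fun j (hj : max N M ≤ j) => hM j (le_trans (le_max_right _ _) hj)
      rw [coeff_add, coeff_leftField, coeff_leftField, coeff_leftField,
        leftCoeff_eq n a b m w _ h1, leftCoeff_eq n a b' m w _ h2,
        leftCoeff_eq n a (b + b') m w (max N M)
          (fun j hj => by rw [coeff_add, h1 j hj, h2 j hj, add_zero]),
        ← Finset.sum_add_distrib]
      exact Finset.sum_congr rfl fun j _ => by simp only [coeff_add, map_add, smul_add])
    (fun c a b => by
      ext m w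
      obtain ⟨N, hN⟩ := b.exists_nat_bound m w
      rw [coeff_smul, coeff_leftField, coeff_leftField, leftCoeff_eq n a b m w N hN,
        leftCoeff_eq n a (c • b) m w N
          (fun j hj => by rw [coeff_smul, hN j hj, smul_zero]), Finset.smul_sum]
      exact Finset.sum_congr rfl fun j _ => by simp only [coeff_smul, map_smul, smul_comm c])

/-- `rightField` as a bilinear map. -/
def right (n : ℤ) : FieldSpace W →ₗ[ℂ] FieldSpace W →ₗ[ℂ] FieldSpace W :=
  LinearMap.mk₂ ℂ (rightField n)
    (fun a a' b => by
      ext m w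
      obtain ⟨N, hN⟩ := a.exists_nat_bound' w
      obtain ⟨M, hM⟩ := a'.exists_nat_bound' w
      have h1 := fun j (hj : max N M ≤ j) => hN j (le_trans (le_max_left _ _) hj)
      have h2 := fun j (hj : max N M ≤ j) => hM j (le_trans (le_max_right _ _) hj)
      rw [coeff_add, coeff_rightField, coeff_rightField, coeff_rightField,
        rightCoeff_eq n a b m w _ h1, rightCoeff_eq n a' b m w _ h2,
        rightCoeff_eq n (a + a') b m w (max N M)
          (fun j hj => by rw [coeff_add, h1 j hj, h2 j hj, add_zero]),
        ← Finset.sum_add_distrib]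
      exact Finset.sum_congr rfl fun j _ => by simp only [coeff_add, map_add, smul_add])
    (fun c a b => by
      ext m w
      obtain ⟨N, hN⟩ := a.exists_nat_bound' w
      rw [coeff_smul, coeff_rightField, coeff_rightField, rightCoeff_eq n a b m w N hN,
        rightCoeff_eq n (c • a) b m w N
          (fun j hj => by rw [coeff_smul, hN j hj, smul_zero]), Finset.smul_sum]
      exact Finset.sum_congr rfl fun j _ => by simp only [coeff_smul, map_smul, smul_comm c])
    (fun a b b' => by
      ext m w
      obtain ⟨N, hN⟩ := a.exists_nat_bound' w
      simp only [coeff_add, coeff_rightField, rightCoeff_eq n a _ m w N hN,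
        ← Finset.sum_add_distrib, smul_add])
    (fun c a b => by
      ext m w
      obtain ⟨N, hN⟩ := a.exists_nat_bound' w
      simp only [coeff_smul, coeff_rightField, rightCoeff_eq n a _ m w N hN,
        Finset.smul_sum, smul_comm c])

/-- The `n`-th residue product `a(z)_n b(z)`, equal to
`Res_{z₁} ((z₁ - z)^n a(z₁) b(z) - (-z + z₁)^n b(z) a(z₁))`. -/
def resProd (n : ℤ) : FieldSpace W →ₗ[ℂ] FieldSpace W →ₗ[ℂ] FieldSpace W :=
  left n - right n

theorem coeff_left (n : ℤ) (a b : FieldSpace W) (m : ℤ) (w : W) :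
    (left n a b).coeff m w = leftCoeff n a b m w := rfl

theorem coeff_right (n : ℤ) (a b : FieldSpace W) (m : ℤ) (w : W) :
    (right n a b).coeff m w = rightCoeff n a b m w := rfl

theorem coeff_resProd (n : ℤ) (a b : FieldSpace W) (m : ℤ) (w : W) :
    (resProd n a b).coeff m w = leftCoeff n a b m w - rightCoeff n a b m w := rfl

end FieldSpace

namespace FieldSpace

variable {W : Type*} [AddCommGroup W] [Module ℂ W]

theorem vandermonde_aux (m n : ℤ) (s : ℕ) (h : m + n = s) :
    ∑ p ∈ Finset.HasAntidiagonal.antidiagonal s,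
      (m - p.1) * Ring.choose m p.1 * Ring.choose n p.2 = if s = 0 then m else 0 := by
  have h1 : ∀ i : ℕ, (m - i) * Ring.choose m i = m * Ring.choose (m - 1) i := by
    intro i
    have e1 := Ring.choose_smul_choose m (Nat.le_succ i)
    have e2 := Ring.choose_smul_choose m (Nat.succ_le_succ (Nat.zero_le i))
    simp at e1 e2
    linear_combination e2 - e1
  have h2 : ∀ p ∈ Finset.HasAntidiagonal.antidiagonal s,
      (m - p.1) * Ring.choose m p.1 * Ring.choose n p.2
        = m * (Ring.choose (m - 1) p.1 * Ring.choose n p.2) := by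
    intro p _
    rw [h1, mul_assoc]
  rw [Finset.sum_congr rfl h2, ← Finset.mul_sum, ← Ring.add_choose_eq s (Commute.all _ _)]
  rcases Nat.eq_zero_or_pos s with hs | hs
  · subst hs; simp
  · rw [if_neg (by omega)]
    have : m - 1 + n = ((s - 1 : ℕ) : ℤ) := by omega
    rw [this, Ring.choose_natCast, Nat.choose_eq_zero_of_lt (by omega)]
    simp

theorem left_left (a b c : FieldSpace W) (κ : ℂ)
    (hab : ∀ (m n : ℤ) (w : W), a.coeff m (b.coeff n w) - b.coeff n (a.coeff m w)
      = if m + n = 0 then ((m : ℂ) * κ) • w else 0) (m n : ℤ) :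
    left m a (left n b c) - left n b (left m a c)
      = if m + n = 0 then ((m : ℂ) * κ) • c else 0 := by
  ext k w
  obtain ⟨N, hN⟩ := c.exists_nat_bound k w
  have expand : ∀ (m n : ℤ) (a b : FieldSpace W), (left m a (left n b c)).coeff k w =
      ∑ i ∈ Finset.range N, ∑ j ∈ Finset.range N, (sbinom m i * sbinom n j) •
        a.coeff (m - i) (b.coeff (n - j) (c.coeff (k + i + j) w)) := by
    intro m n a b
    have hb : ∀ i : ℕ, (left n b c).coeff (k + i) w = ∑ j ∈ Finset.range N,
        sbinom n j • b.coeff (n - j) (c.coeff (k + i + j) w) := fun i =>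
      leftCoeff_eq n b c (k + i) w N fun j hj => by
        have := hN (i + j) (by omega)
        rwa [show k + ((i + j : ℕ) : ℤ) = k + i + j by push_cast; ring] at this
    rw [coeff_left, leftCoeff_eq m a (left n b c) k w N]
    · refine Finset.sum_congr rfl fun i _ => ?_
      rw [hb, map_sum, Finset.smul_sum]
      refine Finset.sum_congr rfl fun j _ => ?_
      rw [map_smul, smul_smul]
    · intro i hi
      rw [hb]
      refine Finset.sum_eq_zero fun j _ => ?_
      have := hN (i + j) (by omega)
      rw [show k + ((i + j : ℕ) : ℤ) = k + i + j by push_cast; ring] at this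
      rw [this, map_zero, smul_zero]
  rw [coeff_sub, expand, expand n m b a, Finset.sum_comm (s := Finset.range N) (t := Finset.range N)
    (f := fun i j => (sbinom n i * sbinom m j) •
        b.coeff (n - i) (a.coeff (m - j) (c.coeff (k + i + j) w))),
    ← Finset.sum_sub_distrib]
  have hterm : ∀ i j : ℕ, (sbinom m i * sbinom n j) •
        a.coeff (m - i) (b.coeff (n - j) (c.coeff (k + i + j) w)) - (sbinom n j * sbinom m i) •
        b.coeff (n - j) (a.coeff (m - i) (c.coeff (k + j + i) w)) =
      if m + n = ((i + j : ℕ) : ℤ) then (sbinom m i * sbinom n j * (((m - i : ℤ) : ℂ) * κ)) •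
        c.coeff (k + (m + n)) w else 0 := by
    intro i j
    rw [mul_comm (sbinom n j), show k + (j : ℤ) + i = k + i + j by ring, ← smul_sub, hab]
    by_cases h : m + n = ((i + j : ℕ) : ℤ)
    · rw [if_pos h, if_pos (by push_cast at h; omega), smul_smul, h]
      push_cast
      rw [add_assoc]
    · rw [if_neg h, if_neg (by push_cast at h; omega), smul_zero]
  have hsum : ∀ i ∈ Finset.range N, (∑ j ∈ Finset.range N, (sbinom m i * sbinom n j) •
        a.coeff (m - i) (b.coeff (n - j) (c.coeff (k + i + j) w))) -
        (∑ j ∈ Finset.range N, (sbinom n j * sbinom m i) •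
        b.coeff (n - j) (a.coeff (m - i) (c.coeff (k + j + i) w))) =
      ∑ j ∈ Finset.range N, if m + n = ((i + j : ℕ) : ℤ) then
        (sbinom m i * sbinom n j * (((m - i : ℤ) : ℂ) * κ)) • c.coeff (k + (m + n)) w else 0 := by
    intro i _
    rw [← Finset.sum_sub_distrib]
    exact Finset.sum_congr rfl fun j _ => hterm i j
  rw [Finset.sum_congr rfl hsum, ← Finset.sum_product']
  by_cases hneg : m + n < 0
  · rw [if_neg (by omega), coeff_zero]
    refine Finset.sum_eq_zero fun p _ => if_neg (by omega)
  obtain ⟨s, hs⟩ := Int.eq_ofNat_of_zero_le (not_lt.mp hneg)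
  by_cases hsN : N ≤ s
  · have h0 : c.coeff (k + (m + n)) w = 0 := by rw [hs]; exact hN s hsN
    rw [Finset.sum_eq_zero]
    · split_ifs with h
      · rw [coeff_smul]
        rw [h, add_zero] at h0
        rw [h0, smul_zero]
      · rfl
    · intro p _
      rw [h0, smul_zero, ite_self]
  · rw [← Finset.sum_filter]
    have hfil : (Finset.range N ×ˢ Finset.range N).filter
        (fun p => m + n = ((p.1 + p.2 : ℕ) : ℤ)) = Finset.HasAntidiagonal.antidiagonal s := by
      ext p
      simp only [Finset.mem_filter, Finset.mem_product, Finset.mem_range, Finset.HasAntidiagonal.mem_antidiagonal]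
      omega
    rw [hfil, ← Finset.sum_smul]
    have hv := vandermonde_aux m n s hs
    have hcoef : ∑ p ∈ Finset.HasAntidiagonal.antidiagonal s,
        sbinom m p.1 * sbinom n p.2 * (((m - p.1 : ℤ) : ℂ) * κ) =
        (-1) ^ s * κ * ((if s = 0 then m else 0 : ℤ) : ℂ) := by
      rw [← hv, Int.cast_sum, Finset.mul_sum]
      refine Finset.sum_congr rfl fun p hp => ?_
      rw [← Finset.HasAntidiagonal.mem_antidiagonal.mp hp, pow_add]
      unfold sbinom
      push_cast
      ring
    rw [hcoef, hs]
    rcases Nat.eq_zero_or_pos s with h0 | h0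
    · subst h0
      simp [mul_comm]
    · rw [if_neg (by omega), if_neg (by omega)]
      simp

theorem left_right (a b c : FieldSpace W) (m n : ℤ) :
    left m a (right n b c) = right n b (left m a c) := by
  ext k w
  obtain ⟨J, hJ⟩ := b.exists_nat_bound' w
  obtain ⟨M, hM⟩ := c.exists_uniform_bound (fun j => b.coeff j w) J
  obtain ⟨N, hN⟩ : ∃ N : ℕ, M - n - k + J ≤ N := ⟨_, Int.self_le_toNat _⟩
  have hR : ∀ i : ℕ, (right n b c).coeff (k + i) w = ∑ j ∈ Finset.range J,
      ((-1 : ℂ) ^ n * sbinom n j) • c.coeff (n + (k + i) - j) (b.coeff j w) := fun i =>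
    rightCoeff_eq n b c (k + i) w J hJ
  rw [coeff_left, leftCoeff_eq m a (right n b c) k w N, coeff_right,
    rightCoeff_eq n b (left m a c) k w J hJ]
  · have e1 : ∀ i ∈ Finset.range N, sbinom m i • a.coeff (m - i) ((right n b c).coeff (k + i) w) =
        ∑ j ∈ Finset.range J, (sbinom m i * ((-1 : ℂ) ^ n * sbinom n j)) •
          a.coeff (m - i) (c.coeff (n + k - j + i) (b.coeff j w)) := by
      intro i _
      rw [hR, map_sum, Finset.smul_sum]
      refine Finset.sum_congr rfl fun j _ => ?_
      rw [map_smul, smul_smul, show n + (k + (i : ℤ)) - j = n + k - j + i by ring]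
    rw [Finset.sum_congr rfl e1, Finset.sum_comm]
    refine Finset.sum_congr rfl fun j hj => ?_
    have hj' := Finset.mem_range.mp hj
    rw [coeff_left, leftCoeff_eq m a c (n + k - j) (b.coeff j w) N
      (fun i hi => hM j hj' _ (by omega)), Finset.smul_sum]
    refine Finset.sum_congr rfl fun i _ => ?_
    rw [smul_smul, mul_comm]
  · intro i hi
    rw [hR]
    refine Finset.sum_eq_zero fun j hj => ?_
    have hj' := Finset.mem_range.mp hj
    rw [hM j hj' _ (by omega), smul_zero]

theorem right_right (a b c : FieldSpace W)
    (hab : ∀ (m n : ℕ) (w : W), a.coeff m (b.coeff n w) = b.coeff n (a.coeff m w)) (m n : ℤ) :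
    right m a (right n b c) = right n b (right m a c) := by
  ext k w
  obtain ⟨J, hJ⟩ := a.exists_nat_bound' w
  obtain ⟨L, hL⟩ := b.exists_nat_bound' w
  have e1 : (right m a (right n b c)).coeff k w = ∑ i ∈ Finset.range J, ∑ j ∈ Finset.range L,
      ((-1 : ℂ) ^ m * sbinom m i * ((-1 : ℂ) ^ n * sbinom n j)) •
        c.coeff (n + m + k - i - j) (a.coeff i (b.coeff j w)) := by
    rw [coeff_right, rightCoeff_eq m a _ k w J hJ]
    refine Finset.sum_congr rfl fun i _ => ?_
    rw [coeff_right, rightCoeff_eq n b c _ _ L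
      (fun j hj => by rw [← hab, hL j hj, map_zero]), Finset.smul_sum]
    refine Finset.sum_congr rfl fun j _ => ?_
    rw [smul_smul, hab, show n + (m + k - (i : ℤ)) - j = n + m + k - i - j by ring]
  have e2 : (right n b (right m a c)).coeff k w = ∑ j ∈ Finset.range L, ∑ i ∈ Finset.range J,
      ((-1 : ℂ) ^ m * sbinom m i * ((-1 : ℂ) ^ n * sbinom n j)) •
        c.coeff (n + m + k - i - j) (a.coeff i (b.coeff j w)) := by
    rw [coeff_right, rightCoeff_eq n b _ k w L hL]
    refine Finset.sum_congr rfl fun j _ => ?_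
    rw [coeff_right, rightCoeff_eq m a c _ _ J
      (fun i hi => by rw [hab, hJ i hi, map_zero]), Finset.smul_sum]
    refine Finset.sum_congr rfl fun i _ => ?_
    rw [smul_smul, show m + (n + k - (j : ℤ)) - i = n + m + k - i - j by ring]
    congr 1
    ring
  rw [e1, e2, Finset.sum_comm]

theorem resProd_comm (a b c : FieldSpace W) (κ : ℂ)
    (hab : ∀ (m n : ℤ) (w : W), a.coeff m (b.coeff n w) - b.coeff n (a.coeff m w)
      = if m + n = 0 then ((m : ℂ) * κ) • w else 0) (m n : ℤ) :
    resProd m a (resProd n b c) - resProd n b (resProd m a c)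
      = if m + n = 0 then ((m : ℂ) * κ) • c else 0 := by
  have hR := right_right a b c (fun i j w => by
    have := hab i j w
    rw [← sub_eq_zero, this]
    split_ifs with h
    · have : i = 0 := by omega
      subst this
      simp
    · rfl) m n
  rw [← left_left a b c κ hab m n]
  simp only [resProd, LinearMap.sub_apply, map_sub]
  rw [left_right a b c, ← left_right b a c, hR]
  abel

theorem resProd_one (a : FieldSpace W) (n : ℤ) (hn : 0 ≤ n) : resProd n a (one W) = 0 := by
  ext m w
  obtain ⟨s, rfl⟩ := Int.eq_ofNat_of_zero_le hn
  rw [coeff_resProd, coeff_zero]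
  have hL : leftCoeff (s : ℤ) a (one W) m w =
      if m ≤ -1 then sbinom s (-1 - m).toNat • a.coeff (s + m + 1) w else 0 := by
    unfold leftCoeff
    split_ifs with h
    · rw [finsum_eq_single _ (-1 - m).toNat]
      · rw [coeff_one, if_pos (by omega), show (s : ℤ) - ((-1 - m).toNat : ℤ) = s + m + 1 by omega]
      · intro j hj
        rw [coeff_one, if_neg (by omega), map_zero, smul_zero]
    · apply finsum_eq_zero_of_forall_eq_zero
      intro j
      rw [coeff_one, if_neg (by omega), map_zero, smul_zero]
  have hR : rightCoeff (s : ℤ) a (one W) m w =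
      if 0 ≤ s + m + 1 then ((-1 : ℂ) ^ (s : ℤ) * sbinom s (s + m + 1).toNat) •
        a.coeff (s + m + 1) w else 0 := by
    unfold rightCoeff
    split_ifs with h
    · rw [finsum_eq_single _ ((s : ℤ) + m + 1).toNat]
      · rw [coeff_one, if_pos (by omega), Int.toNat_of_nonneg h]
      · intro j hj
        rw [coeff_one, if_neg (by omega), smul_zero]
    · apply finsum_eq_zero_of_forall_eq_zero
      intro j
      rw [coeff_one, if_neg (by omega), smul_zero]
  rw [hL, hR]
  have hz : ∀ j : ℕ, s < j → sbinom s j = 0 := by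
    intro j hj
    rw [sbinom, Ring.choose_natCast, Nat.choose_eq_zero_of_lt hj]
    simp
  by_cases h1 : m ≤ -1
  · rw [if_pos h1]
    by_cases h2 : 0 ≤ (s : ℤ) + m + 1
    · rw [if_pos h2]
      obtain ⟨p, hp⟩ : ∃ p : ℕ, m = -1 - p := ⟨(-1 - m).toNat, by omega⟩
      obtain ⟨q, hq⟩ : ∃ q : ℕ, s = p + q := ⟨s - p, by omega⟩
      subst hp hq
      have e1 : (-1 - (-1 - (p : ℤ))).toNat = p := by omega
      have e2 : (((p + q : ℕ) : ℤ) + (-1 - p) + 1).toNat = q := by omega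
      rw [e1, e2, ← sub_smul, sbinom, sbinom, Ring.choose_natCast, Ring.choose_natCast,
        Nat.choose_symm_add, zpow_natCast, pow_add]
      have hq : ((-1 : ℂ) ^ q) * (-1) ^ q = 1 := by rw [← mul_pow]; simp
      rw [show (-1 : ℂ) ^ p * ((((p + q).choose q : ℕ) : ℤ) : ℂ)
          - (-1) ^ p * (-1) ^ q * ((-1) ^ q * ((((p + q).choose q : ℕ) : ℤ) : ℂ)) = 0 by
        linear_combination (-(-1 : ℂ) ^ p * ((((p + q).choose q : ℕ) : ℤ) : ℂ)) * hq, zero_smul]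
    · rw [if_neg h2, hz _ (by omega), zero_smul, sub_zero]
  · rw [if_neg h1, if_pos (by omega), hz _ (by omega), mul_zero, zero_smul, sub_zero]

end FieldSpace

/-! ## The state-field correspondence -/

/-- A restricted level-one action of the Heisenberg Lie algebra on `W`: fields `a(z) = ∑ a(n) z^{-n-1}`
depending linearly on `a ∈ 𝔥`, with `[a(m), b(n)] = m δ_{m+n,0} (a, b)`. -/
structure HeisenbergAction (ℓ : ℕ) (W : Type*) [AddCommGroup W] [Module ℂ W] where
  field : (Fin ℓ → ℂ) →ₗ[ℂ] FieldSpace W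
  comm : ∀ (a b : Fin ℓ → ℂ) (m n : ℤ) (w : W),
    (field a).coeff m ((field b).coeff n w) - (field b).coeff n ((field a).coeff m w)
      = if m + n = 0 then ((m : ℂ) * (a ⬝ᵥ b)) • w else 0

namespace HeisenbergAction

variable {ℓ : ℕ} {W : Type*} [AddCommGroup W] [Module ℂ W] (A : HeisenbergAction ℓ W)

/-- The linear map underlying `fieldRep`. -/
def fieldRepLinear : Heis ℓ →ₗ[ℂ] Module.End ℂ (FieldSpace W) :=
  (Finsupp.lsum ℂ fun n : ℤ => FieldSpace.resProd n ∘ₗ A.field) ∘ₗ Heis.loop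
    + Heis.central.smulRight (1 : Module.End ℂ (FieldSpace W))

theorem fieldRepLinear_apply (x : Heis ℓ) (f : FieldSpace W) :
    A.fieldRepLinear x f =
      (∑ n ∈ (Heis.loop x).support, FieldSpace.resProd n (A.field (Heis.loop x n)) f)
        + Heis.central x • f := by
  simp [fieldRepLinear, Finsupp.sum, LinearMap.sum_apply]

theorem fieldRepLinear_mode (n : ℤ) (a : Fin ℓ → ℂ) :
    A.fieldRepLinear (Heis.mode n a) = FieldSpace.resProd n (A.field a) := by
  simp [fieldRepLinear]

theorem fieldRepLinear_K : A.fieldRepLinear Heis.K = 1 := by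
  simp [fieldRepLinear]

theorem fieldRepLinear_lie (x y : Heis ℓ) :
    A.fieldRepLinear ⁅x, y⁆ = ⁅A.fieldRepLinear x, A.fieldRepLinear y⁆ := by
  have hb : ∀ x y : Heis ℓ, A.fieldRepLinear ⁅x, y⁆
      = Heis.cocycle x y • (1 : Module.End ℂ (FieldSpace W)) := fun x y => by
    rw [Heis.bracket_def, map_smul, fieldRepLinear_K]
  induction x using Heis.induction with
  | hK => rw [hb, fieldRepLinear_K]; simp [LieRing.of_associative_ring_bracket]
  | ha x x' h h' => rw [add_lie, map_add, h, h', map_add, add_lie]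
  | hs c x h => rw [smul_lie, map_smul, h, map_smul, smul_lie]
  | hm m a =>
    induction y using Heis.induction with
    | hK => rw [hb, fieldRepLinear_K]; simp [LieRing.of_associative_ring_bracket]
    | ha x x' h h' => rw [lie_add, map_add, h, h', map_add, lie_add]
    | hs c x h => rw [lie_smul, map_smul, h, map_smul, lie_smul]
    | hm n b =>
      rw [hb, fieldRepLinear_mode, fieldRepLinear_mode, Heis.cocycle_mode_mode,
        LieRing.of_associative_ring_bracket]
      apply LinearMap.ext
      intro f
      have := FieldSpace.resProd_comm (A.field a) (A.field b) f (a ⬝ᵥ b) (A.comm a b) m n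
      rw [LinearMap.sub_apply, Module.End.mul_apply, Module.End.mul_apply, this]
      split_ifs <;> simp

/-- The representation of the Heisenberg Lie algebra on fields for which `a(n)` acts by the residue
product `f(z) ↦ a(z)_n f(z)` and `K` acts as the identity. -/
def fieldRep : Heis ℓ →ₗ⁅ℂ⁆ Module.End ℂ (FieldSpace W) :=
  { A.fieldRepLinear with map_lie' := fun {x y} => A.fieldRepLinear_lie x y }

/-- The map `u ↦ u · Id_W` from `U(ĥ)` to fields. -/
def preY : UniversalEnvelopingAlgebra ℂ (Heis ℓ) →ₗ[ℂ] FieldSpace W :=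
  LinearMap.applyₗ (FieldSpace.one W) ∘ₗ
    (UniversalEnvelopingAlgebra.lift ℂ A.fieldRep).toLinearMap

theorem preY_mul (u v : UniversalEnvelopingAlgebra ℂ (Heis ℓ)) :
    A.preY (u * v) = UniversalEnvelopingAlgebra.lift ℂ A.fieldRep u (A.preY v) := by
  simp [preY]

theorem preY_gen (x : Heis.nonneg ℓ) :
    A.preY (UniversalEnvelopingAlgebra.ι ℂ (x : Heis ℓ)
      - algebraMap ℂ _ (whittakerFunction (0 : ℕ →₀ (Fin ℓ → ℂ)) x)) = 0 := by
  have h1 : A.preY (UniversalEnvelopingAlgebra.ι ℂ (x : Heis ℓ))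
      = Heis.central (x : Heis ℓ) • FieldSpace.one W := by
    change UniversalEnvelopingAlgebra.lift ℂ A.fieldRep
      (UniversalEnvelopingAlgebra.ι ℂ (x : Heis ℓ)) (FieldSpace.one W) = _
    rw [UniversalEnvelopingAlgebra.lift_ι_apply]
    change A.fieldRepLinear x (FieldSpace.one W) = _
    rw [fieldRepLinear_apply, Finset.sum_eq_zero, zero_add]
    intro n hn
    refine FieldSpace.resProd_one _ n ?_
    by_contra hc
    exact Finsupp.mem_support_iff.mp hn (x.2 n (not_le.mp hc))
  have h2 : A.preY (algebraMap ℂ _ (whittakerFunction (0 : ℕ →₀ (Fin ℓ → ℂ)) x))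
      = Heis.central (x : Heis ℓ) • FieldSpace.one W := by
    change UniversalEnvelopingAlgebra.lift ℂ A.fieldRep (algebraMap ℂ _ _) (FieldSpace.one W) = _
    rw [AlgHom.commutes]
    simp [whittakerFunction]
  rw [map_sub, h1, h2, sub_self]

theorem preY_ideal (u : UniversalEnvelopingAlgebra ℂ (Heis ℓ))
    (hu : u ∈ whittakerIdeal (whittakerFunction (0 : ℕ →₀ (Fin ℓ → ℂ)))) : A.preY u = 0 := by
  unfold whittakerIdeal at hu
  induction hu using Submodule.span_induction with
  | mem u h => obtain ⟨x, rfl⟩ := h; exact A.preY_gen x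
  | zero => exact map_zero _
  | add u v _ _ h h' => rw [map_add, h, h', add_zero]
  | smul r u _ h => rw [smul_eq_mul, preY_mul, h, map_zero]

/-- The vertex operators `Y_W : M(1) → {fields on W}`, determined by
`Y_W(a¹(n₁) ⋯ aʳ(n_r) 𝟏, z) = a¹(z)_{n₁} ⋯ aʳ(z)_{n_r} Id_W`. -/
def Y : M1 ℓ →ₗ[ℂ] FieldSpace W :=
  ((whittakerIdeal (whittakerFunction (0 : ℕ →₀ (Fin ℓ → ℂ)))).restrictScalars ℂ).liftQ A.preY
      (fun u hu => A.preY_ideal u hu)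
    ∘ₗ (Submodule.Quotient.restrictScalarsEquiv ℂ _).symm.toLinearMap

theorem Y_vacuum : A.Y (M1.vacuum ℓ) = FieldSpace.one W := by
  change A.preY 1 = _
  simp [preY]

theorem Y_mode (a : Fin ℓ → ℂ) (n : ℤ) (v : M1 ℓ) :
    A.Y (UniversalEnvelopingAlgebra.ι ℂ (Heis.mode n a) • v)
      = FieldSpace.resProd n (A.field a) (A.Y v) := by
  induction v using Submodule.Quotient.induction_on with
  | H u =>
    change A.preY (UniversalEnvelopingAlgebra.ι ℂ (Heis.mode n a) * u) = _
    rw [preY_mul, UniversalEnvelopingAlgebra.lift_ι_apply]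
    change A.fieldRepLinear _ _ = _
    rw [fieldRepLinear_mode]
    rfl

end HeisenbergAction

/-! ## The vertex operators on `M(1)` and `M(1, λ)` -/

/-- `U(L)` is generated by `L`. -/
theorem uea_induction {L : Type*} [LieRing L] [LieAlgebra ℂ L]
    {p : UniversalEnvelopingAlgebra ℂ L → Prop}
    (halg : ∀ c : ℂ, p (algebraMap ℂ _ c)) (hι : ∀ x : L, p (UniversalEnvelopingAlgebra.ι ℂ x))
    (hmul : ∀ u v, p u → p v → p (u * v)) (hadd : ∀ u v, p u → p v → p (u + v))
    (u : UniversalEnvelopingAlgebra ℂ L) : p u := by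
  let S : Subalgebra ℂ (UniversalEnvelopingAlgebra ℂ L) :=
    { carrier := {u | p u}
      mul_mem' := fun {a b} ha hb => hmul a b ha hb
      add_mem' := fun {a b} ha hb => hadd a b ha hb
      algebraMap_mem' := halg }
  let f : L →ₗ⁅ℂ⁆ S :=
    { toFun := fun x => ⟨UniversalEnvelopingAlgebra.ι ℂ x, hι x⟩
      map_add' := fun x y => Subtype.ext (map_add _ x y)
      map_smul' := fun c x => Subtype.ext (map_smul _ c x)
      map_lie' := fun {x y} => Subtype.ext (LieHom.map_lie _ x y) }
  have h : S.val.comp (UniversalEnvelopingAlgebra.lift ℂ f) = AlgHom.id ℂ _ := by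
    apply UniversalEnvelopingAlgebra.hom_ext
    ext x
    change ((UniversalEnvelopingAlgebra.lift ℂ f (UniversalEnvelopingAlgebra.ι ℂ x) : S) :
      UniversalEnvelopingAlgebra ℂ L) = UniversalEnvelopingAlgebra.ι ℂ x
    rw [UniversalEnvelopingAlgebra.lift_ι_apply]
    rfl
  have h2 := DFunLike.congr_fun h u
  have h3 : p (S.val (UniversalEnvelopingAlgebra.lift ℂ f u)) :=
    (UniversalEnvelopingAlgebra.lift ℂ f u).2
  rwa [show S.val (UniversalEnvelopingAlgebra.lift ℂ f u) = u from h2] at h3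

namespace WhittakerM1

variable {ℓ : ℕ} (lam : ℕ →₀ (Fin ℓ → ℂ))

theorem K_smul (w : WhittakerM1 lam) :
    UniversalEnvelopingAlgebra.ι ℂ (Heis.K : Heis ℓ) • w = w := by
  induction w using Submodule.Quotient.induction_on with
  | H u =>
    have hcomm : UniversalEnvelopingAlgebra.ι ℂ (Heis.K : Heis ℓ) * u
        = u * UniversalEnvelopingAlgebra.ι ℂ (Heis.K : Heis ℓ) := by
      induction u using uea_induction with
      | halg c => exact (Algebra.commutes c _).symm
      | hι x =>
        have h := LieHom.map_lie (UniversalEnvelopingAlgebra.ι ℂ) (Heis.K : Heis ℓ) x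
        rw [Heis.bracket_def, Heis.cocycle_K_left, zero_smul, map_zero,
          LieRing.of_associative_ring_bracket] at h
        exact (sub_eq_zero.mp h.symm)
      | hmul u v h h' => rw [← mul_assoc, h, mul_assoc, h', mul_assoc]
      | hadd u v h h' => rw [mul_add, h, h', add_mul]
    have hK : (Heis.K : Heis ℓ) ∈ Heis.nonneg ℓ := fun m _ => by simp
    have hmem : UniversalEnvelopingAlgebra.ι ℂ (Heis.K : Heis ℓ) - 1
        ∈ whittakerIdeal (whittakerFunction lam) := by
      have : UniversalEnvelopingAlgebra.ι ℂ (Heis.K : Heis ℓ)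
          - algebraMap ℂ _ (whittakerFunction lam ⟨Heis.K, hK⟩)
          ∈ whittakerIdeal (whittakerFunction lam) := Submodule.subset_span ⟨⟨Heis.K, hK⟩, rfl⟩
      simpa [whittakerFunction, Finsupp.sum] using this
    rw [← Submodule.Quotient.mk_smul, Submodule.Quotient.eq, smul_eq_mul, hcomm]
    have h := Submodule.smul_mem _ u hmem
    rwa [smul_eq_mul, mul_sub, mul_one] at h

theorem lie_smul' (x y : Heis ℓ) (w : WhittakerM1 lam) :
    UniversalEnvelopingAlgebra.ι ℂ x • UniversalEnvelopingAlgebra.ι ℂ y • w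
      - UniversalEnvelopingAlgebra.ι ℂ y • UniversalEnvelopingAlgebra.ι ℂ x • w
      = Heis.cocycle x y • w := by
  have h := LieHom.map_lie (UniversalEnvelopingAlgebra.ι ℂ) x y
  rw [Heis.bracket_def, map_smul, LieRing.of_associative_ring_bracket] at h
  rw [← mul_smul, ← mul_smul, ← sub_smul, ← h, smul_assoc, K_smul]

theorem truncation (w : WhittakerM1 lam) :
    ∃ N : ℤ, ∀ n, N ≤ n → ∀ a : Fin ℓ → ℂ,
      UniversalEnvelopingAlgebra.ι ℂ (Heis.mode n a) • w = 0 := by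
  have key : ∀ (u : UniversalEnvelopingAlgebra ℂ (Heis ℓ)) (w : WhittakerM1 lam),
      (∃ N : ℤ, ∀ n, N ≤ n → ∀ a : Fin ℓ → ℂ,
        UniversalEnvelopingAlgebra.ι ℂ (Heis.mode n a) • w = 0) →
      ∃ N : ℤ, ∀ n, N ≤ n → ∀ a : Fin ℓ → ℂ,
        UniversalEnvelopingAlgebra.ι ℂ (Heis.mode n a) • u • w = 0 := by
    intro u
    induction u using uea_induction with
    | halg c =>
      rintro w ⟨N, hN⟩
      refine ⟨N, fun n hn a => ?_⟩
      rw [← mul_smul, ← Algebra.commutes, mul_smul, hN n hn a, smul_zero]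
    | hmul u v hu hv =>
      intro w hw
      have := hu _ (hv w hw)
      simpa only [mul_smul] using this
    | hadd u v hu hv =>
      intro w hw
      obtain ⟨N, hN⟩ := hu w hw
      obtain ⟨M, hM⟩ := hv w hw
      refine ⟨max N M, fun n hn a => ?_⟩
      rw [add_smul, smul_add, hN n (le_trans (le_max_left _ _) hn),
        hM n (le_trans (le_max_right _ _) hn), add_zero]
    | hι x =>
      rintro w ⟨N, hN⟩
      obtain ⟨M, hM⟩ : ∃ M : ℤ, ∀ n, M ≤ n → Heis.loop x (-n) = 0 := by
        obtain ⟨B, hB⟩ := (Heis.loop x).support.bddBelow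
        refine ⟨-B + 1, fun n hn => ?_⟩
        by_contra hc
        have := hB (Finsupp.mem_support_iff.mpr hc)
        omega
      refine ⟨max N M, fun n hn a => ?_⟩
      have h := lie_smul' lam (Heis.mode n a) x w
      have hc : Heis.cocycle (Heis.mode n a) x = 0 := by
        unfold Heis.cocycle
        rw [Heis.loop_mode, Finsupp.sum_single_index (by simp),
          hM n (le_trans (le_max_right _ _) hn)]
        simp
      rw [hc, zero_smul, hN n (le_trans (le_max_left _ _) hn), smul_zero, sub_zero] at h
      exact h
  induction w using Submodule.Quotient.induction_on with
  | H u =>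
    have hgen : ∃ N : ℤ, ∀ n, N ≤ n → ∀ a : Fin ℓ → ℂ,
        UniversalEnvelopingAlgebra.ι ℂ (Heis.mode n a) • whittakerGen (whittakerFunction lam)
          = 0 := by
      obtain ⟨B, hB⟩ := lam.support.bddAbove
      refine ⟨B + 1, fun n hn a => ?_⟩
      have hmem : Heis.mode n a ∈ Heis.nonneg ℓ := by
        intro m hm
        rw [Heis.loop_mode, Finsupp.single_apply, if_neg (by omega)]
      have h0 : whittakerFunction lam ⟨Heis.mode n a, hmem⟩ = 0 := by
        change (lam.sum fun m v => Heis.loop (Heis.mode n a) (m : ℤ) ⬝ᵥ v)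
          + Heis.central (Heis.mode n a) = 0
        rw [Heis.central_mode, add_zero]
        refine Finset.sum_eq_zero fun m hm => ?_
        have := hB hm
        beta_reduce
        rw [Heis.loop_mode, Finsupp.single_apply, if_neg (by omega), zero_dotProduct]
      have : UniversalEnvelopingAlgebra.ι ℂ (Heis.mode n a)
          - algebraMap ℂ _ (whittakerFunction lam ⟨Heis.mode n a, hmem⟩)
          ∈ whittakerIdeal (whittakerFunction lam) := Submodule.subset_span ⟨⟨_, hmem⟩, rfl⟩
      rw [h0, map_zero, sub_zero] at this
      rw [whittakerGen, ← Submodule.Quotient.mk_smul, smul_eq_mul, mul_one]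
      exact (Submodule.Quotient.mk_eq_zero _).mpr this
    have h := key u _ hgen
    rwa [whittakerGen, ← Submodule.Quotient.mk_smul, smul_eq_mul, mul_one] at h

/-- The operator `a(n)` on `M(1, λ)`, depending linearly on `a`. -/
def modeOp (n : ℤ) : (Fin ℓ → ℂ) →ₗ[ℂ] Module.End ℂ (WhittakerM1 lam) :=
  (Algebra.lsmul ℂ ℂ (WhittakerM1 lam)).toLinearMap ∘ₗ
    (UniversalEnvelopingAlgebra.ι ℂ : Heis ℓ →ₗ⁅ℂ⁆ _).toLinearMap ∘ₗ Heis.mode n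

/-- The action of the Heisenberg Lie algebra on the induced module `M(1, λ)`. -/
def action : HeisenbergAction ℓ (WhittakerM1 lam) where
  field :=
    { toFun := fun a => ⟨fun n => modeOp lam n a, fun w => by
        obtain ⟨N, hN⟩ := truncation lam w
        exact ⟨N, fun n hn => hN n hn a⟩⟩
      map_add' := fun a b => Subtype.ext (funext fun n => map_add (modeOp lam n) a b)
      map_smul' := fun c a => Subtype.ext (funext fun n => map_smul (modeOp lam n) c a) }
  comm := fun a b m n w => by
    have h := lie_smul' lam (Heis.mode m a) (Heis.mode n b) w
    rw [Heis.cocycle_mode_mode] at h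
    refine Eq.trans h ?_
    split_ifs
    · rfl
    · exact zero_smul _ _

theorem action_coeff (a : Fin ℓ → ℂ) (n : ℤ) (w : WhittakerM1 lam) :
    ((action lam).field a).coeff n w = UniversalEnvelopingAlgebra.ι ℂ (Heis.mode n a) • w := rfl

/-- The vertex operators of `M(1)` on `M(1, λ)`. -/
def Y : M1 ℓ →ₗ[ℂ] FieldSpace (WhittakerM1 lam) := (action lam).Y

end WhittakerM1

/-- The vertex operators `Y(v, z)`, `v ∈ M(1)`, of the vertex algebra `M(1)`. -/
def M1.Y (ℓ : ℕ) : M1 ℓ →ₗ[ℂ] FieldSpace (M1 ℓ) := WhittakerM1.Y 0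

/-! ## The orthogonal group and orbifolds -/

/-- The orthogonal group `O(ℓ)` of the form `(·, ·)` on `𝔥 = ℂ^ℓ`. -/
def OrthGroup (ℓ : ℕ) : Subgroup ((Fin ℓ → ℂ) ≃ₗ[ℂ] (Fin ℓ → ℂ)) where
  carrier := {g | ∀ a b, g a ⬝ᵥ g b = a ⬝ᵥ b}
  one_mem' := fun _ _ => rfl
  mul_mem' := fun {g h} hg hh a b => by
    change g (h a) ⬝ᵥ g (h b) = _
    rw [hg, hh]
  inv_mem' := fun {g} hg a b => by
    have h := hg (g⁻¹ a) (g⁻¹ b)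
    have e : ∀ c, g (g⁻¹ c) = c := fun c => LinearEquiv.apply_symm_apply g c
    rw [e, e] at h
    exact h.symm

namespace OrthGroup

variable {ℓ : ℕ}

/-- The element `-1`. -/
def negOne (ℓ : ℕ) : OrthGroup ℓ := ⟨LinearEquiv.neg ℂ, fun a b => by simp⟩

/-- The embedding `S_ℓ ⊆ O(ℓ)`: the permutation `σ` sends `h_i` to `h_{σ(i)}`. -/
def perm (σ : Equiv.Perm (Fin ℓ)) : OrthGroup ℓ :=
  ⟨LinearEquiv.funCongrLeft ℂ ℂ σ.symm, fun a b => by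
    change ∑ i, a (σ.symm i) * b (σ.symm i) = ∑ i, a i * b i
    exact Equiv.sum_comp σ.symm fun i => a i * b i⟩

theorem perm_single (σ : Equiv.Perm (Fin ℓ)) (i : Fin ℓ) :
    (perm σ).1 (Pi.single i 1) = Pi.single (σ i) 1 := by
  change (Pi.single i (1 : ℂ) : Fin ℓ → ℂ) ∘ σ.symm = Pi.single (σ i) 1
  funext j
  simp [Pi.single_apply, Equiv.symm_apply_eq]

/-- The linear map underlying `heisMap`. -/
def heisMapLinear (g : OrthGroup ℓ) : Heis ℓ →ₗ[ℂ] Heis ℓ :=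
  Heis.ofLoop ∘ₗ Finsupp.mapRange.linearMap g.1.toLinearMap ∘ₗ Heis.loop
    + Heis.central.smulRight Heis.K

theorem loop_heisMapLinear (g : OrthGroup ℓ) (x : Heis ℓ) (n : ℤ) :
    Heis.loop (heisMapLinear g x) n = g.1 (Heis.loop x n) := by
  change ((Finsupp.mapRange.linearMap g.1.toLinearMap (Heis.loop x)
    + Heis.loop (Heis.central x • Heis.K) : ℤ →₀ (Fin ℓ → ℂ))) n = _
  simp

theorem central_heisMapLinear (g : OrthGroup ℓ) (x : Heis ℓ) :
    Heis.central (heisMapLinear g x) = Heis.central x := by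
  change (0 : ℂ) + Heis.central (Heis.central x • Heis.K) = _
  simp

theorem heisMapLinear_mode (g : OrthGroup ℓ) (n : ℤ) (a : Fin ℓ → ℂ) :
    heisMapLinear g (Heis.mode n a) = Heis.mode n (g.1 a) := by
  apply Heis.ext
  · ext m : 1
    rw [loop_heisMapLinear, Heis.loop_mode, Heis.loop_mode, Finsupp.single_apply,
      Finsupp.single_apply]
    split_ifs <;> simp
  · rw [central_heisMapLinear]; rfl

theorem heisMapLinear_K (g : OrthGroup ℓ) : (heisMapLinear g) Heis.K = Heis.K := by
  apply Heis.ext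
  · ext m : 1
    rw [loop_heisMapLinear]; simp
  · rw [central_heisMapLinear]

theorem cocycle_heisMapLinear (g : OrthGroup ℓ) (x y : Heis ℓ) :
    Heis.cocycle (heisMapLinear g x) ((heisMapLinear g) y) = Heis.cocycle x y := by
  induction x using Heis.induction with
  | hK => simp [heisMapLinear_K]
  | ha x x' h h' => rw [map_add, Heis.cocycle_add_left, Heis.cocycle_add_left, h, h']
  | hs c x h => rw [map_smul, Heis.cocycle_smul_left, Heis.cocycle_smul_left, h]
  | hm m a =>
    induction y using Heis.induction with
    | hK => simp [heisMapLinear_K]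
    | ha x x' h h' => rw [map_add, Heis.cocycle_add_right, Heis.cocycle_add_right, h, h']
    | hs c x h => rw [map_smul, Heis.cocycle_smul_right, Heis.cocycle_smul_right, h]
    | hm n b =>
      rw [heisMapLinear_mode, heisMapLinear_mode, Heis.cocycle_mode_mode, Heis.cocycle_mode_mode,
        g.2 a b]

/-- The automorphism `a(n) ↦ (g a)(n)`, `K ↦ K` of the Heisenberg Lie algebra. -/
def heisMap (g : OrthGroup ℓ) : Heis ℓ →ₗ⁅ℂ⁆ Heis ℓ :=
  { (heisMapLinear g) with
    map_lie' := fun {x y} => by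
      change (heisMapLinear g) ⁅x, y⁆ = ⁅heisMapLinear g x, (heisMapLinear g) y⁆
      rw [Heis.bracket_def, Heis.bracket_def, map_smul, heisMapLinear_K, cocycle_heisMapLinear] }

/-- The restriction of `heisMap g` to `𝔫`. -/
def nonnegMap (g : OrthGroup ℓ) : Heis.nonneg ℓ →ₗ⁅ℂ⁆ Heis.nonneg ℓ where
  toFun x := ⟨(heisMap g) (x : Heis ℓ), fun m hm => by
    change Heis.loop (heisMapLinear g x) m = 0
    rw [loop_heisMapLinear, x.2 m hm, map_zero]⟩
  map_add' x y := Subtype.ext (map_add (heisMap g) (x : Heis ℓ) y)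
  map_smul' c x := Subtype.ext (map_smul (heisMap g) c (x : Heis ℓ))
  map_lie' := fun {x y} => Subtype.ext (LieHom.map_lie (heisMap g) (x : Heis ℓ) y)

/-- The automorphism of `U(ĥ)` induced by `heisMap g`. -/
def ueaMap (g : OrthGroup ℓ) :
    UniversalEnvelopingAlgebra ℂ (Heis ℓ) →ₐ[ℂ] UniversalEnvelopingAlgebra ℂ (Heis ℓ) :=
  UniversalEnvelopingAlgebra.lift ℂ ((UniversalEnvelopingAlgebra.ι ℂ).comp (heisMap g))

theorem ueaMap_ι (g : OrthGroup ℓ) (x : Heis ℓ) :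
    ueaMap g (UniversalEnvelopingAlgebra.ι ℂ x)
      = UniversalEnvelopingAlgebra.ι ℂ (heisMapLinear g x) :=
  UniversalEnvelopingAlgebra.lift_ι_apply ℂ _ x

/-- The linear map underlying `act`, before passing to the quotient. -/
def preAct (g : OrthGroup ℓ) : UniversalEnvelopingAlgebra ℂ (Heis ℓ) →ₗ[ℂ] M1 ℓ :=
  (Submodule.mkQ (whittakerIdeal (whittakerFunction (0 : ℕ →₀ (Fin ℓ → ℂ))))).restrictScalars ℂ ∘ₗ
    (ueaMap g).toLinearMap

theorem preAct_ideal (g : OrthGroup ℓ) (u : UniversalEnvelopingAlgebra ℂ (Heis ℓ))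
    (hu : u ∈ whittakerIdeal (whittakerFunction (0 : ℕ →₀ (Fin ℓ → ℂ)))) : preAct g u = 0 := by
  unfold whittakerIdeal at hu
  induction hu using Submodule.span_induction with
  | mem u h =>
    obtain ⟨x, rfl⟩ := h
    refine (Submodule.Quotient.mk_eq_zero _).mpr (Submodule.subset_span ⟨nonnegMap g x, ?_⟩)
    have h0 : whittakerFunction (0 : ℕ →₀ (Fin ℓ → ℂ)) (nonnegMap g x)
        = whittakerFunction (0 : ℕ →₀ (Fin ℓ → ℂ)) x := by
      change 0 + Heis.central (heisMapLinear g (x : Heis ℓ)) = 0 + Heis.central (x : Heis ℓ)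
      rw [central_heisMapLinear]
    rw [AlgHom.toLinearMap_apply, map_sub, ueaMap_ι, AlgHom.commutes]
    beta_reduce
    rw [h0]
    rfl
  | zero => exact map_zero _
  | add u v _ _ h h' => rw [map_add, h, h', add_zero]
  | smul r u _ h =>
    have e : preAct g (r • u) = ueaMap g r • preAct g u := by
      change Submodule.Quotient.mk (ueaMap g (r * u)) = _
      rw [map_mul]
      rfl
    rw [e, h, smul_zero]

/-- The action of `g ∈ O(ℓ)` on `M(1)`, determined by
`a¹(n₁) ⋯ aʳ(n_r) 𝟏 ↦ (g a¹)(n₁) ⋯ (g aʳ)(n_r) 𝟏`. -/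
def act (g : OrthGroup ℓ) : M1 ℓ →ₗ[ℂ] M1 ℓ :=
  ((whittakerIdeal (whittakerFunction (0 : ℕ →₀ (Fin ℓ → ℂ)))).restrictScalars ℂ).liftQ (preAct g)
      (fun u hu => preAct_ideal g u hu)
    ∘ₗ (Submodule.Quotient.restrictScalarsEquiv ℂ _).symm.toLinearMap

theorem act_vacuum (g : OrthGroup ℓ) : act g (M1.vacuum ℓ) = M1.vacuum ℓ := by
  change (preAct g) 1 = _
  simp only [preAct, LinearMap.comp_apply, AlgHom.toLinearMap_apply, map_one]
  rfl

theorem act_mode (g : OrthGroup ℓ) (a : Fin ℓ → ℂ) (n : ℤ) (v : M1 ℓ) :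
    act g (UniversalEnvelopingAlgebra.ι ℂ (Heis.mode n a) • v)
      = UniversalEnvelopingAlgebra.ι ℂ (Heis.mode n (g.1 a)) • act g v := by
  induction v using Submodule.Quotient.induction_on with
  | H u =>
    change Submodule.Quotient.mk (ueaMap g
      (UniversalEnvelopingAlgebra.ι ℂ (Heis.mode n a) * u)) = _
    rw [map_mul, ueaMap_ι, heisMapLinear_mode]
    rfl

end OrthGroup

/-- The twisted Whittaker function `Λ ∘ g`, that is, `(Λ ∘ g)(h(n)) = Λ((g h)(n))`. -/
def twist {ℓ : ℕ} (Λ : Heis.nonneg ℓ →ₗ⁅ℂ⁆ ℂ) (g : OrthGroup ℓ) : Heis.nonneg ℓ →ₗ⁅ℂ⁆ ℂ :=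
  Λ.comp (OrthGroup.nonnegMap g)

/-- The orbifold `M(1)^G`, the space of vectors fixed by all elements of `G ⊆ O(ℓ)`. -/
def orbifold {ℓ : ℕ} (G : Subgroup (OrthGroup ℓ)) : Submodule ℂ (M1 ℓ) where
  carrier := {v | ∀ g ∈ G, OrthGroup.act g v = v}
  zero_mem' := fun g _ => map_zero _
  add_mem' := fun {u v} hu hv g hg => by rw [map_add, hu g hg, hv g hg]
  smul_mem' := fun c v hv g hg => by rw [map_smul, hv g hg]

/-- The involution `θ` of `M(1)`, sending `a¹(n₁) ⋯ aʳ(n_r) 𝟏` to `(-1)^r a¹(n₁) ⋯ aʳ(n_r) 𝟏`. -/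
def theta (ℓ : ℕ) : M1 ℓ →ₗ[ℂ] M1 ℓ := OrthGroup.act (OrthGroup.negOne ℓ)

/-- The fixed points `M(1)^+` of `θ`. -/
def M1plus (ℓ : ℕ) : Submodule ℂ (M1 ℓ) := LinearMap.eqLocus (theta ℓ) LinearMap.id

/-! ## Weak modules and irreducibility -/

/-- `S` is a vertex subalgebra of `(V, Y, 𝟏)`: it contains the vacuum and is closed under all
products `u_n v`. -/
structure IsVertexSubalgebra {V : Type*} [AddCommGroup V] [Module ℂ V]
    (Y : V →ₗ[ℂ] FieldSpace V) (vac : V) (S : Submodule ℂ V) : Prop where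
  vac_mem : vac ∈ S
  coeff_mem : ∀ u ∈ S, ∀ v ∈ S, ∀ n : ℤ, (Y u).coeff n v ∈ S

/-- `(W, Y_W)` is a weak module for the vertex subalgebra `S` of `(V, Y, 𝟏)`.  Lower truncation is
part of the notion of a field.  `jacobi` is the Jacobi identity in components: it compares the
coefficients, for all `p, q, r ∈ ℤ`, and all the sums in it are finite. -/
structure IsWeakModule {V W : Type*} [AddCommGroup V] [Module ℂ V] [AddCommGroup W] [Module ℂ W]
    (Y : V →ₗ[ℂ] FieldSpace V) (vac : V) (S : Submodule ℂ V) (YW : V →ₗ[ℂ] FieldSpace W) :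
    Prop where
  vacuum : YW vac = FieldSpace.one W
  jacobi : ∀ u ∈ S, ∀ v ∈ S, ∀ (p q r : ℤ) (w : W),
    ∑ᶠ i : ℕ, ((Ring.choose p i : ℤ) : ℂ) • (YW ((Y u).coeff (r + i) v)).coeff (p + q - i) w =
      ∑ᶠ i : ℕ, ((-1 : ℂ) ^ i * ((Ring.choose r i : ℤ) : ℂ)) •
        ((YW u).coeff (p + r - i) ((YW v).coeff (q + i) w)
          - (-1 : ℂ) ^ r • (YW v).coeff (q + r - i) ((YW u).coeff (p + i) w))

/-- `(W, Y_W)` is an irreducible weak module for the vertex subalgebra `S` of `(V, Y, 𝟏)`: it is a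
nonzero weak module, and its only subspaces stable under all `v_n`, `v ∈ S`, are `0` and `W`. -/
structure IsIrreducibleWeakModule {V W : Type*} [AddCommGroup V] [Module ℂ V] [AddCommGroup W]
    [Module ℂ W] (Y : V →ₗ[ℂ] FieldSpace V) (vac : V) (S : Submodule ℂ V)
    (YW : V →ₗ[ℂ] FieldSpace W) : Prop where
  subalgebra : IsVertexSubalgebra Y vac S
  weakModule : IsWeakModule Y vac S YW
  nontrivial : Nontrivial W
  eq_bot_or_eq_top : ∀ P : Submodule ℂ W,
    (∀ v ∈ S, ∀ (n : ℤ), ∀ w ∈ P, (YW v).coeff n w ∈ P) → P = ⊥ ∨ P = ⊤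

end

/-! Write W for M(1, λ), p for the order of g, and let P be a nonzero subspace of W stable under the
modes of M(1)^⟨g⟩, with 0 ≠ w ∈ P. The argument is an averaging one. In the direct sum of p copies
of W let a(n) act on the i-th copy as (gⁱa)(n) (`twistSum`); then v ∈ M(1) acts there through gⁱv.
Let x = (w, …, w) and let Q be the span of all v_n x with v ∈ M(1). Since Σᵢ gⁱv is fixed by g,
adding up components sends v_n x to (Σᵢ gⁱv)_n w, so it maps Q into P. It remains to show that Q
contains the whole copy with i = 0; then P = W.

By the Borcherds identity Q is stable under all a(n) (`mode_mem_span_Y`). On W the operators a(n) −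
(a, λ_n), n ≥ 0, are locally nilpotent (`exists_mem_annKer`), so on the i-th copy a(n) has the
single generalized eigenvalue (gⁱa, λ_n). If Λ ∘ gⁱ ≠ Λ, some a(n) separates copy i from copy 0, and
powers of a(n) − (gⁱa, λ_n) kill the component at i while remaining injective at 0. Applied to x,
this produces a nonzero vector of Q concentrated in copy 0 (`single_mem_of_twist_ne`). As W is
irreducible over the Heisenberg algebra, Q contains that copy.

Irreducibility over the Heisenberg algebra (`eq_top_of_modeOp_mem`): local nilpotency leads from any
nonzero vector to a nonzero vector killed by every a(n) − (a, λ_n), and a truncated number operator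
shows that such vectors are multiples of the generator (`exists_smul_gen_of_mem_annKer`). The
generator is nonzero because it survives in a Fock space of polynomials.

That W is a weak module is proved for any restricted level-one action. Two mutually local fields
satisfy the Borcherds identity (`IsLocal.borcherds`), a form of Dong's lemma propagates locality
(`IsLocal.resProd_right`), and Y_W(u_n v, z) = Y_W(u, z)_n Y_W(v, z) (`Y_coeff_Y`) turns the
identity for fields into the Jacobi identity.

The other two statements are instances of the first. For −1 the condition on Λ says λ ≠ 0. For
permutations, if a nontrivial power of g fixes Λ, then λ agrees at two distinct coordinates and the
transposition of these fixes Λ too. -/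

noncomputable section

attribute [local instance 100] LieRing.ofAssociativeRing

/-! ## Binomial expansions -/

section BinomExpand

variable {M : Type*} [AddCommGroup M]

/-- `f s t` vanishes for large `t`. -/
def TruncatedSnd (f : ℤ → ℤ → M) : Prop := ∃ T : ℤ, ∀ s t, T ≤ t → f s t = 0

theorem TruncatedSnd.exists_nat {f : ℤ → ℤ → M} (hf : TruncatedSnd f) (y : ℤ) :
    ∃ N : ℕ, ∀ s, ∀ t, y + N ≤ t → f s t = 0 := by
  obtain ⟨T, hT⟩ := hf
  exact ⟨(T - y).toNat, fun s t ht => hT s t (by omega)⟩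

variable [Module ℂ M]

/-- The binomial coefficient `binom(n, j)`, `n ∈ ℤ`, as a complex number. -/
def zbinom (n : ℤ) (j : ℕ) : ℂ := ((Ring.choose n j : ℤ) : ℂ)

theorem zbinom_zero_right (n : ℤ) : zbinom n 0 = 1 := by simp [zbinom]

theorem zbinom_zero_succ (j : ℕ) : zbinom 0 (j + 1) = 0 := by simp [zbinom, Ring.choose_zero_succ]

theorem zbinom_succ (n : ℤ) (j : ℕ) :
    zbinom (n + 1) (j + 1) = zbinom n j + zbinom n (j + 1) := by
  simp [zbinom, Ring.choose_succ_succ]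

theorem zbinom_natCast (n j : ℕ) : zbinom n j = (n.choose j : ℂ) := by
  simp [zbinom, Ring.choose_natCast]

theorem sbinom_eq (n : ℤ) (j : ℕ) : FieldSpace.sbinom n j = (-1) ^ j * zbinom n j := rfl

/-- The value at `(x, y)` of `(X + e Y)^n f`, expanded in nonnegative powers of `Y`, where `X` and `Y`
are the shifts of the two arguments of `f`. -/
def binomExpand (e : ℂ) (n : ℤ) (f : ℤ → ℤ → M) (x y : ℤ) : M :=
  ∑ᶠ i : ℕ, (e ^ i * zbinom n i) • f (x + n - i) (y + i)

theorem binomExpand_eq_range (e : ℂ) (n : ℤ) {f : ℤ → ℤ → M} (x y : ℤ) (N : ℕ)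
    (hN : ∀ s t, y + N ≤ t → f s t = 0) :
    binomExpand e n f x y =
      ∑ i ∈ Finset.range N, (e ^ i * zbinom n i) • f (x + n - i) (y + i) :=
  FieldSpace.finsum_eq_range N fun j hj => by rw [hN _ _ (by omega), smul_zero]

theorem binomExpand_zero (e : ℂ) {f : ℤ → ℤ → M} (hf : TruncatedSnd f) (x y : ℤ) :
    binomExpand e 0 f x y = f x y := by
  obtain ⟨N, hN⟩ := hf.exists_nat y
  rw [binomExpand_eq_range e 0 x y (N + 1) (fun s t ht => hN s t (by push_cast at ht; omega)),
    Finset.sum_range_succ', Finset.sum_eq_zero]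
  · simp [zbinom_zero_right]
  · intro i _
    rw [zbinom_zero_succ, mul_zero, zero_smul]

/-- Pascal's rule, that is, (X + eY)^(n+1) = (X + eY)^n (X + eY). It holds for negative n as well,
and the inductions on exponents below rest on it. -/
theorem binomExpand_succ (e : ℂ) (n : ℤ) {f : ℤ → ℤ → M} (hf : TruncatedSnd f) (x y : ℤ) :
    binomExpand e (n + 1) f x y = binomExpand e n f (x + 1) y + e • binomExpand e n f x (y + 1) := by
  obtain ⟨N, hN⟩ := hf.exists_nat y
  have h1 : ∀ s t, y + (N + 1 : ℕ) ≤ t → f s t = 0 := fun s t ht => hN s t (by push_cast at ht; omega)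
  rw [binomExpand_eq_range e _ x y (N + 1) h1, binomExpand_eq_range e n (x + 1) y (N + 1) h1,
    binomExpand_eq_range e n x (y + 1) N (fun s t ht => hN s t (by omega)),
    Finset.sum_range_succ', Finset.sum_range_succ' _ N, Finset.smul_sum]
  have : ∀ i : ℕ, (e ^ (i + 1) * zbinom (n + 1) (i + 1)) • f (x + (n + 1) - (i + 1 : ℕ)) (y + (i + 1 : ℕ))
      = (e ^ (i + 1) * zbinom n (i + 1)) • f (x + 1 + n - (i + 1 : ℕ)) (y + (i + 1 : ℕ))
        + e • (e ^ i * zbinom n i) • f (x + n - i) (y + 1 + i) := by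
    intro i
    rw [zbinom_succ, mul_add, add_smul, smul_smul, add_comm]
    congr 2
    · congr 1; ring
    · ring
    · congr 1
      · push_cast; ring
      · push_cast; ring
  rw [Finset.sum_congr rfl fun i _ => this i, Finset.sum_add_distrib]
  have e1 : x + (n + 1) - ((0 : ℕ) : ℤ) = x + 1 + n - ((0 : ℕ) : ℤ) := by ring
  rw [e1, zbinom_zero_right, zbinom_zero_right]
  abel

theorem binomExpand_map {M' : Type*} [AddCommGroup M'] [Module ℂ M'] (φ : M →ₗ[ℂ] M') (e : ℂ)
    (n : ℤ) {f : ℤ → ℤ → M} (hf : TruncatedSnd f) (x y : ℤ) :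
    φ (binomExpand e n f x y) = binomExpand e n (fun s t => φ (f s t)) x y := by
  obtain ⟨N, hN⟩ := hf.exists_nat y
  rw [binomExpand_eq_range e _ x y N hN, binomExpand_eq_range e _ x y N
    (fun s t ht => by rw [hN s t ht, map_zero]), map_sum]
  simp

end BinomExpand

/-! ## Locality and the Borcherds identity for fields -/

namespace FieldSpace

variable {W : Type*} [AddCommGroup W] [Module ℂ W]

theorem truncatedSnd_comp (a b : FieldSpace W) (w : W) :
    TruncatedSnd fun s t => a.coeff s (b.coeff t w) := by
  obtain ⟨N, hN⟩ := b.exists_bound w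
  exact ⟨N, fun s t ht => by beta_reduce; rw [hN t ht, map_zero]⟩

/-- The coefficient at `x^{p} y^{q}` of `(x - y)^r a(x) b(y) - (-y + x)^r b(y) a(x)`, applied to `w`: the
right-hand side of the Borcherds identity. -/
def bracketExpand (a b : FieldSpace W) (w : W) (p q r : ℤ) : W :=
  binomExpand (-1) r (fun s t => a.coeff s (b.coeff t w)) p q
    - (-1 : ℂ) ^ r • binomExpand (-1) r (fun s t => b.coeff s (a.coeff t w)) q p

theorem bracketExpand_zero (a b : FieldSpace W) (w : W) (p q : ℤ) :
    bracketExpand a b w p q 0 = a.coeff p (b.coeff q w) - b.coeff q (a.coeff p w) := by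
  rw [bracketExpand, binomExpand_zero _ (truncatedSnd_comp a b w),
    binomExpand_zero _ (truncatedSnd_comp b a w), zpow_zero, one_smul]

/-- Multiplication by x − y. Both halves obey the same rule: in the second one the factor y − x is
turned around by the sign (−1)^r. -/
theorem bracketExpand_succ (a b : FieldSpace W) (w : W) (p q r : ℤ) :
    bracketExpand a b w p q (r + 1) = bracketExpand a b w (p + 1) q r
      - bracketExpand a b w p (q + 1) r := by
  simp only [bracketExpand]
  rw [binomExpand_succ _ _ (truncatedSnd_comp a b w), binomExpand_succ _ _ (truncatedSnd_comp b a w),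
    zpow_add_one₀ (by norm_num)]
  module

/-- For natural r the power (x − y)^r is a polynomial, so its two expansions agree and exchanging
the fields only changes the sign. -/
theorem bracketExpand_swap (a b : FieldSpace W) (w : W) (r : ℕ) (p q : ℤ) :
    bracketExpand b a w q p r = (-1 : ℂ) ^ (r + 1) • bracketExpand a b w p q r := by
  induction r generalizing p q with
  | zero => simp [bracketExpand_zero]
  | succ r ih =>
    push_cast
    rw [bracketExpand_succ, bracketExpand_succ, ih, ih, pow_succ _ (r + 1)]
    module

/-- The residue in z₁ selects the exponent p = 0, so the residue product is the case p = 0 of the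
Borcherds identity by definition. -/
theorem coeff_resProd_eq_bracketExpand (n : ℤ) (a b : FieldSpace W) (m : ℤ) (w : W) :
    (resProd n a b).coeff m w = bracketExpand a b w 0 m n := by
  rw [coeff_resProd, bracketExpand]
  congr 1
  · refine finsum_congr fun i => ?_
    rw [sbinom_eq, zero_add]
  · obtain ⟨N, hN⟩ := a.exists_nat_bound' w
    rw [rightCoeff_eq n a b m w N hN, binomExpand_eq_range _ _ _ _ N, Finset.smul_sum]
    · refine Finset.sum_congr rfl fun i _ => ?_
      rw [sbinom_eq, smul_smul, zero_add, add_comm n m]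
    · intro s t ht
      have := hN t.toNat (by omega)
      rw [Int.toNat_of_nonneg (by omega)] at this
      rw [this, map_zero]

/-- The left-hand side of the Borcherds identity, for a family of fields in place of the products of
two fields. -/
def modeExpand (c : ℤ → FieldSpace W) (w : W) (p q r : ℤ) : W :=
  binomExpand 1 p (fun t s => (c s).coeff t w) q r

theorem truncatedSnd_family {c : ℤ → FieldSpace W} {N : ℤ} (hc : ∀ n, N ≤ n → c n = 0) (w : W) :
    TruncatedSnd fun t s => (c s).coeff t w :=
  ⟨N, fun t s hs => by beta_reduce; rw [hc s hs, coeff_zero]⟩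

theorem modeExpand_zero {c : ℤ → FieldSpace W} {N : ℤ} (hc : ∀ n, N ≤ n → c n = 0) (w : W)
    (q r : ℤ) : modeExpand c w 0 q r = (c r).coeff q w :=
  binomExpand_zero _ (truncatedSnd_family hc w) _ _

/-- This is the recursion of `bracketExpand_succ` with the terms rearranged. The two sides of the
Borcherds identity therefore agree everywhere once they agree at p = 0 and for large r. -/
theorem modeExpand_succ {c : ℤ → FieldSpace W} {N : ℤ} (hc : ∀ n, N ≤ n → c n = 0) (w : W)
    (p q r : ℤ) : modeExpand c w (p + 1) q r
      = modeExpand c w p (q + 1) r + modeExpand c w p q (r + 1) := by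
  rw [modeExpand, binomExpand_succ _ _ (truncatedSnd_family hc w), one_smul]
  rfl

theorem modeExpand_eq_zero {c : ℤ → FieldSpace W} {N : ℤ} (hc : ∀ n, N ≤ n → c n = 0) (w : W)
    (p q r : ℤ) (hr : N ≤ r) : modeExpand c w p q r = 0 := by
  rw [modeExpand, binomExpand_eq_range _ _ _ _ 0, Finset.sum_range_zero]
  intro s t ht
  rw [hc t (by push_cast at ht; omega), coeff_zero]

theorem modeExpand_eq_range {c : ℤ → FieldSpace W} (N : ℕ) (w : W) (p q r : ℤ)
    (hc : ∀ n, r + N ≤ n → c n = 0) :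
    modeExpand c w p q r = ∑ i ∈ Finset.range N, zbinom p i • (c (r + i)).coeff (q + p - i) w := by
  rw [modeExpand, binomExpand_eq_range _ _ _ _ N]
  · simp
  · intro s t ht
    rw [hc t ht, coeff_zero]

/-- Mutual locality of two fields: `(x - y)^N [a(x), b(y)] = 0` for some `N`. -/
def IsLocal (a b : FieldSpace W) : Prop :=
  ∃ N : ℕ, ∀ (p q : ℤ) (w : W), bracketExpand a b w p q N = 0

theorem IsLocal.symm {a b : FieldSpace W} (h : IsLocal a b) : IsLocal b a := by
  obtain ⟨N, hN⟩ := h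
  exact ⟨N, fun p q w => by rw [bracketExpand_swap, hN, smul_zero]⟩

theorem bracketExpand_eq_zero_of_le {a b : FieldSpace W} {N : ℤ}
    (hN : ∀ (p q : ℤ) (w : W), bracketExpand a b w p q N = 0) (r : ℤ) (hr : N ≤ r) (p q : ℤ) (w : W) :
    bracketExpand a b w p q r = 0 := by
  induction r, hr using Int.leInduction generalizing p q with
  | base => exact hN p q w
  | succ r _ ih => rw [bracketExpand_succ, ih, ih, sub_zero]

theorem IsLocal.exists_resProd_eq_zero {a b : FieldSpace W} (h : IsLocal a b) :
    ∃ N : ℕ, ∀ n : ℤ, N ≤ n → resProd n a b = 0 := by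
  obtain ⟨N, hN⟩ := h
  refine ⟨N, fun n hn => ?_⟩
  ext m w
  rw [coeff_resProd_eq_bracketExpand, bracketExpand_eq_zero_of_le hN n hn, coeff_zero]

/-- The Borcherds identity for mutually local fields. -/
theorem IsLocal.borcherds {a b : FieldSpace W} (h : IsLocal a b) (w : W) (p q r : ℤ) :
    modeExpand (fun n => resProd n a b) w p q r = bracketExpand a b w p q r := by
  obtain ⟨N, hN⟩ := h
  have hc : ∀ n : ℤ, (N : ℤ) ≤ n → resProd n a b = 0 := by
    intro n hn
    ext m w
    rw [coeff_resProd_eq_bracketExpand, bracketExpand_eq_zero_of_le hN n hn, coeff_zero]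
  induction p using Int.induction_on generalizing q r with
  | zero => rw [modeExpand_zero hc, coeff_resProd_eq_bracketExpand]
  | succ p ih => rw [modeExpand_succ hc, ih, ih, bracketExpand_succ]; abel
  | pred p ih =>
    -- Solving the recursion for the smaller p leaves a term with the same p and with r + 1. The
    -- induction on k raises r until r ≥ N, where both sides vanish.
    have key : ∀ k : ℕ, ∀ q r : ℤ, (N : ℤ) ≤ r + k → modeExpand (fun n => resProd n a b) w (-p - 1) q r
        = bracketExpand a b w (-p - 1) q r := by
      intro k
      induction k with
      | zero =>
        intro q r hr
        rw [modeExpand_eq_zero hc _ _ _ _ (by simpa using hr),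
          bracketExpand_eq_zero_of_le hN r (by simpa using hr)]
      | succ k ihk =>
        intro q r hr
        have h1 := modeExpand_succ hc w (-p - 1) (q - 1) r
        have h2 := bracketExpand_succ a b w (-p - 1) (q - 1) r
        rw [sub_add_cancel, sub_add_cancel, ih, ihk (q - 1) (r + 1) (by push_cast at hr; omega)] at h1
        rw [sub_add_cancel, sub_add_cancel] at h2
        rw [h2] at h1
        exact (eq_sub_of_add_eq h1.symm).trans (sub_sub_cancel _ _)
    exact key (N - r).toNat q r (by omega)

/-- A commutator formula implies locality. -/
theorem isLocal_of_commutator {a b : FieldSpace W} (c : ℕ → FieldSpace W) (N : ℕ)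
    (h : ∀ (p q : ℤ) (w : W), a.coeff p (b.coeff q w) - b.coeff q (a.coeff p w)
      = ∑ i ∈ Finset.range N, zbinom p i • (c i).coeff (p + q - i) w) : IsLocal a b := by
  -- The values of `d` at n < 0 are junk and never read: the argument starts at r = 0 and only
  -- raises r. The cut-off at N makes `modeExpand` vanish at r = N, so N is an order of locality.
  set d : ℤ → FieldSpace W := fun n => if n < N then c n.toNat else 0 with hd
  have hc : ∀ n : ℤ, (N : ℤ) ≤ n → d n = 0 := fun n hn => if_neg (by omega)
  have key : ∀ (r : ℕ) (p q : ℤ) (w : W), bracketExpand a b w p q r = modeExpand d w p q r := by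
    intro r
    induction r with
    | zero =>
      intro p q w
      rw [Nat.cast_zero, bracketExpand_zero, h, modeExpand_eq_range N _ _ _ _ (fun n hn => hc n (by omega))]
      refine Finset.sum_congr rfl fun i hi => ?_
      have := Finset.mem_range.mp hi
      simp [hd, this, add_comm]
    | succ r ih =>
      intro p q w
      push_cast
      rw [bracketExpand_succ, ih, ih, modeExpand_succ hc]
      abel
  exact ⟨N, fun p q w => by rw [key, modeExpand_eq_zero hc _ _ _ _ le_rfl]⟩

theorem IsLocal.commutator {a b : FieldSpace W} (h : IsLocal a b) (N : ℕ)
    (hN : ∀ n : ℤ, N ≤ n → resProd n a b = 0) (p q : ℤ) (w : W) :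
    a.coeff p (b.coeff q w) - b.coeff q (a.coeff p w)
      = ∑ i ∈ Finset.range N, zbinom p i • (resProd i a b).coeff (p + q - i) w := by
  rw [← bracketExpand_zero, ← h.borcherds, modeExpand_eq_range N _ _ _ _ (fun n hn => hN n (by omega))]
  simp [add_comm]

theorem isLocal_one_right (a : FieldSpace W) : IsLocal a (one W) :=
  isLocal_of_commutator (fun _ => 0) 0 fun p q w => by
    simp only [coeff_one]
    split_ifs <;> simp

/-- Natural r suffices for locality and permits an induction from the commutator, which avoids
comparing truncations of infinite sums. -/
theorem bracketExpand_add_right (a b b' : FieldSpace W) (w : W) (p q : ℤ) (r : ℕ) :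
    bracketExpand a (b + b') w p q r = bracketExpand a b w p q r + bracketExpand a b' w p q r := by
  induction r generalizing p q with
  | zero => simp only [Nat.cast_zero, bracketExpand_zero, coeff_add, map_add]; abel
  | succ r ih => push_cast; simp only [bracketExpand_succ, ih]; abel

theorem bracketExpand_smul_right (c : ℂ) (a b : FieldSpace W) (w : W) (p q : ℤ) (r : ℕ) :
    bracketExpand a (c • b) w p q r = c • bracketExpand a b w p q r := by
  induction r generalizing p q with
  | zero => simp only [Nat.cast_zero, bracketExpand_zero, coeff_smul, map_smul, smul_sub]
  | succ r ih => push_cast; simp only [bracketExpand_succ, ih, smul_sub]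

theorem IsLocal.add_right {a b b' : FieldSpace W} (h : IsLocal a b) (h' : IsLocal a b') :
    IsLocal a (b + b') := by
  obtain ⟨N, hN⟩ := h
  obtain ⟨N', hN'⟩ := h'
  refine ⟨max N N', fun p q w => ?_⟩
  rw [bracketExpand_add_right, bracketExpand_eq_zero_of_le hN _ (by simp),
    bracketExpand_eq_zero_of_le hN' _ (by simp), add_zero]

theorem IsLocal.smul_right {a b : FieldSpace W} (c : ℂ) (h : IsLocal a b) : IsLocal a (c • b) := by
  obtain ⟨N, hN⟩ := h
  exact ⟨N, fun p q w => by rw [bracketExpand_smul_right, hN, smul_zero]⟩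

end FieldSpace

/-! ## Identities between binomial coefficients -/

theorem zbinom_add (m n : ℤ) (s : ℕ) :
    zbinom (m + n) s = ∑ p ∈ Finset.HasAntidiagonal.antidiagonal s, zbinom m p.1 * zbinom n p.2 := by
  simp only [zbinom, Ring.add_choose_eq s (Commute.all m n)]
  push_cast
  rfl

/-- Both sides are the trinomial coefficient for choosing disjoint sets of sizes i and l;
`zbinom_add_mul` counts the same choices through their union. -/
theorem zbinom_mul_zbinom (m : ℤ) (i l : ℕ) :
    zbinom m i * zbinom (m - i) l = zbinom m l * zbinom (m - l) i := by
  have h1 := Ring.choose_smul_choose m (Nat.le_add_right i l)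
  have h2 := Ring.choose_smul_choose m (Nat.le_add_left l i)
  rw [Nat.add_sub_cancel_left] at h1
  rw [Nat.add_sub_cancel, Nat.choose_symm_add.symm] at h2
  unfold zbinom
  exact_mod_cast h1.symm.trans h2

theorem zbinom_add_mul (m : ℤ) (i l : ℕ) :
    zbinom m (l + i) * zbinom ((l + i : ℕ) : ℤ) l = zbinom m l * zbinom (m - l) i := by
  have h1 := Ring.choose_smul_choose m (Nat.le_add_right l i)
  rw [Nat.add_sub_cancel_left] at h1
  unfold zbinom
  rw [Ring.choose_natCast, ← Int.cast_mul, ← Int.cast_mul, ← h1, nsmul_eq_mul]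
  push_cast
  ring

/-- Trinomial revision pulls out binom(m, l), and Vandermonde's convolution sums the rest. This
gives the coefficients in the left products. -/
theorem sum_zbinom_sub (m n : ℤ) (l s : ℕ) :
    ∑ p ∈ Finset.HasAntidiagonal.antidiagonal s, zbinom m p.1 * zbinom n p.2 * zbinom (m - p.1) l
      = zbinom m l * zbinom (m + n - l) s := by
  rw [show m + n - l = (m - l) + n by ring, zbinom_add, Finset.mul_sum]
  refine Finset.sum_congr rfl fun p _ => ?_
  linear_combination zbinom n p.2 * zbinom_mul_zbinom m p.1 l

theorem sum_range_shift {M : Type*} [AddCommMonoid M] {N i : ℕ} (hi : i ≤ N) {f : ℕ → M}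
    (hf : ∀ s < i, f s = 0) :
    ∑ s ∈ Finset.range N, f s = ∑ j ∈ Finset.range (N - i), f (i + j) := by
  obtain ⟨k, rfl⟩ := Nat.exists_eq_add_of_le hi
  rw [Finset.sum_range_add, Finset.sum_eq_zero (s := Finset.range i), zero_add,
    Nat.add_sub_cancel_left]
  exact fun s hs => hf s (Finset.mem_range.mp hs)

/-- The terms with i < l vanish; after the shift i ↦ l + i, trinomial revision and Vandermonde apply
again. This gives the coefficients in the right products. -/
theorem sum_zbinom_left (m n : ℤ) (l s : ℕ) :
    ∑ p ∈ Finset.HasAntidiagonal.antidiagonal s, zbinom m p.1 * zbinom n p.2 * zbinom p.1 l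
      = if l ≤ s then zbinom m l * zbinom (m + n - l) (s - l) else 0 := by
  rw [Finset.Nat.sum_antidiagonal_eq_sum_range_succ
    (fun i j => zbinom m i * zbinom n j * zbinom i l)]
  have hz : ∀ i < l, zbinom m i * zbinom n (s - i) * zbinom i l = 0 := fun i hi => by
    rw [zbinom_natCast i l, Nat.choose_eq_zero_of_lt hi, Nat.cast_zero, mul_zero]
  split_ifs with h
  · rw [sum_range_shift (Nat.le_succ_of_le h) hz, show m + n - l = (m - l) + n by ring, zbinom_add,
      Finset.Nat.sum_antidiagonal_eq_sum_range_succ (fun i j => zbinom (m - l) i * zbinom n j),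
      Finset.mul_sum, show s.succ - l = (s - l).succ by omega]
    refine Finset.sum_congr rfl fun i _ => ?_
    rw [show s - (l + i) = s - l - i by omega]
    linear_combination zbinom n (s - l - i) * zbinom_add_mul m i l
  · exact Finset.sum_eq_zero fun i hi => hz i (by have := Finset.mem_range.mp hi; omega)

/-- The square splits into antidiagonals; those reaching beyond N are incomplete, but `h` is zero on
them. -/
theorem sum_range_range_add {M : Type*} [AddCommGroup M] [Module ℂ M] (N : ℕ) (γ : ℕ → ℕ → ℂ)
    (h : ℕ → M) (hN : ∀ s, N ≤ s → h s = 0) :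
    ∑ i ∈ Finset.range N, ∑ j ∈ Finset.range N, γ i j • h (i + j)
      = ∑ s ∈ Finset.range N, (∑ p ∈ Finset.HasAntidiagonal.antidiagonal s, γ p.1 p.2) • h s := by
  have h1 : ∀ i ∈ Finset.range N, ∑ j ∈ Finset.range N, γ i j • h (i + j)
      = ∑ j ∈ Finset.range (N - i), γ i j • h (i + j) := by
    intro i _
    refine (Finset.sum_subset (Finset.range_subset_range.mpr (Nat.sub_le N i)) fun j _ hj => ?_).symm
    rw [hN _ (by rw [Finset.mem_range] at hj; omega), smul_zero]
  rw [Finset.sum_congr rfl h1, ← Finset.sum_range_diag_flip N fun i j => γ i j • h (i + j)]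
  refine Finset.sum_congr rfl fun s _ => ?_
  rw [Finset.Nat.sum_antidiagonal_eq_sum_range_succ γ, Finset.sum_smul]
  refine Finset.sum_congr rfl fun k hk => ?_
  rw [Nat.add_sub_cancel' (by have := Finset.mem_range.mp hk; omega)]

/-! ## The commutator formula for residue products -/

namespace FieldSpace

variable {W : Type*} [AddCommGroup W] [Module ℂ W]

theorem coeff_sum {ι : Type*} (s : Finset ι) (f : ι → FieldSpace W) (n : ℤ) (w : W) :
    (∑ i ∈ s, f i).coeff n w = ∑ i ∈ s, (f i).coeff n w := by
  classical
  induction s using Finset.induction_on with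
  | empty => simp
  | insert i s hi ih => rw [Finset.sum_insert hi, Finset.sum_insert hi, coeff_add, ih]

theorem coeff_left_left (m n : ℤ) (a b c : FieldSpace W) (k : ℤ) (w : W) (N : ℕ)
    (hN : ∀ j : ℕ, N ≤ j → c.coeff (k + j) w = 0) :
    (left m a (left n b c)).coeff k w =
      ∑ i ∈ Finset.range N, ∑ j ∈ Finset.range N, (sbinom m i * sbinom n j) •
        a.coeff (m - i) (b.coeff (n - j) (c.coeff (k + (i + j : ℕ)) w)) := by
  have hb : ∀ i : ℕ, (left n b c).coeff (k + i) w = ∑ j ∈ Finset.range N,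
      sbinom n j • b.coeff (n - j) (c.coeff (k + (i + j : ℕ)) w) := fun i => by
    rw [coeff_left, leftCoeff_eq n b c (k + i) w N]
    · simp only [Nat.cast_add, add_assoc]
    · intro j hj
      have := hN (i + j) (by omega)
      rwa [Nat.cast_add, ← add_assoc] at this
  rw [coeff_left, leftCoeff_eq m a (left n b c) k w N]
  · refine Finset.sum_congr rfl fun i _ => ?_
    rw [hb, map_sum, Finset.smul_sum]
    refine Finset.sum_congr rfl fun j _ => ?_
    rw [map_smul, smul_smul]
  · intro i hi
    rw [hb]
    refine Finset.sum_eq_zero fun j _ => ?_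
    rw [hN (i + j) (by omega), map_zero, smul_zero]

theorem coeff_right_right (m n : ℤ) (a b c : FieldSpace W) (k : ℤ) (w : W) (N : ℕ)
    (hN : ∀ i : ℕ, N ≤ i → a.coeff i w = 0)
    (hN' : ∀ i j : ℕ, N ≤ j → b.coeff j (a.coeff i w) = 0) :
    (right m a (right n b c)).coeff k w =
      ∑ i ∈ Finset.range N, ∑ j ∈ Finset.range N,
        ((-1 : ℂ) ^ m * sbinom m i * ((-1 : ℂ) ^ n * sbinom n j)) •
          c.coeff (m + n + k - (i + j : ℕ)) (b.coeff j (a.coeff i w)) := by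
  rw [coeff_right, rightCoeff_eq m a _ k w N hN]
  refine Finset.sum_congr rfl fun i _ => ?_
  rw [coeff_right, rightCoeff_eq n b c _ _ N (hN' i), Finset.smul_sum]
  refine Finset.sum_congr rfl fun j _ => ?_
  rw [smul_smul, show n + (m + k - (i : ℤ)) - j = m + n + k - (i + j : ℕ) by push_cast; ring]

theorem exists_comp_bound (a b : FieldSpace W) (w : W) :
    ∃ N : ℕ, (∀ i : ℕ, N ≤ i → a.coeff i w = 0) ∧
      ∀ i j : ℕ, N ≤ j → b.coeff j (a.coeff i w) = 0 := by
  obtain ⟨J, hJ⟩ := a.exists_nat_bound' w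
  obtain ⟨N, hN⟩ := b.exists_uniform_bound (fun j => a.coeff j w) J
  refine ⟨max J N.toNat, fun i hi => hJ i (by omega), fun i j hj => ?_⟩
  by_cases h : i < J
  · exact hN i h j (by omega)
  · rw [hJ i (by omega), map_zero]

/-- Each pair (i, j) contributes a commutator of a_(m−i) and f_(n−j). Expanding it by `h` gives
terms that, up to a scalar, depend only on l and i + j; `sum_zbinom_sub` adds up the scalars. -/
theorem left_left_commutator {a f : FieldSpace W} {c : ℕ → FieldSpace W} {N : ℕ}
    (h : ∀ (p q : ℤ) (w : W), a.coeff p (f.coeff q w) - f.coeff q (a.coeff p w)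
      = ∑ i ∈ Finset.range N, zbinom p i • (c i).coeff (p + q - i) w)
    (g : FieldSpace W) (m n : ℤ) :
    left m a (left n f g) - left n f (left m a g)
      = ∑ l ∈ Finset.range N, zbinom m l • left (m + n - l) (c l) g := by
  ext k w
  obtain ⟨B, hB⟩ := g.exists_nat_bound k w
  rw [coeff_sub, coeff_left_left m n a f g k w B hB, coeff_left_left n m f a g k w B hB,
    Finset.sum_comm (f := fun i j => (sbinom n i * sbinom m j) •
        f.coeff (n - i) (a.coeff (m - j) (g.coeff (k + (i + j : ℕ)) w))),
    ← Finset.sum_sub_distrib, coeff_sum]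
  have h1 : ∀ i j : ℕ, (sbinom m i * sbinom n j) •
        a.coeff (m - i) (f.coeff (n - j) (g.coeff (k + (i + j : ℕ)) w)) - (sbinom n j * sbinom m i) •
        f.coeff (n - j) (a.coeff (m - i) (g.coeff (k + (j + i : ℕ)) w)) =
      ∑ l ∈ Finset.range N, (sbinom m i * sbinom n j * zbinom (m - i) l) •
        (c l).coeff (m + n - l - (i + j : ℕ)) (g.coeff (k + (i + j : ℕ)) w) := by
    intro i j
    rw [mul_comm (sbinom n j), add_comm j i, ← smul_sub, h, Finset.smul_sum]
    refine Finset.sum_congr rfl fun l _ => ?_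
    rw [smul_smul, show m - i + (n - j) - l = m + n - l - (i + j : ℕ) by push_cast; ring]
  have h2 : ∀ i ∈ Finset.range B, (∑ j ∈ Finset.range B, (sbinom m i * sbinom n j) •
        a.coeff (m - i) (f.coeff (n - j) (g.coeff (k + (i + j : ℕ)) w))) -
        (∑ j ∈ Finset.range B, (sbinom n j * sbinom m i) •
        f.coeff (n - j) (a.coeff (m - i) (g.coeff (k + (j + i : ℕ)) w))) =
      ∑ l ∈ Finset.range N, ∑ j ∈ Finset.range B, (sbinom m i * sbinom n j * zbinom (m - i) l) •
        (c l).coeff (m + n - l - (i + j : ℕ)) (g.coeff (k + (i + j : ℕ)) w) := by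
    intro i _
    rw [← Finset.sum_sub_distrib, Finset.sum_comm]
    exact Finset.sum_congr rfl fun j _ => h1 i j
  rw [Finset.sum_congr rfl h2, Finset.sum_comm]
  refine Finset.sum_congr rfl fun l _ => ?_
  rw [sum_range_range_add B (fun i j => sbinom m i * sbinom n j * zbinom (m - i) l)
    (fun s => (c l).coeff (m + n - l - s) (g.coeff (k + s) w))
    (fun s hs => by rw [hB s hs, map_zero]), coeff_smul, coeff_left,
    leftCoeff_eq _ _ _ _ _ B hB, Finset.smul_sum]
  refine Finset.sum_congr rfl fun s _ => ?_
  rw [smul_smul]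
  congr 1
  rw [sbinom_eq, mul_left_comm, ← sum_zbinom_sub, Finset.mul_sum]
  refine Finset.sum_congr rfl fun p hp => ?_
  rw [← Finset.HasAntidiagonal.mem_antidiagonal.mp hp, pow_add, sbinom_eq, sbinom_eq]
  ring

/-- Here the modes of a and f act before g, with indices i, j ≥ 0, so the order of the commutator is
reversed and `sum_zbinom_left` takes the place of `sum_zbinom_sub`. -/
theorem right_right_commutator {a f : FieldSpace W} {c : ℕ → FieldSpace W} {N : ℕ}
    (h : ∀ (p q : ℤ) (w : W), a.coeff p (f.coeff q w) - f.coeff q (a.coeff p w)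
      = ∑ i ∈ Finset.range N, zbinom p i • (c i).coeff (p + q - i) w)
    (g : FieldSpace W) (m n : ℤ) :
    right n f (right m a g) - right m a (right n f g)
      = ∑ l ∈ Finset.range N, zbinom m l • right (m + n - l) (c l) g := by
  ext k w
  obtain ⟨B₁, hB₁, hB₁'⟩ := exists_comp_bound a f w
  obtain ⟨B₂, hB₂, hB₂'⟩ := exists_comp_bound f a w
  obtain ⟨B₃, hB₃⟩ : ∃ B : ℕ, ∀ l < N, ∀ s : ℤ, B ≤ s → (c l).coeff s w = 0 := by
    have : ∀ l, ∃ B : ℕ, ∀ s : ℤ, B ≤ s → (c l).coeff s w = 0 := fun l => by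
      obtain ⟨M, hM⟩ := (c l).exists_bound w
      exact ⟨M.toNat, fun s hs => hM s (by omega)⟩
    choose M hM using this
    refine ⟨(Finset.range N).sup M, fun l hl s hs => hM l s (le_trans ?_ hs)⟩
    exact_mod_cast Finset.le_sup (f := M) (Finset.mem_range.mpr hl)
  -- `B₁` and `B₂` truncate the two double sums. The summands `B₃ + N` ensure s − l ≥ B₃ for all s ≥
  -- B and l < N.
  set B := B₁ + B₂ + B₃ + N with hB
  rw [coeff_sub, coeff_right_right m n a f g k w B (fun i hi => hB₁ i (by omega))
      (fun i j hj => hB₁' i j (by omega)),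
    coeff_right_right n m f a g k w B (fun i hi => hB₂ i (by omega))
      (fun i j hj => hB₂' i j (by omega)),
    Finset.sum_comm (f := fun i j => ((-1 : ℂ) ^ n * sbinom n i * ((-1 : ℂ) ^ m * sbinom m j)) •
          g.coeff (n + m + k - (i + j : ℕ)) (a.coeff j (f.coeff i w))),
    ← Finset.sum_sub_distrib, coeff_sum]
  have h1 : ∀ i j : ℕ, ((-1 : ℂ) ^ n * sbinom n j * ((-1 : ℂ) ^ m * sbinom m i)) •
          g.coeff (n + m + k - (j + i : ℕ)) (a.coeff i (f.coeff j w))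
        - ((-1 : ℂ) ^ m * sbinom m i * ((-1 : ℂ) ^ n * sbinom n j)) •
          g.coeff (m + n + k - (i + j : ℕ)) (f.coeff j (a.coeff i w)) =
      ∑ l ∈ Finset.range N, ((-1 : ℂ) ^ m * sbinom m i * ((-1 : ℂ) ^ n * sbinom n j) * zbinom i l) •
        g.coeff (m + n + k - (i + j : ℕ)) ((c l).coeff ((i + j : ℕ) - l) w) := by
    intro i j
    rw [mul_comm ((-1 : ℂ) ^ n * sbinom n j), add_comm j i, add_comm n m, ← smul_sub, ← map_sub, h,
      map_sum, Finset.smul_sum]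
    refine Finset.sum_congr rfl fun l _ => ?_
    rw [map_smul, smul_smul, Nat.cast_add]
  have h2 : ∀ i ∈ Finset.range B,
      (∑ j ∈ Finset.range B, ((-1 : ℂ) ^ n * sbinom n j * ((-1 : ℂ) ^ m * sbinom m i)) •
          g.coeff (n + m + k - (j + i : ℕ)) (a.coeff i (f.coeff j w)))
        - (∑ j ∈ Finset.range B, ((-1 : ℂ) ^ m * sbinom m i * ((-1 : ℂ) ^ n * sbinom n j)) •
          g.coeff (m + n + k - (i + j : ℕ)) (f.coeff j (a.coeff i w))) =
      ∑ l ∈ Finset.range N, ∑ j ∈ Finset.range B,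
        ((-1 : ℂ) ^ m * sbinom m i * ((-1 : ℂ) ^ n * sbinom n j) * zbinom i l) •
        g.coeff (m + n + k - (i + j : ℕ)) ((c l).coeff ((i + j : ℕ) - l) w) := by
    intro i _
    rw [← Finset.sum_sub_distrib, Finset.sum_comm]
    exact Finset.sum_congr rfl fun j _ => h1 i j
  rw [Finset.sum_congr rfl h2, Finset.sum_comm]
  refine Finset.sum_congr rfl fun l hl => ?_
  have hl := Finset.mem_range.mp hl
  rw [sum_range_range_add B
    (fun i j => (-1 : ℂ) ^ m * sbinom m i * ((-1 : ℂ) ^ n * sbinom n j) * zbinom i l)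
    (fun s => g.coeff (m + n + k - s) ((c l).coeff (s - l) w))
    (fun s hs => by rw [hB₃ l hl _ (by omega), map_zero]), coeff_smul, coeff_right,
    rightCoeff_eq _ _ _ _ _ (B - l) (fun j hj => hB₃ l hl _ (by omega)), Finset.smul_sum]
  have h3 : ∀ s : ℕ, ∑ p ∈ Finset.HasAntidiagonal.antidiagonal s,
      (-1 : ℂ) ^ m * sbinom m p.1 * ((-1 : ℂ) ^ n * sbinom n p.2) * zbinom p.1 l
      = if l ≤ s then (-1) ^ m * (-1) ^ n * (-1) ^ s * (zbinom m l * zbinom (m + n - l) (s - l))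
        else 0 := by
    intro s
    have := congrArg (fun z : ℂ => (-1) ^ m * (-1) ^ n * (-1) ^ s * z) (sum_zbinom_left m n l s)
    beta_reduce at this
    rw [mul_ite, mul_zero] at this
    rw [← this, Finset.mul_sum]
    refine Finset.sum_congr rfl fun p hp => ?_
    rw [← Finset.HasAntidiagonal.mem_antidiagonal.mp hp, pow_add, sbinom_eq, sbinom_eq]
    ring
  -- The coefficients with s < l are zero. This discards the modes of `c l` with negative index,
  -- which do not occur in a right product.
  rw [sum_range_shift (show l ≤ B by omega) fun s hs => by
    rw [h3, if_neg (by omega), zero_smul]]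
  refine Finset.sum_congr rfl fun s _ => ?_
  rw [h3, if_pos (Nat.le_add_right l s), smul_smul, Nat.add_sub_cancel_left]
  congr 1
  · rw [sbinom_eq, zpow_sub₀ (by norm_num), zpow_add₀ (by norm_num), zpow_natCast, pow_add]
    have : ((-1 : ℂ) ^ l)⁻¹ = (-1) ^ l := by
      rw [← inv_pow]; norm_num
    rw [div_eq_mul_inv, this]
    ring
  · rw [show m + n + k - ((l + s : ℕ) : ℤ) = m + n - l + k - s by push_cast; ring,
      show ((l + s : ℕ) : ℤ) - l = s by push_cast; ring]

/-- The commutator formula for residue products. -/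
theorem resProd_commutator {a f : FieldSpace W} {c : ℕ → FieldSpace W} {N : ℕ}
    (h : ∀ (p q : ℤ) (w : W), a.coeff p (f.coeff q w) - f.coeff q (a.coeff p w)
      = ∑ i ∈ Finset.range N, zbinom p i • (c i).coeff (p + q - i) w)
    (g : FieldSpace W) (m n : ℤ) :
    resProd m a (resProd n f g) - resProd n f (resProd m a g)
      = ∑ l ∈ Finset.range N, zbinom m l • resProd (m + n - l) (c l) g := by
  have hL := left_left_commutator h g m n
  have hR := right_right_commutator h g m n
  simp only [resProd, LinearMap.sub_apply, map_sub, smul_sub, Finset.sum_sub_distrib]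
  -- Left and right products commute for arbitrary fields, so the mixed terms cancel.
  rw [← hL, ← hR, left_right a f g, ← left_right f a g]
  abel

theorem IsLocal.resProd_commutator {a f : FieldSpace W} (h : IsLocal a f) (N : ℕ)
    (hN : ∀ n : ℤ, N ≤ n → resProd n a f = 0) (g : FieldSpace W) (m n : ℤ) :
    resProd m a (resProd n f g) = resProd n f (resProd m a g)
      + ∑ l ∈ Finset.range N, zbinom m l • resProd (m + n - l) (resProd l a f) g :=
  eq_add_of_sub_eq' (FieldSpace.resProd_commutator (h.commutator N hN) g m n)

end FieldSpace

/-! ## Locality of residue products -/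

section BinomExpand

variable {M : Type*} [AddCommGroup M]

theorem TruncatedSnd.add {f g : ℤ → ℤ → M} (hf : TruncatedSnd f) (hg : TruncatedSnd g) :
    TruncatedSnd fun s t => f s t + g s t := by
  obtain ⟨T, hT⟩ := hf
  obtain ⟨T', hT'⟩ := hg
  refine ⟨max T T', fun s t ht => ?_⟩
  beta_reduce
  rw [hT s t (by omega), hT' s t (by omega), add_zero]

variable [Module ℂ M]

theorem TruncatedSnd.smul {f : ℤ → ℤ → M} (c : ℂ) (hf : TruncatedSnd f) :
    TruncatedSnd fun s t => c • f s t := by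
  obtain ⟨T, hT⟩ := hf
  exact ⟨T, fun s t ht => by beta_reduce; rw [hT s t ht, smul_zero]⟩

theorem binomExpand_add (e : ℂ) (n : ℤ) {f g : ℤ → ℤ → M} (hf : TruncatedSnd f)
    (hg : TruncatedSnd g) (x y : ℤ) :
    binomExpand e n (fun s t => f s t + g s t) x y
      = binomExpand e n f x y + binomExpand e n g x y := by
  obtain ⟨N, hN⟩ := hf.exists_nat y
  obtain ⟨N', hN'⟩ := hg.exists_nat y
  have h1 : ∀ s t, y + (N + N' : ℕ) ≤ t → f s t = 0 := fun s t ht =>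
    hN s t (by push_cast at ht; omega)
  have h2 : ∀ s t, y + (N + N' : ℕ) ≤ t → g s t = 0 := fun s t ht =>
    hN' s t (by push_cast at ht; omega)
  rw [binomExpand_eq_range e n x y _ h1, binomExpand_eq_range e n x y _ h2,
    binomExpand_eq_range e n x y (N + N') (fun s t ht => by rw [h1 s t ht, h2 s t ht, add_zero]),
    ← Finset.sum_add_distrib]
  simp only [smul_add]

theorem binomExpand_smul (e : ℂ) (n : ℤ) {f : ℤ → ℤ → M} (hf : TruncatedSnd f) (c : ℂ) (x y : ℤ) :
    binomExpand e n (fun s t => c • f s t) x y = c • binomExpand e n f x y :=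
  (binomExpand_map (LinearMap.lsmul ℂ M c) e n hf x y).symm

/-- Truncation of the sum is proved together with the formula because the induction step needs it to
split off one summand. -/
theorem binomExpand_sum (e : ℂ) (n : ℤ) {ι : Type*} (S : Finset ι) (c : ι → ℂ) {f : ι → ℤ → ℤ → M}
    (hf : ∀ i, TruncatedSnd (f i)) (x y : ℤ) :
    TruncatedSnd (fun s t => ∑ i ∈ S, c i • f i s t) ∧
    binomExpand e n (fun s t => ∑ i ∈ S, c i • f i s t) x y
      = ∑ i ∈ S, c i • binomExpand e n (f i) x y := by
  classical
  induction S using Finset.induction_on with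
  | empty =>
    refine ⟨⟨0, fun _ _ _ => rfl⟩, ?_⟩
    simp only [Finset.sum_empty]
    rw [binomExpand_eq_range e n x y 0 (fun _ _ _ => rfl), Finset.sum_range_zero]
  | insert i S hi ih =>
    simp only [Finset.sum_insert hi]
    exact ⟨((hf i).smul (c i)).add ih.1, by
      rw [binomExpand_add e n ((hf i).smul (c i)) ih.1, binomExpand_smul e n (hf i), ih.2]⟩

end BinomExpand

namespace FieldSpace

variable {W : Type*} [AddCommGroup W] [Module ℂ W]

theorem truncatedSnd_comp_shift (a b : FieldSpace W) (w : W) (k : ℤ) :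
    TruncatedSnd fun s t => a.coeff s (b.coeff (k + t) w) := by
  obtain ⟨N, hN⟩ := b.exists_bound w
  exact ⟨N - k, fun s t ht => by beta_reduce; rw [hN _ (by omega), map_zero]⟩

/-- A field `f` acts on the products of two fields as a derivation. -/
theorem commutator_binomExpand {f a g : FieldSpace W} {fa fg : ℕ → FieldSpace W} {N : ℕ}
    (ha : ∀ (p q : ℤ) (w : W), f.coeff p (a.coeff q w) - a.coeff q (f.coeff p w)
      = ∑ i ∈ Finset.range N, zbinom p i • (fa i).coeff (p + q - i) w)
    (hg : ∀ (p q : ℤ) (w : W), f.coeff p (g.coeff q w) - g.coeff q (f.coeff p w)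
      = ∑ i ∈ Finset.range N, zbinom p i • (fg i).coeff (p + q - i) w)
    (e : ℂ) (m p x y : ℤ) (w : W) :
    f.coeff p (binomExpand e m (fun s t => a.coeff s (g.coeff t w)) x y)
        - binomExpand e m (fun s t => a.coeff s (g.coeff t (f.coeff p w))) x y
      = ∑ l ∈ Finset.range N, zbinom p l •
          (binomExpand e m (fun s t => (fa l).coeff s (g.coeff t w)) (p + x - l) y
            + binomExpand e m (fun s t => a.coeff s ((fg l).coeff t w)) x (p + y - l)) := by
  have hA : ∀ l : ℕ, TruncatedSnd fun s t => (fa l).coeff (p + s - l) (g.coeff t w) := by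
    intro l
    obtain ⟨T, hT⟩ := truncatedSnd_comp (fa l) g w
    exact ⟨T, fun s t ht => hT _ t ht⟩
  have hG : ∀ l : ℕ, TruncatedSnd fun s t => a.coeff s ((fg l).coeff (p + t - l) w) := by
    intro l
    have := truncatedSnd_comp_shift a (fg l) w (p - l)
    simpa only [sub_add_eq_add_sub] using this
  have e1 : f.coeff p (binomExpand e m (fun s t => a.coeff s (g.coeff t w)) x y)
      = binomExpand e m (fun s t => a.coeff s (g.coeff t (f.coeff p w))
        + ∑ l ∈ Finset.range N, zbinom p l • ((fa l).coeff (p + s - l) (g.coeff t w)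
          + a.coeff s ((fg l).coeff (p + t - l) w))) x y := by
    rw [binomExpand_map (f.coeff p) e m (truncatedSnd_comp a g w)]
    congr 1
    funext s t
    have h1 := ha p s (g.coeff t w)
    have h2 := congrArg (a.coeff s) (hg p t w)
    rw [map_sub, map_sum] at h2
    simp only [map_smul] at h2
    simp only [smul_add, Finset.sum_add_distrib]
    rw [← h1, ← h2]
    abel
  have hs := binomExpand_sum e m (Finset.range N) (fun l => zbinom p l)
    (fun l => (hA l).add (hG l)) x y
  rw [e1, binomExpand_add e m (truncatedSnd_comp a g (f.coeff p w)) hs.1, add_sub_cancel_left, hs.2]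
  refine Finset.sum_congr rfl fun l _ => ?_
  rw [binomExpand_add e m (hA l) (hG l)]
  -- Shifting one argument of the expanded family by p − l amounts to shifting the base point of the
  -- expansion.
  congr 2
  · refine finsum_congr fun i => ?_
    beta_reduce
    rw [show p + (x + m - i) - l = p + x - l + m - i by ring]
  · refine finsum_congr fun i => ?_
    beta_reduce
    rw [show p + (y + i) - l = p + y - l + i by ring]

/-- If `f` is local with `a`, with `g` and with `g` after taking products with `a`, then it is local with
all products of `a` and `g`. -/
theorem IsLocal.resProd_right {f a g : FieldSpace W} (hfa : IsLocal f a) (hfg : IsLocal f g)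
    (h : ∀ i : ℕ, IsLocal (resProd i f a) g) (m : ℤ) : IsLocal f (resProd m a g) := by
  obtain ⟨N₁, hN₁⟩ := hfa.exists_resProd_eq_zero
  obtain ⟨N₂, hN₂⟩ := hfg.exists_resProd_eq_zero
  set N := N₁ + N₂ with hN
  have hNa : ∀ n : ℤ, N ≤ n → resProd n f a = 0 := fun n hn => hN₁ n (by omega)
  have hNg : ∀ n : ℤ, N ≤ n → resProd n f g = 0 := fun n hn => hN₂ n (by omega)
  obtain ⟨S, hS⟩ : ∃ S : ℕ, ∀ l < N, ∀ n : ℤ, S ≤ n → resProd n (resProd l f a) g = 0 := by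
    choose S hS using fun l => (h l).exists_resProd_eq_zero
    refine ⟨(Finset.range N).sup S, fun l hl n hn => hS l n (le_trans ?_ hn)⟩
    exact_mod_cast Finset.le_sup (f := S) (Finset.mem_range.mpr hl)
  -- `M` bounds the nonzero products f_t g, and for l < N and s ≥ M − l it gives m + s ≥ S, where
  -- (f_l a)_(m+s) g vanishes.
  obtain ⟨M, hM, hM'⟩ : ∃ M : ℕ, N ≤ M ∧ (S : ℤ) - m + N ≤ M :=
    ⟨max N ((S : ℤ) - m + N).toNat, by omega, by omega⟩
  -- The aim is a commutator formula with the fields f_t(a_m g). Commuting f_p past a and g gives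
  -- terms indexed by l (`e1`), and the commutator formula for products expands f_t(a_m g) (`e2`).
  -- The two match after putting t = l + s and using the Borcherds identity for f_l a and g (`e4`).
  refine isLocal_of_commutator (fun t => resProd t f (resProd m a g)) M fun p q w => ?_
  have hca := hfa.commutator N hNa
  have hcg := hfg.commutator N hNg
  have e1 : f.coeff p ((resProd m a g).coeff q w) - (resProd m a g).coeff q (f.coeff p w)
      = ∑ l ∈ Finset.range N, zbinom p l • (bracketExpand (resProd l f a) g w (p - l) q m
          + (resProd m a (resProd l f g)).coeff (p + q - l) w) := by
    have h1 := commutator_binomExpand hca hcg (-1) m p 0 q w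
    have h2 := commutator_binomExpand hcg hca (-1) m p q 0 w
    simp only [coeff_resProd_eq_bracketExpand m a, bracketExpand, map_sub, map_smul]
    rw [sub_sub_sub_comm, ← smul_sub, h1, h2, Finset.smul_sum, ← Finset.sum_sub_distrib]
    refine Finset.sum_congr rfl fun l _ => ?_
    rw [add_zero]
    module
  have e2 : ∀ t : ℕ, resProd t f (resProd m a g) = resProd m a (resProd t f g)
      + ∑ l ∈ Finset.range N, zbinom t l • resProd (t + m - l) (resProd l f a) g := fun t =>
    hfa.resProd_commutator N hNa g t m
  have e3 : ∑ t ∈ Finset.range M, zbinom p t • (resProd m a (resProd t f g)).coeff (p + q - t) w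
      = ∑ l ∈ Finset.range N, zbinom p l • (resProd m a (resProd l f g)).coeff (p + q - l) w := by
    refine (Finset.sum_subset (Finset.range_subset_range.mpr hM) fun t _ ht => ?_).symm
    rw [hNg t (by rw [Finset.mem_range] at ht; omega), map_zero, coeff_zero, smul_zero]
  have e4 : ∀ l ∈ Finset.range N, ∑ t ∈ Finset.range M,
      zbinom p t • zbinom t l • (resProd (t + m - l) (resProd l f a) g).coeff (p + q - t) w
      = zbinom p l • bracketExpand (resProd l f a) g w (p - l) q m := by
    intro l hl
    have hl := Finset.mem_range.mp hl
    rw [sum_range_shift (show l ≤ M by omega), ← (h l).borcherds,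
      modeExpand_eq_range (M - l) _ _ _ _ (fun n hn => hS l hl n (by omega)), Finset.smul_sum]
    · refine Finset.sum_congr rfl fun s _ => ?_
      rw [smul_smul, smul_smul, zbinom_add_mul,
        show ((l + s : ℕ) : ℤ) + m - l = m + s by push_cast; ring,
        show p + q - ((l + s : ℕ) : ℤ) = q + (p - l) - s by push_cast; ring]
    · intro t ht
      rw [zbinom_natCast t l, Nat.choose_eq_zero_of_lt ht, Nat.cast_zero, zero_smul, smul_zero]
  simp only [e2, coeff_add, coeff_sum, coeff_smul, smul_add, Finset.smul_sum]
  rw [e1, Finset.sum_add_distrib, e3, Finset.sum_comm, Finset.sum_congr rfl e4]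
  simp only [smul_add, Finset.sum_add_distrib]
  rw [add_comm]

/-! ## Products with the identity field -/

/-- Negation of the upper index. -/
theorem sbinom_eq_zbinom (y : ℤ) (j : ℕ) : sbinom y j = zbinom (j - 1 - y) j := by
  have h := Ring.choose_neg (-y) j
  rw [neg_neg, show -y + (j : ℤ) - 1 = j - 1 - y by ring] at h
  rw [sbinom, zbinom, h, Units.smul_def, smul_eq_mul]
  push_cast
  rw [Int.coe_negOnePow_natCast, ← mul_assoc]
  push_cast
  rw [← mul_pow]
  norm_num

/-- After upper negation the upper index of the second factor no longer depends on i, and the sum is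
a Vandermonde convolution. -/
theorem sum_zbinom_mul_sbinom (x t : ℤ) (k : ℕ) :
    ∑ i ∈ Finset.range (k + 1), zbinom x i * sbinom (x + t - i) (k - i) = sbinom t k := by
  rw [sbinom_eq_zbinom t k, show (k : ℤ) - 1 - t = x + (k - 1 - t - x) by ring, zbinom_add,
    Finset.Nat.sum_antidiagonal_eq_sum_range_succ (fun i j => zbinom x i * zbinom (k - 1 - t - x) j)]
  refine Finset.sum_congr rfl fun i hi => ?_
  rw [sbinom_eq_zbinom, Nat.cast_sub (by have := Finset.mem_range.mp hi; omega)]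
  congr 2
  ring

theorem sbinom_natCast_of_lt {s j : ℕ} (h : s < j) : sbinom s j = 0 := by
  rw [sbinom_eq, zbinom_natCast, Nat.choose_eq_zero_of_lt h, Nat.cast_zero, mul_zero]

/-- Products with the identity field are divided powers of the derivative. -/
theorem coeff_resProd_one (f : FieldSpace W) (k : ℕ) (t : ℤ) (w : W) :
    (resProd (-k - 1) f (one W)).coeff t w = sbinom t k • f.coeff (t - k) w := by
  rw [coeff_resProd]
  -- The identity field has only the mode −1. The left half can meet it only for t < 0, the right
  -- half only for t ≥ 0, and each in at most one term.
  by_cases ht : t < 0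
  · obtain ⟨s, rfl⟩ : ∃ s : ℕ, t = -1 - s := ⟨(-1 - t).toNat, by omega⟩
    have hL : leftCoeff (-k - 1) f (one W) (-1 - s) w = sbinom (-k - 1) s • f.coeff (-1 - s - k) w := by
      unfold leftCoeff
      rw [finsum_eq_single _ s]
      · rw [coeff_one, if_pos (by omega), show -(k : ℤ) - 1 - s = -1 - s - k by ring]
      · intro j hj
        rw [coeff_one, if_neg (by omega), map_zero, smul_zero]
    have hR : rightCoeff (-k - 1) f (one W) (-1 - s) w = 0 := by
      unfold rightCoeff
      apply finsum_eq_zero_of_forall_eq_zero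
      intro j
      rw [coeff_one, if_neg (by omega), smul_zero]
    rw [hL, hR, sub_zero, sbinom_eq_zbinom, sbinom_eq_zbinom]
    congr 1
    rw [show (s : ℤ) - 1 - (-k - 1) = ((s + k : ℕ) : ℤ) by push_cast; ring,
      show (k : ℤ) - 1 - (-1 - s) = ((s + k : ℕ) : ℤ) by push_cast; ring, zbinom_natCast,
      zbinom_natCast, Nat.choose_symm_add]
  · obtain ⟨s, rfl⟩ : ∃ s : ℕ, t = s := ⟨t.toNat, by omega⟩
    have hL : leftCoeff (-k - 1) f (one W) s w = 0 := by
      unfold leftCoeff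
      apply finsum_eq_zero_of_forall_eq_zero
      intro j
      rw [coeff_one, if_neg (by omega), map_zero, smul_zero]
    rw [hL, zero_sub]
    unfold rightCoeff
    by_cases hs : s < k
    · rw [sbinom_natCast_of_lt hs, zero_smul, neg_eq_zero]
      apply finsum_eq_zero_of_forall_eq_zero
      intro j
      rw [coeff_one, if_neg (by omega), smul_zero]
    · obtain ⟨r, rfl⟩ := Nat.exists_eq_add_of_le (not_lt.mp hs)
      rw [finsum_eq_single _ r]
      · rw [coeff_one, if_pos (by push_cast; ring), ← neg_smul,
          show ((k + r : ℕ) : ℤ) - k = r by push_cast; ring]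
        congr 1
        rw [sbinom_eq_zbinom _ r, show (r : ℤ) - 1 - (-k - 1) = ((k + r : ℕ) : ℤ) by push_cast; ring,
          sbinom_eq, zbinom_natCast, zbinom_natCast, Nat.choose_symm_add, zpow_sub₀ (by norm_num),
          zpow_neg, zpow_natCast, zpow_one, ← inv_pow]
        norm_num
        ring
      · intro j hj
        rw [coeff_one, if_neg (by push_cast; omega), smul_zero]

theorem resProd_one_one (k : ℕ) :
    resProd (-k - 1) (one W) (one W) = if k = 0 then one W else 0 := by
  ext t w
  rw [coeff_resProd_one, coeff_one]
  rcases Nat.eq_zero_or_pos k with rfl | hk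
  · simp [sbinom_eq, zbinom_zero_right, coeff_one]
  · rw [if_neg (show k ≠ 0 by omega), coeff_zero]
    split_ifs with h
    · obtain ⟨s, rfl⟩ : ∃ s : ℕ, t = s := ⟨t.toNat, by omega⟩
      rw [sbinom_natCast_of_lt (by omega), zero_smul]
    · rw [smul_zero]

theorem resProd_neg_one_one (f : FieldSpace W) : resProd (-1) f (one W) = f := by
  ext t w
  have := coeff_resProd_one f 0 t w
  simpa [sbinom_eq, zbinom_zero_right] using this

/-- With ∂⁽ᵏ⁾ = ∂ᵏ/k!, this is the Leibniz rule for ∂⁽ᵏ⁾(a_m f) combined with (∂⁽ⁱ⁾a)_m = (−1)^i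
binom(m, i) a_(m−i). No locality is needed: both halves reduce to `sum_zbinom_mul_sbinom`. -/
theorem resProd_resProd_one (a f : FieldSpace W) (m : ℤ) (k : ℕ) :
    resProd (-k - 1) (resProd m a f) (one W)
      = ∑ i ∈ Finset.range (k + 1), sbinom m i • resProd (m - i) a (resProd (-k - 1 + i) f (one W)) := by
  have hone : ∀ i ∈ Finset.range (k + 1), ∀ (t : ℤ) (w : W),
      (resProd (-k - 1 + i) f (one W)).coeff t w = sbinom t (k - i) • f.coeff (t - k + i) w := by
    intro i hi t w
    have hi := Finset.mem_range.mp hi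
    rw [show -(k : ℤ) - 1 + i = -((k - i : ℕ) : ℤ) - 1 by omega, coeff_resProd_one,
      show t - ((k - i : ℕ) : ℤ) = t - k + i by omega]
  ext t w
  rw [coeff_resProd_one, coeff_resProd, coeff_sum, smul_sub]
  simp only [coeff_smul, coeff_resProd, smul_sub, Finset.sum_sub_distrib]
  congr 1
  · obtain ⟨N₀, hN₀⟩ := f.exists_nat_bound (t - k) w
    set N := k + 1 + N₀ with hN
    -- The condition i < k + 1 inside the summand guards the truncated subtraction k − i when i is
    -- later allowed to run up to N.
    have h1 : ∀ i ∈ Finset.range (k + 1),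
        sbinom m i • leftCoeff (m - i) a (resProd (-k - 1 + i) f (one W)) t w
        = ∑ j ∈ Finset.range N, (if i < k + 1 then sbinom m i * sbinom (m - i) j
            * sbinom (t + j) (k - i) else 0) • a.coeff (m - (i + j : ℕ)) (f.coeff (t - k + (i + j : ℕ)) w) := by
      intro i hi
      have hz : ∀ j : ℕ, N ≤ j → (resProd (-k - 1 + i) f (one W)).coeff (t + j) w = 0 := by
        intro j hj
        have := hN₀ (i + j) (by omega)
        rw [hone i hi, show t + j - k + i = t - k + (i + j : ℕ) by push_cast; ring, this, smul_zero]
      rw [leftCoeff_eq _ _ _ _ _ N hz, Finset.smul_sum]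
      refine Finset.sum_congr rfl fun j _ => ?_
      rw [hone i hi, map_smul, if_pos (Finset.mem_range.mp hi), smul_smul, smul_smul,
        show t + j - k + i = t - k + (i + j : ℕ) by push_cast; ring,
        show m - i - j = m - (i + j : ℕ) by push_cast; ring]
    rw [Finset.sum_congr rfl h1, Finset.sum_subset (Finset.range_subset_range.mpr
        (show k + 1 ≤ N by omega)) (fun i _ hi => by
        refine Finset.sum_eq_zero fun j _ => ?_
        rw [if_neg (by simpa using hi), zero_smul]),
      sum_range_range_add N (fun i j => if i < k + 1 then sbinom m i * sbinom (m - i) j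
            * sbinom (t + j) (k - i) else 0)
        (fun s => a.coeff (m - s) (f.coeff (t - k + s) w))
        (fun s hs => by rw [hN₀ s (by omega), map_zero]),
      leftCoeff_eq _ _ _ _ _ N (fun j hj => hN₀ j (by omega)), Finset.smul_sum]
    refine Finset.sum_congr rfl fun s _ => ?_
    rw [smul_smul]
    congr 1
    rw [Finset.Nat.sum_antidiagonal_eq_sum_range_succ (fun i j => if i < k + 1 then
      sbinom m i * sbinom (m - i) j * sbinom (t + j) (k - i) else 0)]
    have h2 : ∀ i ∈ Finset.range s.succ, (if i < k + 1 then sbinom m i * sbinom (m - i) (s - i : ℕ)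
        * sbinom (t + (s - i : ℕ)) (k - i) else 0)
        = sbinom m s * if i < k + 1 then zbinom s i * sbinom (s + t - i) (k - i) else 0 := by
      intro i hi
      obtain ⟨j, rfl⟩ := Nat.exists_eq_add_of_le (Nat.lt_succ_iff.mp (Finset.mem_range.mp hi))
      rw [Nat.add_sub_cancel_left]
      split_ifs
      · rw [show ((i + j : ℕ) : ℤ) + t - i = t + j by push_cast; ring, sbinom_eq m, sbinom_eq (m - i),
          sbinom_eq m, pow_add]
        linear_combination (-(-1) ^ i * (-1) ^ j * sbinom (t + j) (k - i)) * zbinom_add_mul m j i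
      · rw [mul_zero]
    have h3 : ∑ i ∈ Finset.range s.succ,
        (if i < k + 1 then zbinom s i * sbinom (s + t - i) (k - i) else 0)
        = ∑ i ∈ Finset.range (k + 1), zbinom s i * sbinom (s + t - i) (k - i) := by
      rw [← Finset.sum_filter]
      refine Finset.sum_subset (fun i hi => Finset.mem_range.mpr (Finset.mem_filter.mp hi).2)
        fun i hi hi' => ?_
      have : s < i := by
        rw [Finset.mem_filter, Finset.mem_range] at hi'
        rw [Finset.mem_range] at hi
        omega
      rw [zbinom_natCast s i, Nat.choose_eq_zero_of_lt this, Nat.cast_zero, zero_mul]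
    rw [Finset.sum_congr rfl h2, ← Finset.mul_sum, h3, sum_zbinom_mul_sbinom, mul_comm]
  · obtain ⟨N, hN⟩ := a.exists_nat_bound' w
    have h1 : ∀ i ∈ Finset.range (k + 1),
        sbinom m i • rightCoeff (m - i) a (resProd (-k - 1 + i) f (one W)) t w
        = ∑ j ∈ Finset.range N, ((-1) ^ m * sbinom m j
            * (zbinom (m - j) i * sbinom (m - j + t - i) (k - i)))
            • f.coeff (m + (t - k) - j) (a.coeff j w) := by
      intro i hi
      rw [rightCoeff_eq _ _ _ _ _ N hN, Finset.smul_sum]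
      refine Finset.sum_congr rfl fun j _ => ?_
      rw [hone i hi, smul_smul, smul_smul, show m - i + t - j - k + i = m + (t - k) - j by ring,
        show m - i + t - j = m - j + t - i by ring]
      congr 1
      have hsq : ((-1 : ℂ) ^ i) * ((-1) ^ i)⁻¹ = 1 := mul_inv_cancel₀ (pow_ne_zero _ (by norm_num))
      rw [zpow_sub₀ (by norm_num), zpow_natCast, sbinom_eq m, sbinom_eq (m - i), sbinom_eq m]
      rw [div_eq_mul_inv]
      linear_combination ((-1) ^ m * (-1) ^ j * sbinom (m - j + t - i) (k - i)) *
        ((zbinom m i * zbinom (m - i) j) * hsq + zbinom_mul_zbinom m i j)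
    rw [Finset.sum_congr rfl h1, Finset.sum_comm, rightCoeff_eq _ _ _ _ _ N hN, Finset.smul_sum]
    refine Finset.sum_congr rfl fun j _ => ?_
    rw [← Finset.sum_smul, ← Finset.mul_sum, sum_zbinom_mul_sbinom, smul_smul, mul_comm]

end FieldSpace

open FieldSpace

/-! ## The modules `M(1, λ)` -/

namespace WhittakerM1

variable {ℓ : ℕ} (lam : ℕ →₀ (Fin ℓ → ℂ))

theorem whittakerGen_def : whittakerGen (whittakerFunction lam)
    = (Submodule.Quotient.mk 1 : WhittakerM1 lam) := rfl

theorem mode_mem_nonneg (n : ℕ) (a : Fin ℓ → ℂ) : Heis.mode (n : ℤ) a ∈ Heis.nonneg ℓ := by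
  intro m hm
  rw [Heis.loop_mode, Finsupp.single_apply, if_neg (by omega)]

theorem whittakerFunction_mode (n : ℕ) (a : Fin ℓ → ℂ) :
    whittakerFunction lam ⟨Heis.mode (n : ℤ) a, mode_mem_nonneg n a⟩ = a ⬝ᵥ lam n := by
  change (lam.sum fun m v => Heis.loop (Heis.mode (n : ℤ) a) (m : ℤ) ⬝ᵥ v)
    + Heis.central (Heis.mode (n : ℤ) a) = _
  rw [Heis.central_mode, add_zero, Finsupp.sum, Finset.sum_eq_single n]
  · simp
  · intro m _ hm
    rw [Heis.loop_mode, Finsupp.single_apply, if_neg (by omega), zero_dotProduct]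
  · intro h
    rw [Finsupp.notMem_support_iff.mp h, dotProduct_zero]

theorem mode_smul_gen (n : ℕ) (a : Fin ℓ → ℂ) :
    UniversalEnvelopingAlgebra.ι ℂ (Heis.mode (n : ℤ) a) • whittakerGen (whittakerFunction lam)
      = (a ⬝ᵥ lam n) • whittakerGen (whittakerFunction lam) := by
  have h : UniversalEnvelopingAlgebra.ι ℂ (Heis.mode (n : ℤ) a) - algebraMap ℂ _
      (whittakerFunction lam ⟨Heis.mode (n : ℤ) a, mode_mem_nonneg n a⟩)
      ∈ whittakerIdeal (whittakerFunction lam) := Submodule.subset_span ⟨⟨_, _⟩, rfl⟩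
  rw [whittakerFunction_mode] at h
  rw [whittakerGen_def, ← Submodule.Quotient.mk_smul, ← Submodule.Quotient.mk_smul,
    Submodule.Quotient.eq, smul_eq_mul, mul_one, Algebra.smul_def, mul_one]
  exact h

variable {lam}

/-- A subspace that is stable under all `a(n)` is a `U(ĥ)`-submodule. -/
theorem smul_mem_of_mode {P : Submodule ℂ (WhittakerM1 lam)}
    (hP : ∀ (n : ℤ) (a : Fin ℓ → ℂ), ∀ w ∈ P, UniversalEnvelopingAlgebra.ι ℂ (Heis.mode n a) • w ∈ P)
    (u : UniversalEnvelopingAlgebra ℂ (Heis ℓ)) : ∀ w ∈ P, u • w ∈ P := by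
  induction u using uea_induction with
  | halg c => intro w hw; rw [algebraMap_smul]; exact P.smul_mem c hw
  | hmul u v hu hv => intro w hw; rw [mul_smul]; exact hu _ (hv w hw)
  | hadd u v hu hv => intro w hw; rw [add_smul]; exact P.add_mem (hu w hw) (hv w hw)
  | hι x =>
    induction x using Heis.induction with
    | hm n a => exact hP n a
    | hK => intro w hw; rw [K_smul]; exact hw
    | ha x y hx hy => intro w hw; rw [map_add, add_smul]; exact P.add_mem (hx w hw) (hy w hw)
    | hs c x hx => intro w hw; rw [map_smul, smul_assoc]; exact P.smul_mem c (hx w hw)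

theorem smul_gen_surjective (w : WhittakerM1 lam) :
    ∃ u : UniversalEnvelopingAlgebra ℂ (Heis ℓ), u • whittakerGen (whittakerFunction lam) = w := by
  induction w using Submodule.Quotient.induction_on with
  | H u => exact ⟨u, by rw [whittakerGen_def, ← Submodule.Quotient.mk_smul, smul_eq_mul, mul_one]⟩

theorem eq_top_of_mode {P : Submodule ℂ (WhittakerM1 lam)}
    (hgen : whittakerGen (whittakerFunction lam) ∈ P)
    (hP : ∀ (n : ℤ) (a : Fin ℓ → ℂ), ∀ w ∈ P,
      UniversalEnvelopingAlgebra.ι ℂ (Heis.mode n a) • w ∈ P) : P = ⊤ := by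
  rw [eq_top_iff]
  intro w _
  obtain ⟨u, rfl⟩ := smul_gen_surjective w
  exact smul_mem_of_mode hP u _ hgen

/-- `M(1, λ)` is spanned by the vectors `a¹(n₁) ⋯ aʳ(n_r) e^λ`. -/
theorem induction {p : WhittakerM1 lam → Prop} (gen : p (whittakerGen (whittakerFunction lam)))
    (add : ∀ v w, p v → p w → p (v + w)) (smul : ∀ (c : ℂ) w, p w → p (c • w))
    (mode : ∀ (n : ℤ) (a : Fin ℓ → ℂ) w, p w →
      p (UniversalEnvelopingAlgebra.ι ℂ (Heis.mode n a) • w)) (w : WhittakerM1 lam) : p w := by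
  let P : Submodule ℂ (WhittakerM1 lam) :=
    { carrier := {w | p w}
      add_mem' := fun {v w} hv hw => add v w hv hw
      zero_mem' := by simpa using smul 0 _ gen
      smul_mem' := fun c w hw => smul c w hw }
  have h : P = ⊤ := eq_top_of_mode gen fun n a w hw => mode n a w hw
  exact h.symm.le (Submodule.mem_top (x := w))

end WhittakerM1

/-! ## The vertex operators of a Heisenberg action -/

namespace HeisenbergAction

variable {ℓ : ℕ} {W : Type*} [AddCommGroup W] [Module ℂ W] (A : HeisenbergAction ℓ W)

theorem commutator_eq (a b : Fin ℓ → ℂ) (p q : ℤ) (w : W) :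
    (A.field a).coeff p ((A.field b).coeff q w) - (A.field b).coeff q ((A.field a).coeff p w)
      = ∑ i ∈ Finset.range 2, zbinom p i •
        (if i = 1 then (a ⬝ᵥ b) • one W else 0).coeff (p + q - i) w := by
  rw [A.comm, Finset.sum_range_succ, Finset.sum_range_one]
  simp only [zero_ne_one, if_false, if_true, coeff_zero, smul_zero, zero_add, coeff_smul, coeff_one]
  by_cases h : p + q = 0
  · rw [if_pos h, if_pos (by omega), smul_smul]
    congr 1
    simp [zbinom]
  · rw [if_neg h, if_neg (by omega), smul_zero, smul_zero]

theorem isLocal_field (a b : Fin ℓ → ℂ) : IsLocal (A.field a) (A.field b) :=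
  isLocal_of_commutator _ 2 (A.commutator_eq a b)

/-- The residue products `a(z)_i b(z)`, `i ≥ 0`, are multiples of the identity. -/
theorem resProd_field_field (a b : Fin ℓ → ℂ) (i : ℕ) :
    ∃ c : ℂ, resProd i (A.field a) (A.field b) = c • one W := by
  -- Applied to the identity field, b(z)₋₁ returns b(z) and a(z)_i gives 0. So a(z)_i b(z) is the
  -- correction term with l = 1, a multiple of the product Id_(i−2) Id, which is zero unless i = 1.
  have h := FieldSpace.resProd_commutator (A.commutator_eq a b) (one W) i (-1)
  rw [resProd_neg_one_one, resProd_one _ _ (Int.natCast_nonneg i), map_zero, sub_zero,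
    Finset.sum_range_succ, Finset.sum_range_one] at h
  refine ⟨if i = 1 then a ⬝ᵥ b else 0, ?_⟩
  rw [h, if_neg zero_ne_one, if_pos rfl, map_zero, LinearMap.zero_apply, smul_zero, zero_add, map_smul,
    LinearMap.smul_apply]
  have hone : ∀ m : ℤ, resProd m (one W) (one W) = if m = -1 then one W else 0 := by
    intro m
    by_cases hm : 0 ≤ m
    · rw [resProd_one _ _ hm, if_neg (by omega)]
    · obtain ⟨k, rfl⟩ : ∃ k : ℕ, m = -k - 1 := ⟨(-1 - m).toNat, by omega⟩
      rw [resProd_one_one]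
      by_cases hk : k = 0
      · rw [if_pos hk, if_pos (by omega)]
      · rw [if_neg hk, if_neg (by omega)]
  rw [hone]
  by_cases hi : i = 1
  · rw [if_pos hi, if_pos (by omega), hi]
    simp [zbinom]
  · rw [if_neg hi]
    by_cases h0 : (i : ℤ) + -1 - (1 : ℕ) = -1
    · omega
    · rw [if_neg h0, smul_zero, smul_zero, zero_smul]

/-- Build v up by modes and use `resProd_right`: its third hypothesis concerns multiples of the
identity field, which are local with everything. -/
theorem isLocal_field_Y (a : Fin ℓ → ℂ) (v : M1 ℓ) : IsLocal (A.field a) (A.Y v) := by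
  induction v using WhittakerM1.induction with
  | gen => exact (congrArg (IsLocal (A.field a)) A.Y_vacuum).mpr (isLocal_one_right _)
  | add v w hv hw => rw [map_add]; exact hv.add_right hw
  | smul c w hw => rw [map_smul]; exact hw.smul_right c
  | mode n b w hw =>
    rw [Y_mode]
    refine (A.isLocal_field a b).resProd_right hw (fun i => ?_) n
    obtain ⟨c, hc⟩ := A.resProd_field_field a b i
    rw [hc]
    exact ((isLocal_one_right (A.Y w)).smul_right c).symm

end HeisenbergAction

/-! ### Modes of vertex operators on the vacuum of M(1) -/

namespace M1

variable {ℓ : ℕ}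

theorem Y_mode (a : Fin ℓ → ℂ) (n : ℤ) (v : M1 ℓ) :
    M1.Y ℓ (UniversalEnvelopingAlgebra.ι ℂ (Heis.mode n a) • v)
      = resProd n ((WhittakerM1.action 0).field a) (M1.Y ℓ v) :=
  (WhittakerM1.action 0).Y_mode a n v

theorem Y_vacuum : M1.Y ℓ (vacuum ℓ) = one (M1 ℓ) := (WhittakerM1.action 0).Y_vacuum

theorem mode_smul_vacuum (n : ℕ) (a : Fin ℓ → ℂ) :
    UniversalEnvelopingAlgebra.ι ℂ (Heis.mode (n : ℤ) a) • vacuum ℓ = 0 := by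
  have := WhittakerM1.mode_smul_gen (0 : ℕ →₀ (Fin ℓ → ℂ)) n a
  rwa [Finsupp.coe_zero, Pi.zero_apply, dotProduct_zero, zero_smul] at this

/-- The right half of the residue product starts with some a(j), j ≥ 0, and these kill the vacuum.
-/
theorem coeff_Y_mode_vacuum (a : Fin ℓ → ℂ) (m n : ℤ) (v : M1 ℓ) :
    (M1.Y ℓ (UniversalEnvelopingAlgebra.ι ℂ (Heis.mode m a) • v)).coeff n (vacuum ℓ)
      = leftCoeff m ((WhittakerM1.action 0).field a) (M1.Y ℓ v) n (vacuum ℓ) := by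
  rw [Y_mode, coeff_resProd, rightCoeff_eq _ _ _ _ _ 0, Finset.sum_range_zero, sub_zero]
  exact fun j _ => mode_smul_vacuum j a

/-- `v_n 𝟏 = 0` for `n ≥ 0`. -/
theorem coeff_Y_vacuum_of_nonneg (v : M1 ℓ) (n : ℤ) (hn : 0 ≤ n) :
    (M1.Y ℓ v).coeff n (vacuum ℓ) = 0 := by
  induction v using WhittakerM1.induction generalizing n with
  | gen =>
    change (M1.Y ℓ (vacuum ℓ)).coeff n (vacuum ℓ) = 0
    rw [Y_vacuum, coeff_one, if_neg (by omega)]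
  | add v w hv hw => rw [map_add, coeff_add, hv n hn, hw n hn, add_zero]
  | smul c w hw => rw [map_smul, coeff_smul, hw n hn, smul_zero]
  | mode m a w hw =>
    rw [coeff_Y_mode_vacuum, leftCoeff_eq _ _ _ _ _ 0 (fun j _ => hw _ (by omega)),
      Finset.sum_range_zero]

end M1

/-! ### Compatibility with products, the Jacobi identity, twists and direct sums -/

namespace HeisenbergAction

variable {ℓ : ℕ} {W : Type*} [AddCommGroup W] [Module ℂ W] (A : HeisenbergAction ℓ W)

/-- For n ≥ 0 both sides vanish. For n < 0 they satisfy the same recursion in u: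
`resProd_resProd_one` for fields and `coeff_Y_mode_vacuum` in M(1) have equal coefficients. This is
the base case of `Y_coeff_Y`. -/
theorem resProd_Y_one (u : M1 ℓ) (n : ℤ) :
    resProd n (A.Y u) (one W) = A.Y ((M1.Y ℓ u).coeff n (M1.vacuum ℓ)) := by
  by_cases hn : 0 ≤ n
  · rw [resProd_one _ _ hn, M1.coeff_Y_vacuum_of_nonneg u n hn, map_zero]
  obtain ⟨k, rfl⟩ : ∃ k : ℕ, n = -k - 1 := ⟨(-1 - n).toNat, by omega⟩
  clear hn
  induction u using WhittakerM1.induction generalizing k with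
  | gen =>
    change resProd (-k - 1) (A.Y (M1.vacuum ℓ)) (one W)
      = A.Y ((M1.Y ℓ (M1.vacuum ℓ)).coeff (-k - 1) (M1.vacuum ℓ))
    rw [Y_vacuum, M1.Y_vacuum, coeff_one, resProd_one_one]
    by_cases hk : k = 0
    · rw [if_pos hk, if_pos (by omega), Y_vacuum]
    · rw [if_neg hk, if_neg (by omega), map_zero]
  | add v w hv hw =>
    simp only [map_add, LinearMap.add_apply, coeff_add]
    rw [hv, hw]
  | smul c w hw =>
    simp only [map_smul, LinearMap.smul_apply, coeff_smul]
    rw [hw]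
  | mode m a w hw =>
    rw [Y_mode, resProd_resProd_one, M1.coeff_Y_mode_vacuum, leftCoeff_eq _ _ _ _ _ (k + 1)
      (fun j hj => M1.coeff_Y_vacuum_of_nonneg w _ (by omega)), map_sum]
    refine Finset.sum_congr rfl fun i hi => ?_
    have hi := Finset.mem_range.mp hi
    rw [map_smul, WhittakerM1.action_coeff, Y_mode,
      show -(k : ℤ) - 1 + i = -((k - i : ℕ) : ℤ) - 1 by omega, hw]

/-- `Y_W(u_n v, z) = Y_W(u, z)_n Y_W(v, z)`. -/
theorem Y_coeff_Y (u v : M1 ℓ) (n : ℤ) :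
    A.Y ((M1.Y ℓ u).coeff n v) = resProd n (A.Y u) (A.Y v) := by
  induction v using WhittakerM1.induction generalizing u n with
  | gen =>
    refine (A.resProd_Y_one u n).symm.trans ?_
    rw [← Y_vacuum]
    rfl
  | add v w hv hw => rw [map_add, map_add, map_add, map_add, hv, hw]
  | smul c w hw => rw [map_smul, map_smul, map_smul, map_smul, hw]
  | mode m a w hw =>
    -- Move a(m) past u_n in M(1), and a(z)_m past Y(u, z)_n for fields on W. The correction terms
    -- carry the same coefficients and involve the vectors a(l)u, so the induction hypothesis is
    -- needed for every u.
    have hloc := (WhittakerM1.action (0 : ℕ →₀ (Fin ℓ → ℂ))).isLocal_field_Y a u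
    obtain ⟨N₁, hN₁⟩ := hloc.exists_resProd_eq_zero
    obtain ⟨N₂, hN₂⟩ := (A.isLocal_field_Y a u).exists_resProd_eq_zero
    have h1 := hloc.commutator (N₁ + N₂) (fun n hn => hN₁ n (by omega)) m n w
    have h2 := (A.isLocal_field_Y a u).resProd_commutator (N₁ + N₂) (fun n hn => hN₂ n (by omega))
      (A.Y w) m n
    rw [WhittakerM1.action_coeff, WhittakerM1.action_coeff] at h1
    have h3 := congrArg A.Y h1
    rw [map_sub, map_sum, Y_mode] at h3
    have h4 : ∀ l : ℕ, A.Y (zbinom m l • (resProd l ((WhittakerM1.action 0).field a)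
          ((WhittakerM1.action 0).Y u)).coeff (m + n - l) w)
        = zbinom m l • resProd (m + n - l) (resProd l (A.field a) (A.Y u)) (A.Y w) := by
      intro l
      rw [map_smul, ← HeisenbergAction.Y_mode, ← HeisenbergAction.Y_mode, ← hw]
      rfl
    rw [Finset.sum_congr rfl fun l _ => h4 l] at h3
    have h5 : A.Y (((WhittakerM1.action 0).Y u).coeff n w) = resProd n (A.Y u) (A.Y w) := hw u n
    rw [h5, h2, sub_eq_iff_eq_add, add_comm, add_left_cancel_iff] at h3
    rw [Y_mode]
    exact h3.symm

/-- The vertex operators of a Heisenberg action are mutually local. -/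
theorem isLocal_Y (u v : M1 ℓ) : IsLocal (A.Y u) (A.Y v) := by
  induction v using WhittakerM1.induction generalizing u with
  | gen => exact (congrArg (IsLocal (A.Y u)) A.Y_vacuum).mpr (isLocal_one_right _)
  | add v w hv hw => rw [map_add]; exact (hv u).add_right (hw u)
  | smul c w hw => rw [map_smul]; exact (hw u).smul_right c
  | mode m a w hw =>
    rw [Y_mode]
    refine (A.isLocal_field_Y a u).symm.resProd_right (hw u) (fun i => ?_) m
    -- Once a(z) is itself a vertex operator, Y(u, z)_i a(z) is the vertex operator of a vector, and
    -- the induction hypothesis covers all vectors in the first argument.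
    have : A.field a = A.Y (UniversalEnvelopingAlgebra.ι ℂ (Heis.mode (-1) a) • M1.vacuum ℓ) := by
      rw [Y_mode, Y_vacuum, resProd_neg_one_one]
    rw [this, ← Y_coeff_Y]
    exact hw _

/-- The Borcherds identity for the vertex operators of a Heisenberg action. -/
theorem borcherds (u v : M1 ℓ) (p q r : ℤ) (w : W) :
    modeExpand (fun n => A.Y ((M1.Y ℓ u).coeff n v)) w p q r
      = bracketExpand (A.Y u) (A.Y v) w p q r := by
  simp only [Y_coeff_Y]
  exact (A.isLocal_Y u v).borcherds w p q r

/-- This is `borcherds`, with both halves of the right-hand side cut at a common bound and merged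
into a single sum. -/
theorem jacobi (u v : M1 ℓ) (p q r : ℤ) (w : W) :
    ∑ᶠ i : ℕ, ((Ring.choose p i : ℤ) : ℂ) • (A.Y ((M1.Y ℓ u).coeff (r + i) v)).coeff (p + q - i) w =
      ∑ᶠ i : ℕ, ((-1 : ℂ) ^ i * ((Ring.choose r i : ℤ) : ℂ)) •
        ((A.Y u).coeff (p + r - i) ((A.Y v).coeff (q + i) w)
          - (-1 : ℂ) ^ r • (A.Y v).coeff (q + r - i) ((A.Y u).coeff (p + i) w)) := by
  have h := A.borcherds u v p q r w
  obtain ⟨N, hN⟩ := (truncatedSnd_comp (A.Y u) (A.Y v) w).exists_nat q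
  obtain ⟨N', hN'⟩ := (truncatedSnd_comp (A.Y v) (A.Y u) w).exists_nat p
  have h1 : ∀ s t, q + (N + N' : ℕ) ≤ t → (A.Y u).coeff s ((A.Y v).coeff t w) = 0 :=
    fun s t ht => hN s t (by push_cast at ht; omega)
  have h2 : ∀ s t, p + (N + N' : ℕ) ≤ t → (A.Y v).coeff s ((A.Y u).coeff t w) = 0 :=
    fun s t ht => hN' s t (by push_cast at ht; omega)
  rw [bracketExpand, binomExpand_eq_range _ _ _ _ _ h1, binomExpand_eq_range _ _ _ _ _ h2,
    Finset.smul_sum, ← Finset.sum_sub_distrib] at h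
  refine Eq.trans ?_ (finsum_eq_range (N + N') ?_).symm
  · refine Eq.trans (finsum_congr fun i => ?_) (h.trans (Finset.sum_congr rfl fun i _ => ?_))
    · rw [one_pow, one_mul, add_comm p q]
      rfl
    · rw [smul_sub, smul_comm ((-1 : ℂ) ^ r)]
      rfl
  · intro j hj
    rw [h1 _ _ (by omega), h2 _ _ (by omega), smul_zero, sub_zero, smul_zero]

theorem isWeakModule (S : Submodule ℂ (M1 ℓ)) : IsWeakModule (M1.Y ℓ) (M1.vacuum ℓ) S A.Y where
  vacuum := A.Y_vacuum
  jacobi u _ v _ p q r w := A.jacobi u v p q r w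

/-! ### Functoriality -/

/-- Vertex operators are compatible with maps of Heisenberg actions. -/
theorem map_coeff_Y {W' : Type*} [AddCommGroup W'] [Module ℂ W'] {A : HeisenbergAction ℓ W}
    {A' : HeisenbergAction ℓ W'} (φ : W →ₗ[ℂ] W')
    (h : ∀ a n w, φ ((A.field a).coeff n w) = (A'.field a).coeff n (φ w)) (v : M1 ℓ) (n : ℤ) (w : W) :
    φ ((A.Y v).coeff n w) = (A'.Y v).coeff n (φ w) := by
  induction v using WhittakerM1.induction generalizing n w with
  | gen =>
    change φ ((A.Y (M1.vacuum ℓ)).coeff n w) = (A'.Y (M1.vacuum ℓ)).coeff n (φ w)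
    rw [Y_vacuum, Y_vacuum, coeff_one, coeff_one]
    split_ifs
    · rfl
    · exact map_zero φ
  | add u v hu hv => rw [map_add, map_add, coeff_add, coeff_add, map_add, hu, hv]
  | smul c v hv => rw [map_smul, map_smul, coeff_smul, coeff_smul, map_smul, hv]
  | mode m a v hv =>
    rw [Y_mode, Y_mode, coeff_resProd_eq_bracketExpand, coeff_resProd_eq_bracketExpand, bracketExpand,
      bracketExpand, map_sub, map_smul, binomExpand_map φ _ _ (truncatedSnd_comp _ _ w),
      binomExpand_map φ _ _ (truncatedSnd_comp _ _ w)]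
    simp only [h, hv]

/-- The action twisted by `g ∈ O(ℓ)`, for which `a(n)` acts as `(g a)(n)`. -/
def twist (g : OrthGroup ℓ) : HeisenbergAction ℓ W where
  field := A.field ∘ₗ g.1.toLinearMap
  comm a b m n w := (A.comm (g.1 a) (g.1 b) m n w).trans (by rw [g.2 a b])

theorem twist_field (g : OrthGroup ℓ) (a : Fin ℓ → ℂ) : (A.twist g).field a = A.field (g.1 a) := rfl

/-- Both sides turn a(m) on v into the product with (ga)(z). Thus moving vectors by g amounts to
twisting the module. -/
theorem Y_act (g : OrthGroup ℓ) (v : M1 ℓ) : A.Y (OrthGroup.act g v) = (A.twist g).Y v := by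
  induction v using WhittakerM1.induction with
  | gen =>
    change A.Y (OrthGroup.act g (M1.vacuum ℓ)) = (A.twist g).Y (M1.vacuum ℓ)
    rw [OrthGroup.act_vacuum, Y_vacuum, Y_vacuum]
  | add u v hu hv => rw [map_add, map_add, map_add, hu, hv]
  | smul c v hv => rw [map_smul, map_smul, map_smul, hv]
  | mode m a v hv => rw [OrthGroup.act_mode, Y_mode, Y_mode, hv, twist_field]

/-- The direct product of finitely many actions on the same space. -/
def pi {ι : Type*} [Fintype ι] (B : ι → HeisenbergAction ℓ W) : HeisenbergAction ℓ (ι → W) where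
  field :=
    { toFun := fun a => ⟨fun n => LinearMap.pi fun i => ((B i).field a).coeff n ∘ₗ LinearMap.proj i,
        fun w => by
          choose N hN using fun i => ((B i).field a).exists_bound (w i)
          refine ⟨∑ i, |N i|, fun n hn => funext fun i => hN i n ?_⟩
          exact (le_abs_self _).trans ((Finset.single_le_sum (fun j _ => abs_nonneg (N j))
            (Finset.mem_univ i)).trans hn)⟩
      map_add' := fun a b => by
        ext n w i
        change ((B i).field (a + b)).coeff n (w i) = _
        rw [map_add]
        rfl
      map_smul' := fun c a => by
        ext n w i
        change ((B i).field (c • a)).coeff n (w i) = _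
        rw [map_smul]
        rfl }
  comm a b m n w := funext fun i => ((B i).comm a b m n (w i)).trans (by split_ifs <;> rfl)

theorem pi_Y_coeff {ι : Type*} [Fintype ι] (B : ι → HeisenbergAction ℓ W) (v : M1 ℓ) (n : ℤ)
    (w : ι → W) (i : ι) : ((pi B).Y v).coeff n w i = ((B i).Y v).coeff n (w i) :=
  map_coeff_Y (A := pi B) (A' := B i) (LinearMap.proj i) (fun _ _ _ => rfl) v n w

/-- The span of all `v_n w`, for fixed `w`, is stable under all `a(n)`. -/
theorem mode_mem_span_Y (w : W) (a : Fin ℓ → ℂ) (s : ℤ) :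
    ∀ x ∈ Submodule.span ℂ (Set.range fun p : M1 ℓ × ℤ => (A.Y p.1).coeff p.2 w),
      (A.field a).coeff s x ∈ Submodule.span ℂ (Set.range fun p : M1 ℓ × ℤ => (A.Y p.1).coeff p.2 w) := by
  set Q := Submodule.span ℂ (Set.range fun p : M1 ℓ × ℤ => (A.Y p.1).coeff p.2 w) with hQ
  have hmem : ∀ v n, (A.Y v).coeff n w ∈ Q := fun v n => Submodule.subset_span ⟨(v, n), rfl⟩
  obtain ⟨u, hu⟩ : ∃ u : M1 ℓ, A.Y u = A.field a :=
    ⟨UniversalEnvelopingAlgebra.ι ℂ (Heis.mode (-1) a) • M1.vacuum ℓ, by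
      rw [Y_mode, Y_vacuum, resProd_neg_one_one]⟩
  -- Use the Borcherds identity at p = P and r = s − P. Since a(t)w = 0 for t ≥ P, the half where
  -- a(z) acts first disappears, and Σ_i (−1)^i binom(s − P, i) a(s − i) v_(q+i) w lies in Q. The
  -- term i = 0 is the wanted one and the others have larger q, so the induction is on T − q, where
  -- v_q w = 0 for q ≥ T.
  obtain ⟨P, hP⟩ := (A.field a).exists_bound w
  have key : ∀ (v : M1 ℓ) (q s : ℤ), (A.field a).coeff s ((A.Y v).coeff q w) ∈ Q := by
    intro v
    obtain ⟨T, hT⟩ := (A.Y v).exists_bound w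
    have : ∀ (k : ℕ) (q s : ℤ), T ≤ q + k → (A.field a).coeff s ((A.Y v).coeff q w) ∈ Q := by
      intro k
      induction k with
      | zero => intro q s hq; rw [hT q (by simpa using hq), map_zero]; exact Q.zero_mem
      | succ k ih =>
        intro q s hq
        have hb := A.borcherds u v P q (s - P) w
        obtain ⟨N, hN⟩ := (truncatedSnd_comp (A.Y u) (A.Y v) w).exists_nat q
        have hz : binomExpand (-1) (s - P) (fun s t => (A.Y v).coeff s ((A.Y u).coeff t w)) q P = 0 := by
          rw [binomExpand_eq_range _ _ _ _ 0, Finset.sum_range_zero]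
          intro s t ht
          rw [hu, hP t (by simpa using ht), map_zero]
        have hl : modeExpand (fun n => A.Y ((M1.Y ℓ u).coeff n v)) w P q (s - P) ∈ Q := by
          obtain ⟨M, hM⟩ := (M1.Y ℓ u).exists_nat_bound (s - P) v
          rw [modeExpand_eq_range M]
          · exact Q.sum_mem fun i _ => Q.smul_mem _ (hmem _ _)
          · intro n hn
            obtain ⟨j, rfl⟩ : ∃ j : ℕ, n = s - P + j := ⟨(n - (s - P)).toNat, by omega⟩
            rw [hM j (by omega), map_zero]
        rw [hb, bracketExpand, hz, smul_zero, sub_zero, binomExpand_eq_range _ _ _ _ (N + 1)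
          (fun s t ht => hN s t (by push_cast at ht; omega)), Finset.sum_range_succ'] at hl
        have hr : ∑ i ∈ Finset.range N, ((-1 : ℂ) ^ (i + 1) * zbinom (s - P) (i + 1)) •
            (A.Y u).coeff (P + (s - P) - (i + 1 : ℕ)) ((A.Y v).coeff (q + (i + 1 : ℕ)) w) ∈ Q :=
          Q.sum_mem fun i _ => Q.smul_mem _ (by
            rw [hu]; exact ih _ _ (by push_cast at hq ⊢; omega))
        have := (Submodule.add_mem_iff_right Q hr).mp hl
        simpa [zbinom_zero_right, hu] using this
    exact fun q s => this (T - q).toNat q s (by omega)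
  intro x hx
  induction hx using Submodule.span_induction with
  | mem x hx => obtain ⟨p, rfl⟩ := hx; exact key _ _ _
  | zero => rw [map_zero]; exact Q.zero_mem
  | add x y _ _ hx hy => rw [map_add]; exact Q.add_mem hx hy
  | smul c x _ hx => rw [map_smul]; exact Q.smul_mem c hx

end HeisenbergAction

/-! ## The Whittaker function on modes -/

theorem Heis.nonneg_le {ℓ : ℕ} {P : Submodule ℂ (Heis ℓ)}
    (hm : ∀ (n : ℕ) (a : Fin ℓ → ℂ), Heis.mode (n : ℤ) a ∈ P) (hK : Heis.K ∈ P) :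
    ∀ x ∈ Heis.nonneg ℓ, x ∈ P := by
  intro x hx
  have e : x = Heis.ofLoop (Heis.loop x) + Heis.central x • Heis.K := by
    apply Heis.ext
    · rw [map_add, map_smul, Heis.loop_K, smul_zero, add_zero]; rfl
    · rw [map_add, map_smul, Heis.central_K, smul_eq_mul, mul_one]
      exact (zero_add _).symm
  rw [e]
  refine P.add_mem ?_ (P.smul_mem _ hK)
  rw [← Finsupp.sum_single (Heis.loop x), Finsupp.sum, map_sum]
  refine P.sum_mem fun n hn => ?_
  have h0 : 0 ≤ n := by
    by_contra h
    exact Finsupp.mem_support_iff.mp hn (hx n (not_le.mp h))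
  obtain ⟨k, rfl⟩ := Int.eq_ofNat_of_zero_le h0
  exact hm k _

/-- The linear extension by zero of the Whittaker function to the Heisenberg Lie algebra. -/
def whittakerLinear {ℓ : ℕ} (lam : ℕ →₀ (Fin ℓ → ℂ)) : Heis ℓ →ₗ[ℂ] ℂ where
  toFun x := (lam.sum fun n v => Heis.loop x (n : ℤ) ⬝ᵥ v) + Heis.central x
  map_add' x y := by
    simp only [map_add, Finsupp.add_apply, add_dotProduct, Finsupp.sum, Finset.sum_add_distrib]
    ring
  map_smul' c x := by
    simp only [map_smul, Finsupp.smul_apply, smul_dotProduct, Finsupp.sum,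
      RingHom.id_apply, smul_eq_mul, mul_add, Finset.mul_sum]

theorem whittakerLinear_mode {ℓ : ℕ} (lam : ℕ →₀ (Fin ℓ → ℂ)) (n : ℕ) (a : Fin ℓ → ℂ) :
    whittakerLinear lam (Heis.mode (n : ℤ) a) = a ⬝ᵥ lam n :=
  WhittakerM1.whittakerFunction_mode lam n a

theorem whittakerLinear_K {ℓ : ℕ} (lam : ℕ →₀ (Fin ℓ → ℂ)) : whittakerLinear lam Heis.K = 1 := by
  simp [whittakerLinear, Finsupp.sum]

/-- The algebra 𝔫 is spanned by the nonnegative modes and K, and the two functions always agree at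
K. -/
theorem twist_whittakerFunction_eq_iff {ℓ : ℕ} (lam : ℕ →₀ (Fin ℓ → ℂ)) (g : OrthGroup ℓ) :
    twist (whittakerFunction lam) g = whittakerFunction lam
      ↔ ∀ (n : ℕ) (a : Fin ℓ → ℂ), g.1 a ⬝ᵥ lam n = a ⬝ᵥ lam n := by
  constructor
  · intro h n a
    have h1 := DFunLike.congr_fun h ⟨_, WhittakerM1.mode_mem_nonneg n a⟩
    rw [WhittakerM1.whittakerFunction_mode] at h1
    rw [← h1, ← whittakerLinear_mode, ← OrthGroup.heisMapLinear_mode]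
    rfl
  · intro h
    ext ⟨x, hx⟩
    refine Heis.nonneg_le (P := LinearMap.eqLocus
      (whittakerLinear lam ∘ₗ OrthGroup.heisMapLinear g) (whittakerLinear lam)) ?_ ?_ x hx
    · intro n a
      rw [LinearMap.mem_eqLocus, LinearMap.comp_apply, OrthGroup.heisMapLinear_mode,
        whittakerLinear_mode, whittakerLinear_mode, h]
    · rw [LinearMap.mem_eqLocus, LinearMap.comp_apply, OrthGroup.heisMapLinear_K]

/-! ## The Fock space -/

namespace Fock

open MvPolynomial

variable {ℓ : ℕ} (lam : ℕ →₀ (Fin ℓ → ℂ))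

/-- The operator `h_i(n)` on the Fock space `ℂ[x_{k,i}]`, where `x_{k,i}` stands for `h_i(-k-1)`. -/
def basisOp (n : ℤ) (i : Fin ℓ) : Module.End ℂ (MvPolynomial (ℕ × Fin ℓ) ℂ) :=
  if n < 0 then LinearMap.mulLeft ℂ (X ((-n - 1).toNat, i))
  else (n : ℂ) • (pderiv (R := ℂ) ((n - 1).toNat, i)).toLinearMap + lam n.toNat i • 1

theorem pderiv_comm (x y : ℕ × Fin ℓ) (p : MvPolynomial (ℕ × Fin ℓ) ℂ) :
    pderiv x (pderiv y p) = pderiv y (pderiv x p) := by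
  have h : ⁅pderiv (R := ℂ) x, pderiv (R := ℂ) y⁆ = 0 := by
    apply MvPolynomial.derivation_ext
    intro i
    rw [Derivation.commutator_apply, pderiv_X, pderiv_X]
    simp [Pi.single_apply, apply_ite]
  have h1 := DFunLike.congr_fun h p
  rw [Derivation.commutator_apply] at h1
  exact sub_eq_zero.mp h1

theorem basisOp_neg (k : ℕ) (i : Fin ℓ) (p : MvPolynomial (ℕ × Fin ℓ) ℂ) :
    basisOp lam (-k - 1) i p = X (k, i) * p := by
  rw [basisOp, if_pos (by omega), show (-(-(k : ℤ) - 1) - 1).toNat = k by omega]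
  rfl

theorem basisOp_zero (i : Fin ℓ) (p : MvPolynomial (ℕ × Fin ℓ) ℂ) :
    basisOp lam 0 i p = lam 0 i • p := by
  rw [basisOp, if_neg (by omega)]
  simp

theorem basisOp_pos (k : ℕ) (i : Fin ℓ) (p : MvPolynomial (ℕ × Fin ℓ) ℂ) :
    basisOp lam (k + 1) i p = ((k : ℂ) + 1) • pderiv (k, i) p + lam (k + 1) i • p := by
  rw [basisOp, if_neg (by omega), show ((k : ℤ) + 1 - 1).toNat = k by omega,
    show ((k : ℤ) + 1).toNat = k + 1 by omega]
  simp

theorem basisOp_one (n : ℕ) (i : Fin ℓ) :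
    basisOp lam n i 1 = lam n i • (1 : MvPolynomial (ℕ × Fin ℓ) ℂ) := by
  cases n with
  | zero => exact basisOp_zero lam i 1
  | succ k =>
    push_cast
    rw [basisOp_pos, pderiv_one, smul_zero, zero_add]

theorem int_cases (n : ℤ) : (∃ k : ℕ, n = -k - 1) ∨ n = 0 ∨ ∃ k : ℕ, n = k + 1 := by
  rcases lt_trichotomy n 0 with h | h | h
  · exact Or.inl ⟨(-n - 1).toNat, by omega⟩
  · exact Or.inr (Or.inl h)
  · exact Or.inr (Or.inr ⟨(n - 1).toNat, by omega⟩)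

theorem basisOp_comm (m n : ℤ) (i j : Fin ℓ) (p : MvPolynomial (ℕ × Fin ℓ) ℂ) :
    basisOp lam m i (basisOp lam n j p) - basisOp lam n j (basisOp lam m i p)
      = if m + n = 0 ∧ i = j then (m : ℂ) • p else 0 := by
  rcases int_cases m with ⟨k, rfl⟩ | rfl | ⟨k, rfl⟩
  · rcases int_cases n with ⟨l, rfl⟩ | rfl | ⟨l, rfl⟩
    · rw [if_neg (by omega)]
      simp only [basisOp_neg]
      ring
    · rw [if_neg (by omega)]
      simp only [basisOp_neg, basisOp_zero, mul_smul_comm, sub_self]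
    · simp only [basisOp_neg, basisOp_pos, Derivation.leibniz, pderiv_X, smul_eq_mul]
      by_cases h : k = l ∧ i = j
      · obtain ⟨rfl, rfl⟩ := h
        rw [if_pos ⟨by ring, rfl⟩, Pi.single_eq_same]
        push_cast
        simp only [MvPolynomial.smul_eq_C_mul, map_sub, map_neg, map_add, map_one]
        ring
      · rw [if_neg (by rintro ⟨h1, h2⟩; exact h ⟨by omega, h2⟩),
          Pi.single_eq_of_ne (by rintro ⟨⟩; exact h ⟨rfl, rfl⟩)]
        simp only [MvPolynomial.smul_eq_C_mul]
        ring
  · simp only [basisOp_zero, map_smul, sub_self, Int.cast_zero, zero_smul, ite_self]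
  · rcases int_cases n with ⟨l, rfl⟩ | rfl | ⟨l, rfl⟩
    · simp only [basisOp_neg, basisOp_pos, Derivation.leibniz, pderiv_X, smul_eq_mul]
      by_cases h : k = l ∧ i = j
      · obtain ⟨rfl, rfl⟩ := h
        rw [if_pos ⟨by ring, rfl⟩, Pi.single_eq_same]
        push_cast
        simp only [MvPolynomial.smul_eq_C_mul, map_add, map_one]
        ring
      · rw [if_neg (by rintro ⟨h1, h2⟩; exact h ⟨by omega, h2⟩),
          Pi.single_eq_of_ne (by rintro ⟨⟩; exact h ⟨rfl, rfl⟩)]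
        simp only [MvPolynomial.smul_eq_C_mul]
        ring
    · rw [if_neg (by omega)]
      simp only [basisOp_zero, map_smul, sub_self]
    · rw [if_neg (by omega)]
      simp only [basisOp_pos, map_add, map_smul, pderiv_comm (k, i) (l, j)]
      module

/-- The operator `a(n)` on the Fock space. -/
def op (n : ℤ) : (Fin ℓ → ℂ) →ₗ[ℂ] Module.End ℂ (MvPolynomial (ℕ × Fin ℓ) ℂ) :=
  Fintype.linearCombination ℂ (basisOp lam n)

theorem op_apply (n : ℤ) (a : Fin ℓ → ℂ) (p : MvPolynomial (ℕ × Fin ℓ) ℂ) :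
    op lam n a p = ∑ i, a i • basisOp lam n i p := by
  simp [op, Fintype.linearCombination_apply, LinearMap.sum_apply]

theorem op_comm (m n : ℤ) (a b : Fin ℓ → ℂ) (p : MvPolynomial (ℕ × Fin ℓ) ℂ) :
    op lam m a (op lam n b p) - op lam n b (op lam m a p)
      = if m + n = 0 then ((m : ℂ) * (a ⬝ᵥ b)) • p else 0 := by
  have e1 : op lam m a (op lam n b p)
      = ∑ i, ∑ j, (a i * b j) • basisOp lam m i (basisOp lam n j p) := by
    simp only [op_apply, map_sum, map_smul, Finset.smul_sum, smul_smul]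
    rw [Finset.sum_comm]
    exact Finset.sum_congr rfl fun i _ => Finset.sum_congr rfl fun j _ => by rw [mul_comm]
  have e2 : op lam n b (op lam m a p)
      = ∑ i, ∑ j, (a i * b j) • basisOp lam n j (basisOp lam m i p) := by
    simp only [op_apply, map_sum, map_smul, Finset.smul_sum, smul_smul]
  rw [e1, e2]
  simp only [← Finset.sum_sub_distrib, ← smul_sub, basisOp_comm]
  by_cases h : m + n = 0
  · simp only [h, true_and, if_true, smul_ite, smul_zero, Finset.sum_ite_eq, Finset.mem_univ, smul_smul,
      ← Finset.sum_smul, dotProduct, Finset.mul_sum]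
    congr 1
    exact Finset.sum_congr rfl fun i _ => mul_comm _ _
  · simp [h]

/-- The linear map underlying `rep`. -/
def repLinear : Heis ℓ →ₗ[ℂ] Module.End ℂ (MvPolynomial (ℕ × Fin ℓ) ℂ) :=
  (Finsupp.lsum ℂ fun n : ℤ => op lam n) ∘ₗ Heis.loop
    + Heis.central.smulRight (1 : Module.End ℂ (MvPolynomial (ℕ × Fin ℓ) ℂ))

theorem repLinear_mode (n : ℤ) (a : Fin ℓ → ℂ) : repLinear lam (Heis.mode n a) = op lam n a := by
  simp [repLinear]

theorem repLinear_K : repLinear lam Heis.K = 1 := by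
  simp [repLinear]

theorem repLinear_lie (x y : Heis ℓ) : repLinear lam ⁅x, y⁆ = ⁅repLinear lam x, repLinear lam y⁆ := by
  have hb : ∀ x y : Heis ℓ, repLinear lam ⁅x, y⁆
      = Heis.cocycle x y • (1 : Module.End ℂ (MvPolynomial (ℕ × Fin ℓ) ℂ)) := fun x y => by
    rw [Heis.bracket_def, map_smul, repLinear_K]
  induction x using Heis.induction with
  | hK => rw [hb, repLinear_K]; simp [LieRing.of_associative_ring_bracket]
  | ha x x' h h' => rw [add_lie, map_add, h, h', map_add, add_lie]
  | hs c x h =>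
    rw [smul_lie, map_smul, h, map_smul]
    simp only [LieRing.of_associative_ring_bracket, smul_mul_assoc, mul_smul_comm, smul_sub]
  | hm m a =>
    induction y using Heis.induction with
    | hK => rw [hb, repLinear_K]; simp [LieRing.of_associative_ring_bracket]
    | ha x x' h h' => rw [lie_add, map_add, h, h', map_add, lie_add]
    | hs c x h =>
      rw [lie_smul, map_smul, h, map_smul]
      simp only [LieRing.of_associative_ring_bracket, smul_mul_assoc, mul_smul_comm, smul_sub]
    | hm n b =>
      rw [hb, repLinear_mode, repLinear_mode, Heis.cocycle_mode_mode,
        LieRing.of_associative_ring_bracket]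
      apply LinearMap.ext
      intro f
      rw [LinearMap.sub_apply, Module.End.mul_apply, Module.End.mul_apply, op_comm]
      split_ifs <;> simp

/-- The action of the Heisenberg Lie algebra on the Fock space. -/
def rep : Heis ℓ →ₗ⁅ℂ⁆ Module.End ℂ (MvPolynomial (ℕ × Fin ℓ) ℂ) :=
  { repLinear lam with map_lie' := fun {x y} => repLinear_lie lam x y }

theorem repLinear_one (x : Heis ℓ) (hx : x ∈ Heis.nonneg ℓ) :
    repLinear lam x 1 = whittakerLinear lam x • 1 := by
  refine Heis.nonneg_le (P := LinearMap.eqLocus (LinearMap.applyₗ 1 ∘ₗ repLinear lam)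
    ((whittakerLinear lam).smulRight 1)) ?_ ?_ x hx
  · intro n a
    rw [LinearMap.mem_eqLocus, LinearMap.smulRight_apply, whittakerLinear_mode, LinearMap.comp_apply,
      repLinear_mode, LinearMap.applyₗ_apply_apply, op_apply]
    simp only [basisOp_one, smul_smul, ← Finset.sum_smul]
    rfl
  · rw [LinearMap.mem_eqLocus, LinearMap.smulRight_apply, whittakerLinear_K, LinearMap.comp_apply,
      repLinear_K, LinearMap.applyₗ_apply_apply, one_smul, Module.End.one_apply]

theorem lift_rep_ideal (u : UniversalEnvelopingAlgebra ℂ (Heis ℓ))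
    (hu : u ∈ whittakerIdeal (whittakerFunction lam)) :
    UniversalEnvelopingAlgebra.lift ℂ (rep lam) u 1 = 0 := by
  unfold whittakerIdeal at hu
  induction hu using Submodule.span_induction with
  | mem u h =>
    obtain ⟨x, rfl⟩ := h
    rw [map_sub, UniversalEnvelopingAlgebra.lift_ι_apply, AlgHom.commutes, LinearMap.sub_apply]
    refine sub_eq_zero.mpr ((repLinear_one lam x x.2).trans ?_)
    rw [Module.algebraMap_end_apply]
    rfl
  | zero => rw [map_zero, LinearMap.zero_apply]
  | add u v _ _ h h' => rw [map_add, LinearMap.add_apply, h, h', add_zero]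
  | smul r u _ h => rw [smul_eq_mul, map_mul, Module.End.mul_apply, h, map_zero]

end Fock

/-- The Fock space serves this purpose only: the left ideal defining M(1, λ) annihilates the
polynomial 1, and the unit of U(ĥ) does not. -/
theorem WhittakerM1.gen_ne_zero {ℓ : ℕ} (lam : ℕ →₀ (Fin ℓ → ℂ)) :
    whittakerGen (whittakerFunction lam) ≠ 0 := by
  intro h
  have h1 := Fock.lift_rep_ideal lam 1 ((Submodule.Quotient.mk_eq_zero _).mp h)
  rw [map_one (UniversalEnvelopingAlgebra.lift ℂ (Fock.rep lam)), Module.End.one_apply] at h1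
  exact one_ne_zero h1

/-! ## Irreducibility of `M(1, λ)` over the Heisenberg Lie algebra -/

namespace WhittakerM1

variable {ℓ : ℕ} (lam : ℕ →₀ (Fin ℓ → ℂ))

theorem modeOp_apply (n : ℤ) (a : Fin ℓ → ℂ) (w : WhittakerM1 lam) :
    modeOp lam n a w = UniversalEnvelopingAlgebra.ι ℂ (Heis.mode n a) • w := rfl

theorem modeOp_comm (a b : Fin ℓ → ℂ) (m n : ℤ) (w : WhittakerM1 lam) :
    modeOp lam m a (modeOp lam n b w)
      = modeOp lam n b (modeOp lam m a w) + (if m + n = 0 then (m : ℂ) * (a ⬝ᵥ b) else 0) • w := by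
  rw [ite_smul, zero_smul]
  exact eq_add_of_sub_eq' ((action lam).comm a b m n w)

/-- The operator `a(n) - (a, λ_n)`, `n ≥ 0`, which annihilates the generator of `M(1, λ)`. -/
def ann (n : ℕ) (a : Fin ℓ → ℂ) : Module.End ℂ (WhittakerM1 lam) :=
  modeOp lam n a - (a ⬝ᵥ lam n) • 1

theorem ann_apply (n : ℕ) (a : Fin ℓ → ℂ) (w : WhittakerM1 lam) :
    ann lam n a w = modeOp lam n a w - (a ⬝ᵥ lam n) • w := rfl

theorem ann_gen (n : ℕ) (a : Fin ℓ → ℂ) : ann lam n a (whittakerGen (whittakerFunction lam)) = 0 := by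
  rw [ann_apply, modeOp_apply, mode_smul_gen, sub_self]

theorem ann_modeOp (n : ℕ) (a b : Fin ℓ → ℂ) (k : ℤ) (w : WhittakerM1 lam) :
    ann lam n a (modeOp lam k b w)
      = modeOp lam k b (ann lam n a w) + (if n + k = 0 then (n : ℂ) * (a ⬝ᵥ b) else 0) • w := by
  rw [ann_apply, ann_apply, modeOp_comm, map_sub, map_smul, Int.cast_natCast]
  abel

variable {lam}

/-- `M(1, λ)` is spanned by the vectors `a¹(-n₁) ⋯ aʳ(-n_r) e^λ`, `n_i > 0`. -/
theorem creation_induction {p : WhittakerM1 lam → Prop}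
    (gen : p (whittakerGen (whittakerFunction lam)))
    (add : ∀ v w, p v → p w → p (v + w)) (smul : ∀ (c : ℂ) w, p w → p (c • w))
    (create : ∀ (n : ℕ) (a : Fin ℓ → ℂ) w, p w → p (modeOp lam (-n - 1) a w))
    (w : WhittakerM1 lam) : p w := by
  let F : Set (Submodule ℂ (WhittakerM1 lam)) := {P | whittakerGen (whittakerFunction lam) ∈ P ∧
    ∀ (n : ℕ) (a : Fin ℓ → ℂ), ∀ w ∈ P, modeOp lam (-n - 1) a w ∈ P}
  have hgen : whittakerGen (whittakerFunction lam) ∈ sInf F :=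
    (Submodule.mem_sInf).mpr fun P hP => hP.1
  have hcreate : ∀ (n : ℕ) (a : Fin ℓ → ℂ), ∀ w ∈ sInf F, modeOp lam (-n - 1) a w ∈ sInf F :=
    fun n a w hw => (Submodule.mem_sInf).mpr fun P hP =>
      hP.2 n a w ((Submodule.mem_sInf).mp hw P hP)
  -- `T` consists of the vectors of the least creation-stable subspace that all a(n), n ≥ 0, keep
  -- inside it. Commutators of modes are scalars, so `T` is again creation-stable and minimality
  -- makes it everything. The least subspace is therefore stable under all modes.
  let T : Submodule ℂ (WhittakerM1 lam) :=
    sInf F ⊓ ⨅ (n : ℕ), ⨅ (a : Fin ℓ → ℂ), (sInf F).comap (modeOp lam n a)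
  have hT : T ∈ F := by
    constructor
    · refine ⟨hgen, ?_⟩
      simp only [SetLike.mem_coe, Submodule.mem_iInf, Submodule.mem_comap]
      intro n a
      rw [modeOp_apply, mode_smul_gen]
      exact Submodule.smul_mem _ _ hgen
    · rintro n a w ⟨hw, hw'⟩
      refine ⟨hcreate n a w hw, ?_⟩
      simp only [SetLike.mem_coe, Submodule.mem_iInf, Submodule.mem_comap] at hw' ⊢
      intro m b
      rw [modeOp_comm]
      exact Submodule.add_mem _ (hcreate n a _ (hw' m b)) (Submodule.smul_mem _ _ hw)
  have htop : sInf F = ⊤ := by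
    refine eq_top_of_mode hgen fun n a w hw => ?_
    by_cases hn : 0 ≤ n
    · obtain ⟨k, rfl⟩ := Int.eq_ofNat_of_zero_le hn
      have := ((sInf_le hT : sInf F ≤ T) hw).2
      simp only [SetLike.mem_coe, Submodule.mem_iInf, Submodule.mem_comap] at this
      exact this k a
    · obtain ⟨k, rfl⟩ : ∃ k : ℕ, n = -k - 1 := ⟨(-1 - n).toNat, by omega⟩
      exact hcreate k a w hw
  let P : Submodule ℂ (WhittakerM1 lam) :=
    { carrier := {w | p w}
      add_mem' := fun {v w} hv hw => add v w hv hw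
      zero_mem' := by simpa using smul 0 _ gen
      smul_mem' := fun c w hw => smul c w hw }
  exact (sInf_le (show P ∈ F from ⟨gen, create⟩) : sInf F ≤ P) (htop.symm.le Submodule.mem_top)

/-! ### Local nilpotency of the operators a(n) − (a, λ_n) -/

variable (lam) in
/-- The vectors killed by all products of `r` operators `a(n) - (a, λ_n)`. -/
def annKer : ℕ → Submodule ℂ (WhittakerM1 lam)
  | 0 => ⊥
  | r + 1 => ⨅ (n : ℕ), ⨅ (a : Fin ℓ → ℂ), (annKer r).comap (ann lam n a)

theorem mem_annKer_succ {r : ℕ} {w : WhittakerM1 lam} :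
    w ∈ annKer lam (r + 1) ↔ ∀ (n : ℕ) (a : Fin ℓ → ℂ), ann lam n a w ∈ annKer lam r := by
  simp only [annKer, Submodule.mem_iInf, Submodule.mem_comap]

theorem mem_annKer_zero {w : WhittakerM1 lam} : w ∈ annKer lam 0 ↔ w = 0 := Submodule.mem_bot ℂ

theorem annKer_mono : Monotone (annKer lam) := by
  refine monotone_nat_of_le_succ fun r => ?_
  induction r with
  | zero => exact bot_le
  | succ r ih => exact fun w hw => mem_annKer_succ.mpr fun n a => ih (mem_annKer_succ.mp hw n a)

/-- Commuting an annihilation operator past a mode costs only a scalar, so one mode raises the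
degree of nilpotency by at most one. -/
theorem modeOp_mem_annKer {r : ℕ} {w : WhittakerM1 lam} (hw : w ∈ annKer lam r) (k : ℤ)
    (b : Fin ℓ → ℂ) : modeOp lam k b w ∈ annKer lam (r + 1) := by
  induction r generalizing w with
  | zero => rw [mem_annKer_zero.mp hw, map_zero]; exact Submodule.zero_mem _
  | succ r ih =>
    refine mem_annKer_succ.mpr fun n a => ?_
    rw [ann_modeOp]
    exact Submodule.add_mem _ (ih (mem_annKer_succ.mp hw n a)) (Submodule.smul_mem _ _ hw)

theorem exists_mem_annKer (w : WhittakerM1 lam) : ∃ r, w ∈ annKer lam r := by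
  induction w using creation_induction with
  | gen =>
    refine ⟨1, mem_annKer_succ.mpr fun n a => ?_⟩
    rw [ann_gen]
    exact Submodule.zero_mem _
  | add v w hv hw =>
    obtain ⟨r, hr⟩ := hv
    obtain ⟨s, hs⟩ := hw
    exact ⟨max r s, Submodule.add_mem _ (annKer_mono (le_max_left r s) hr)
      (annKer_mono (le_max_right r s) hs)⟩
  | smul c w hw =>
    obtain ⟨r, hr⟩ := hw
    exact ⟨r, Submodule.smul_mem _ _ hr⟩
  | create n a w hw =>
    obtain ⟨r, hr⟩ := hw
    exact ⟨r + 1, modeOp_mem_annKer hr _ _⟩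

theorem ann_pow_eq_zero {r : ℕ} {w : WhittakerM1 lam} (hw : w ∈ annKer lam r) (n : ℕ)
    (a : Fin ℓ → ℂ) : (ann lam n a ^ r) w = 0 := by
  induction r generalizing w with
  | zero => rw [mem_annKer_zero.mp hw, map_zero]
  | succ r ih => rw [pow_succ, Module.End.mul_apply, ih (mem_annKer_succ.mp hw n a)]

/-! ### Number operators and Whittaker vectors -/

variable (lam) in
/-- The operator `∑_{0 < n ≤ N} ∑_i h_i(-n) (h_i(n) - (h_i, λ_n)) / n`, which counts the factors of the
vectors `a¹(-n₁) ⋯ aʳ(-n_r) e^λ` with `n_i ≤ N`. -/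
def number (N : ℕ) : Module.End ℂ (WhittakerM1 lam) :=
  ∑ n ∈ Finset.range N, ∑ i, ((n : ℂ) + 1)⁻¹ •
    (modeOp lam (-n - 1) (Pi.single i 1) * ann lam (n + 1) (Pi.single i 1))

theorem number_apply (N : ℕ) (w : WhittakerM1 lam) :
    number lam N w = ∑ n ∈ Finset.range N, ∑ i, ((n : ℂ) + 1)⁻¹ •
      modeOp lam (-n - 1) (Pi.single i 1) (ann lam (n + 1) (Pi.single i 1) w) := by
  simp [number, LinearMap.sum_apply]

/-- Only the summand n = k fails to commute with b(−k−1). There the commutator is (k + 1)(h_i, b),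
the weight cancels k + 1, and the sum over the orthonormal basis restores b. -/
theorem number_modeOp {N k : ℕ} (hk : k < N) (b : Fin ℓ → ℂ) (w : WhittakerM1 lam) :
    number lam N (modeOp lam (-k - 1) b w)
      = modeOp lam (-k - 1) b (number lam N w) + modeOp lam (-k - 1) b w := by
  have hb : modeOp lam (-k - 1) b w = ∑ i, b i • modeOp lam (-k - 1) (Pi.single i 1) w := by
    conv_lhs => rw [pi_eq_sum_univ' b]
    rw [map_sum, LinearMap.sum_apply]
    simp
  have h1 : ∀ n : ℕ, ∀ i, modeOp lam (-n - 1) (Pi.single i 1)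
      (ann lam (n + 1) (Pi.single i 1) (modeOp lam (-k - 1) b w))
      = modeOp lam (-k - 1) b (modeOp lam (-n - 1) (Pi.single i 1) (ann lam (n + 1) (Pi.single i 1) w))
        + (if n = k then ((n : ℂ) + 1) * b i else 0) • modeOp lam (-n - 1) (Pi.single i 1) w := by
    intro n i
    rw [ann_modeOp, map_add, map_smul, modeOp_comm, if_neg (by omega), zero_smul, add_zero,
      single_one_dotProduct]
    congr 2
    by_cases h : n = k
    · rw [if_pos h, if_pos (by push_cast; omega)]
      push_cast
      rfl
    · rw [if_neg h, if_neg (by push_cast; omega)]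
  rw [number_apply, number_apply]
  simp only [h1, smul_add, Finset.sum_add_distrib, map_sum, map_smul, smul_smul]
  congr 1
  rw [Finset.sum_eq_single k]
  · rw [hb]
    refine Finset.sum_congr rfl fun i _ => ?_
    rw [if_pos rfl, ← mul_assoc, inv_mul_cancel₀ (by exact_mod_cast Nat.succ_ne_zero k), one_mul]
  · intro n _ hn
    refine Finset.sum_eq_zero fun i _ => ?_
    rw [if_neg hn, mul_zero, zero_smul]
  · intro h
    exact absurd (Finset.mem_range.mpr hk) h

theorem number_eq_zero (N : ℕ) {w : WhittakerM1 lam} (hw : w ∈ annKer lam 1) :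
    number lam N w = 0 := by
  rw [number_apply]
  refine Finset.sum_eq_zero fun n _ => Finset.sum_eq_zero fun i _ => ?_
  rw [mem_annKer_zero.mp (mem_annKer_succ.mp hw _ _), map_zero, smul_zero]

theorem gen_mem_annKer : whittakerGen (whittakerFunction lam) ∈ annKer lam 1 :=
  mem_annKer_succ.mpr fun n a => by rw [ann_gen]; exact Submodule.zero_mem _

variable (lam) in
/-- The product of the operators `number N - s`, `1 ≤ s ≤ r`. -/
def numberProd (N : ℕ) : ℕ → Module.End ℂ (WhittakerM1 lam)
  | 0 => 1
  | r + 1 => (number lam N - ((r : ℂ) + 1) • 1) * numberProd N r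

theorem numberProd_succ_apply (N r : ℕ) (w : WhittakerM1 lam) :
    numberProd lam N (r + 1) w
      = number lam N (numberProd lam N r w) - ((r : ℂ) + 1) • numberProd lam N r w := rfl

/-- On a vector killed by `number` the factor with index s acts as −s, so the scalar is (−1)^r r!.
-/
theorem numberProd_annKer (N r : ℕ) {w : WhittakerM1 lam} (hw : w ∈ annKer lam 1) :
    ∃ c : ℂ, c ≠ 0 ∧ numberProd lam N r w = c • w := by
  induction r with
  | zero => exact ⟨1, one_ne_zero, (one_smul ℂ w).symm⟩
  | succ r ih =>
    obtain ⟨c, hc, h⟩ := ih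
    refine ⟨-((r : ℂ) + 1) * c, mul_ne_zero (neg_ne_zero.mpr (by exact_mod_cast Nat.succ_ne_zero r)) hc,
      ?_⟩
    rw [numberProd_succ_apply, h, map_smul, number_eq_zero N hw]
    module

/-- Passing b(−k−1) lowers each s by one, so the factors 1 ≤ s ≤ r + 1 become 0 ≤ s ≤ r, and the
factor s = 0 is `number` itself. -/
theorem numberProd_modeOp {N k : ℕ} (hk : k < N) (r : ℕ) (b : Fin ℓ → ℂ) (w : WhittakerM1 lam) :
    numberProd lam N (r + 1) (modeOp lam (-k - 1) b w)
      = modeOp lam (-k - 1) b (number lam N (numberProd lam N r w)) := by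
  induction r with
  | zero =>
    rw [numberProd_succ_apply]
    change number lam N (modeOp lam (-k - 1) b w) - _ • modeOp lam (-k - 1) b w
      = modeOp lam (-k - 1) b (number lam N w)
    rw [number_modeOp hk]
    module
  | succ r ih =>
    rw [numberProd_succ_apply, ih, number_modeOp hk, numberProd_succ_apply]
    simp only [map_sub, map_smul]
    push_cast
    module

theorem numberProd_mem_of_le {N r s : ℕ} (hrs : r ≤ s) {w : WhittakerM1 lam}
    (hw : numberProd lam N r w ∈ Submodule.span ℂ {whittakerGen (whittakerFunction lam)}) :
    numberProd lam N s w ∈ Submodule.span ℂ {whittakerGen (whittakerFunction lam)} := by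
  induction s, hrs using Nat.le_induction with
  | base => exact hw
  | succ s _ ih =>
    obtain ⟨c, hc⟩ := Submodule.mem_span_singleton.mp ih
    rw [numberProd_succ_apply, ← hc, map_smul, number_eq_zero N gen_mem_annKer, smul_zero, zero_sub]
    exact Submodule.neg_mem _ (Submodule.smul_mem _ _ (Submodule.smul_mem _ _
      (Submodule.mem_span_singleton_self _)))

/-- Each further creation operator costs one more factor: by `numberProd_modeOp`, `number` is then
applied to a multiple of the generator and gives zero. `N₀` must exceed every index that occurs, as
`number` sees no others. -/
theorem exists_numberProd_mem (w : WhittakerM1 lam) : ∃ N₀ r : ℕ, ∀ N, N₀ ≤ N →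
    numberProd lam N r w ∈ Submodule.span ℂ {whittakerGen (whittakerFunction lam)} := by
  induction w using creation_induction with
  | gen => exact ⟨0, 0, fun N _ => Submodule.mem_span_singleton_self _⟩
  | add v w hv hw =>
    obtain ⟨N₁, r₁, h₁⟩ := hv
    obtain ⟨N₂, r₂, h₂⟩ := hw
    refine ⟨max N₁ N₂, max r₁ r₂, fun N hN => ?_⟩
    rw [map_add]
    exact Submodule.add_mem _
      (numberProd_mem_of_le (le_max_left _ _) (h₁ N (le_trans (le_max_left _ _) hN)))
      (numberProd_mem_of_le (le_max_right _ _) (h₂ N (le_trans (le_max_right _ _) hN)))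
  | smul c w hw =>
    obtain ⟨N₁, r₁, h₁⟩ := hw
    exact ⟨N₁, r₁, fun N hN => by rw [map_smul]; exact Submodule.smul_mem _ _ (h₁ N hN)⟩
  | create n a w hw =>
    obtain ⟨N₁, r₁, h₁⟩ := hw
    refine ⟨max N₁ (n + 1), r₁ + 1, fun N hN => ?_⟩
    obtain ⟨c, hc⟩ := Submodule.mem_span_singleton.mp (h₁ N (le_trans (le_max_left _ _) hN))
    rw [numberProd_modeOp (lt_of_lt_of_le (Nat.lt_succ_self n) (le_trans (le_max_right _ _) hN)), ← hc,
      map_smul, number_eq_zero N gen_mem_annKer, smul_zero, map_zero]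
    exact Submodule.zero_mem _

/-- The Whittaker vectors of `M(1, λ)` are the multiples of the generator. -/
theorem exists_smul_gen_of_mem_annKer {w : WhittakerM1 lam} (hw : w ∈ annKer lam 1) :
    ∃ c : ℂ, w = c • whittakerGen (whittakerFunction lam) := by
  -- One and the same operator multiplies the Whittaker vector by a nonzero scalar and sends it to
  -- the line of the generator.
  obtain ⟨N, r, h⟩ := exists_numberProd_mem w
  obtain ⟨c, hc, h1⟩ := numberProd_annKer N r hw
  obtain ⟨d, hd⟩ := Submodule.mem_span_singleton.mp (h N le_rfl)
  exact ⟨c⁻¹ * d, by rw [mul_smul, hd, h1, smul_smul, inv_mul_cancel₀ hc, one_smul]⟩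

/-- `M(1, λ)` is an irreducible module over the Heisenberg Lie algebra. -/
theorem eq_top_of_modeOp_mem {P : Submodule ℂ (WhittakerM1 lam)}
    (hP : ∀ (n : ℤ) (a : Fin ℓ → ℂ), ∀ w ∈ P, modeOp lam n a w ∈ P) {w : WhittakerM1 lam}
    (hw : w ∈ P) (h0 : w ≠ 0) : P = ⊤ := by
  refine eq_top_of_mode ?_ hP
  obtain ⟨r, hr⟩ := exists_mem_annKer w
  induction r generalizing w with
  | zero => exact absurd (mem_annKer_zero.mp hr) h0
  | succ r ih =>
    -- Either w is a Whittaker vector, hence a multiple of the generator, or some annihilation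
    -- operator gives a nonzero vector of P of lower degree.
    by_cases h : ∀ (n : ℕ) (a : Fin ℓ → ℂ), ann lam n a w = 0
    · obtain ⟨c, hc⟩ := exists_smul_gen_of_mem_annKer
        (mem_annKer_succ.mpr fun n a => mem_annKer_zero.mpr (h n a))
      have hc0 : c ≠ 0 := by
        rintro rfl
        exact h0 (by rw [hc, zero_smul])
      have := P.smul_mem c⁻¹ hw
      rwa [hc, smul_smul, inv_mul_cancel₀ hc0, one_smul] at this
    · push Not at h
      obtain ⟨n, a, h⟩ := h
      exact ih (P.sub_mem (hP n a w hw) (P.smul_mem _ hw)) h (mem_annKer_succ.mp hr n a)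

/-- The operators `a(n)`, `n ≥ 0`, have no eigenvalue other than `(a, λ_n)`. -/
theorem modeOp_sub_ne_zero {n : ℕ} {a : Fin ℓ → ℂ} {c : ℂ} (hc : c ≠ a ⬝ᵥ lam n)
    {w : WhittakerM1 lam} (hw : w ≠ 0) : modeOp lam n a w - c • w ≠ 0 := by
  intro h
  have h1 : ann lam n a w = (c - a ⬝ᵥ lam n) • w := by
    rw [ann_apply, sub_eq_zero.mp h, sub_smul]
  have h2 : ∀ r : ℕ, (ann lam n a ^ r) w = (c - a ⬝ᵥ lam n) ^ r • w := by
    intro r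
    induction r with
    | zero => rw [pow_zero, pow_zero, one_smul, Module.End.one_apply]
    | succ r ih => rw [pow_succ, Module.End.mul_apply, h1, map_smul, ih, smul_smul, pow_succ']
  obtain ⟨r, hr⟩ := exists_mem_annKer w
  have h3 := ann_pow_eq_zero hr n a
  rw [h2] at h3
  exact (smul_ne_zero (pow_ne_zero _ (sub_ne_zero.mpr hc)) hw) h3

end WhittakerM1

/-! ## Orbifolds -/

namespace OrthGroup

variable {ℓ : ℕ}

theorem act_one (v : M1 ℓ) : act 1 v = v := by
  induction v using WhittakerM1.induction with
  | gen => exact act_vacuum 1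
  | add u v hu hv => rw [map_add, hu, hv]
  | smul c v hv => rw [map_smul, hv]
  | mode n a v hv => rw [act_mode, hv]; rfl

theorem act_mul (g h : OrthGroup ℓ) (v : M1 ℓ) : act (g * h) v = act g (act h v) := by
  induction v using WhittakerM1.induction with
  | gen =>
    refine (act_vacuum (g * h)).trans ?_
    change _ = act g (act h (M1.vacuum ℓ))
    rw [act_vacuum, act_vacuum]
  | add u v hu hv => rw [map_add, map_add, map_add, hu, hv]
  | smul c v hv => rw [map_smul, map_smul, map_smul, hv]
  | mode n a v hv => rw [act_mode, act_mode, act_mode, hv]; rfl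

/-- `O(ℓ)` acts on `M(1)` by automorphisms. -/
theorem act_coeff_Y (g : OrthGroup ℓ) (u v : M1 ℓ) (n : ℤ) :
    act g ((M1.Y ℓ u).coeff n v) = (M1.Y ℓ (act g u)).coeff n (act g v) := by
  -- `act g` is a map of Heisenberg actions from M(1) to its twist by g, so functoriality applies;
  -- `Y_act` then removes the twist.
  have h := HeisenbergAction.map_coeff_Y (A := WhittakerM1.action 0)
    (A' := (WhittakerM1.action 0).twist g) (act g) (fun a n w => act_mode g a n w) u n v
  rw [← HeisenbergAction.Y_act] at h
  exact h

end OrthGroup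

theorem orbifold_isVertexSubalgebra {ℓ : ℕ} (G : Subgroup (OrthGroup ℓ)) :
    IsVertexSubalgebra (M1.Y ℓ) (M1.vacuum ℓ) (orbifold G) where
  vac_mem g _ := OrthGroup.act_vacuum g
  coeff_mem u hu v hv n g hg := by rw [OrthGroup.act_coeff_Y, hu g hg, hv g hg]

theorem mem_orbifold_zpowers {ℓ : ℕ} {g : OrthGroup ℓ} (hg : IsOfFinOrder g) {v : M1 ℓ}
    (hv : OrthGroup.act g v = v) : v ∈ orbifold (Subgroup.zpowers g) := by
  intro h hh
  obtain ⟨k, rfl⟩ := Submonoid.mem_powers_iff _ _ |>.mp (hg.mem_powers_iff_mem_zpowers.mpr hh)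
  induction k with
  | zero => rw [pow_zero, OrthGroup.act_one]
  | succ k ih =>
    rw [pow_succ, OrthGroup.act_mul, hv]
    exact ih ⟨k, zpow_natCast g k⟩

/-- Applying g permutes the summands cyclically. This trace supplies the fixed vectors used in the
averaging argument. -/
theorem sum_act_mem_orbifold {ℓ : ℕ} {g : OrthGroup ℓ} (hg : IsOfFinOrder g) (v : M1 ℓ) :
    ∑ i : Fin (orderOf g), OrthGroup.act (g ^ (i : ℕ)) v ∈ orbifold (Subgroup.zpowers g) := by
  refine mem_orbifold_zpowers hg ?_
  rw [map_sum, Fin.sum_univ_eq_sum_range (fun i => OrthGroup.act (g ^ i) v),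
    Fin.sum_univ_eq_sum_range (fun i => OrthGroup.act g (OrthGroup.act (g ^ i) v))]
  have h1 := Finset.sum_range_succ (fun i => OrthGroup.act (g ^ i) v) (orderOf g)
  rw [Finset.sum_range_succ', pow_orderOf_eq_one, pow_zero] at h1
  rw [← add_right_cancel h1]
  exact Finset.sum_congr rfl fun i _ => by rw [pow_succ', OrthGroup.act_mul]

/-! ### Irreducibility over the fixed points of an isometry of finite order -/

namespace WhittakerM1

variable {ℓ : ℕ} {lam : ℕ →₀ (Fin ℓ → ℂ)}

variable (lam) in
/-- The direct sum of the twists of `M(1, λ)` by `g⁰, …, g^{p-1}`, where `p` is the order of `g`. -/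
def twistSum (g : OrthGroup ℓ) : HeisenbergAction ℓ (Fin (orderOf g) → WhittakerM1 lam) :=
  HeisenbergAction.pi fun i => (action lam).twist (g ^ (i : ℕ))

theorem twistSum_field (g : OrthGroup ℓ) (a : Fin ℓ → ℂ) (n : ℤ)
    (x : Fin (orderOf g) → WhittakerM1 lam) (i : Fin (orderOf g)) :
    ((twistSum lam g).field a).coeff n x i = modeOp lam n ((g ^ (i : ℕ)).1 a) (x i) := rfl

theorem twistSum_Y (g : OrthGroup ℓ) (v : M1 ℓ) (n : ℤ)
    (x : Fin (orderOf g) → WhittakerM1 lam) (i : Fin (orderOf g)) :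
    ((twistSum lam g).Y v).coeff n x i
      = (WhittakerM1.Y lam (OrthGroup.act (g ^ (i : ℕ)) v)).coeff n (x i) := by
  rw [twistSum, HeisenbergAction.pi_Y_coeff, ← HeisenbergAction.Y_act]
  rfl

/-- If the twists of `Λ` by `g, …, g^{p-1}` differ from `Λ`, then a submodule of the direct sum of the
twists of `M(1, λ)` that contains a diagonal vector contains the untwisted summand. -/
theorem single_mem_of_twist_ne {g : OrthGroup ℓ} (hg : IsOfFinOrder g)
    (hΛ : ∀ i : ℕ, 1 ≤ i → i < orderOf g →
      twist (whittakerFunction lam) (g ^ i) ≠ whittakerFunction lam)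
    {Q : Submodule ℂ (Fin (orderOf g) → WhittakerM1 lam)}
    (hQ : ∀ (n : ℤ) (a : Fin ℓ → ℂ), ∀ x ∈ Q, ((twistSum lam g).field a).coeff n x ∈ Q)
    {w : WhittakerM1 lam} (hw : w ≠ 0) (hmem : (fun _ => w) ∈ Q) (w' : WhittakerM1 lam) :
    Pi.single ⟨0, hg.orderOf_pos⟩ w' ∈ Q := by
  set i₀ : Fin (orderOf g) := ⟨0, hg.orderOf_pos⟩ with hi₀
  -- Components are removed one at a time while the one at `i₀` stays nonzero. Only Λ ∘ g^j and Λ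
  -- need to be separated, never two twists from each other.
  have kill : ∀ S : Finset (Fin (orderOf g)), i₀ ∉ S →
      ∃ y ∈ Q, y i₀ ≠ 0 ∧ ∀ i ∈ S, y i = 0 := by
    intro S
    induction S using Finset.induction_on with
    | empty => exact fun _ => ⟨_, hmem, hw, fun i hi => absurd hi (Finset.notMem_empty i)⟩
    | insert j S hj ih =>
      intro hS
      rw [Finset.mem_insert, not_or] at hS
      obtain ⟨y, hy, hy0, hyS⟩ := ih hS.2
      have hj0 : 1 ≤ (j : ℕ) := by
        rw [Nat.one_le_iff_ne_zero]
        exact fun h => hS.1 (Fin.ext h.symm)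
      have h1 := hΛ j hj0 j.2
      rw [Ne, twist_whittakerFunction_eq_iff] at h1
      push Not at h1
      obtain ⟨n, a, hna⟩ := h1
      -- On component j the operator a(n) − c is locally nilpotent. On component `i₀` it is
      -- injective, because there the only possible eigenvalue of a(n) is (a, λ_n) ≠ c. Components
      -- that are already zero remain zero.
      set c : ℂ := (g ^ (j : ℕ)).1 a ⬝ᵥ lam n with hc
      have step : ∀ r : ℕ, ∃ z ∈ Q, z i₀ ≠ 0 ∧ (∀ i ∈ S, z i = 0) ∧
          z j = (ann lam n ((g ^ (j : ℕ)).1 a) ^ r) (y j) := by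
        intro r
        induction r with
        | zero => exact ⟨y, hy, hy0, hyS, rfl⟩
        | succ r ihr =>
          obtain ⟨z, hz, hz0, hzS, hzj⟩ := ihr
          refine ⟨((twistSum lam g).field a).coeff n z - c • z,
            Q.sub_mem (hQ n a z hz) (Q.smul_mem c hz), ?_, ?_, ?_⟩
          · exact modeOp_sub_ne_zero hna hz0
          · intro i hi
            rw [Pi.sub_apply, twistSum_field, Pi.smul_apply, hzS i hi, map_zero, smul_zero, sub_zero]
          · rw [pow_succ', Module.End.mul_apply, ← hzj]
            rfl
      obtain ⟨r, hr⟩ := exists_mem_annKer (y j)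
      obtain ⟨z, hz, hz0, hzS, hzj⟩ := step r
      refine ⟨z, hz, hz0, fun i hi => ?_⟩
      rcases Finset.mem_insert.mp hi with rfl | hi
      · rw [hzj, ann_pow_eq_zero hr]
      · exact hzS i hi
  obtain ⟨y, hy, hy0, hyS⟩ := kill (Finset.univ.erase i₀) (Finset.notMem_erase _ _)
  have hysingle : y = Pi.single i₀ (y i₀) := by
    funext i
    by_cases hi : i = i₀
    · rw [hi, Pi.single_eq_same]
    · rw [Pi.single_eq_of_ne hi, hyS i (Finset.mem_erase.mpr ⟨hi, Finset.mem_univ i⟩)]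
  -- The part of Q in the untwisted copy is stable under all modes and nonzero, so irreducibility
  -- over the Heisenberg algebra applies.
  have htop : Q.comap (LinearMap.single ℂ (fun _ => WhittakerM1 lam) i₀) = ⊤ := by
    refine eq_top_of_modeOp_mem (fun n a x hx => ?_) (w := y i₀) ?_ hy0
    · have := hQ n a _ hx
      have e : ((twistSum lam g).field a).coeff n (Pi.single i₀ x) = Pi.single i₀ (modeOp lam n a x) := by
        funext i
        rw [twistSum_field]
        by_cases hi : i = i₀
        · subst hi
          rw [Pi.single_eq_same, Pi.single_eq_same]
          rfl
        · rw [Pi.single_eq_of_ne hi, Pi.single_eq_of_ne hi, map_zero]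
      rw [LinearMap.single_apply, e] at this
      exact this
    · rw [Submodule.mem_comap, LinearMap.single_apply, ← hysingle]
      exact hy
  exact htop.symm.le (Submodule.mem_top (x := w'))

theorem isIrreducibleWeakModule_orbifold {g : OrthGroup ℓ} (hg : IsOfFinOrder g)
    (hΛ : ∀ i : ℕ, 1 ≤ i → i < orderOf g →
      twist (whittakerFunction lam) (g ^ i) ≠ whittakerFunction lam) :
    IsIrreducibleWeakModule (M1.Y ℓ) (M1.vacuum ℓ) (orbifold (Subgroup.zpowers g))
      (WhittakerM1.Y lam) where
  subalgebra := orbifold_isVertexSubalgebra _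
  weakModule := (action lam).isWeakModule _
  nontrivial := ⟨⟨_, 0, gen_ne_zero lam⟩⟩
  eq_bot_or_eq_top P hP := by
    rw [or_iff_not_imp_left]
    intro hbot
    obtain ⟨w, hwP, hw⟩ := P.ne_bot_iff.mp hbot
    rw [eq_top_iff]
    intro w' _
    set x : Fin (orderOf g) → WhittakerM1 lam := fun _ => w with hx
    set Q := Submodule.span ℂ
      (Set.range fun p : M1 ℓ × ℤ => ((twistSum lam g).Y p.1).coeff p.2 x) with hQ
    have hmem : x ∈ Q := Submodule.subset_span ⟨(M1.vacuum ℓ, -1), by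
      beta_reduce
      rw [HeisenbergAction.Y_vacuum, coeff_one, if_pos rfl]⟩
    have hsingle := single_mem_of_twist_ne hg hΛ
      (fun n a => (twistSum lam g).mode_mem_span_Y x a n) hw hmem w'
    -- On the generators of Q the sum of the components is a mode of the g-invariant vector Σᵢ gⁱv
    -- applied to w, hence lies in P.
    have hsum : ∀ y ∈ Q, ∑ i, y i ∈ P := by
      intro y hy
      induction hy using Submodule.span_induction with
      | mem y h =>
        obtain ⟨⟨v, n⟩, rfl⟩ := h
        have := hP _ (sum_act_mem_orbifold hg v) n w hwP
        rw [map_sum, coeff_sum] at this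
        simpa only [twistSum_Y] using this
      | zero => simp
      | add y z _ _ hy hz =>
        simp only [Pi.add_apply, Finset.sum_add_distrib]
        exact P.add_mem hy hz
      | smul c y _ hy =>
        simp only [Pi.smul_apply, ← Finset.smul_sum]
        exact P.smul_mem c hy
    have := hsum _ hsingle
    rwa [Finset.sum_pi_single', if_pos (Finset.mem_univ _)] at this

end WhittakerM1

/-! ### The involution −1 and the permutations -/

namespace OrthGroup

variable {ℓ : ℕ}

theorem negOne_apply (a : Fin ℓ → ℂ) : (negOne ℓ).1 a = -a := rfl

theorem negOne_sq : negOne ℓ ^ 2 = 1 := by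
  rw [pow_two]
  refine Subtype.ext (LinearEquiv.ext fun a => ?_)
  exact neg_neg a

theorem isOfFinOrder_negOne : IsOfFinOrder (negOne ℓ) :=
  isOfFinOrder_iff_pow_eq_one.mpr ⟨2, two_pos, negOne_sq⟩

theorem orbifold_negOne : orbifold (Subgroup.zpowers (negOne ℓ)) = M1plus ℓ := by
  ext v
  exact ⟨fun h => h _ (Subgroup.mem_zpowers _), fun h => mem_orbifold_zpowers isOfFinOrder_negOne h⟩

theorem perm_apply (σ : Equiv.Perm (Fin ℓ)) (a : Fin ℓ → ℂ) : (perm σ).1 a = a ∘ σ.symm := rfl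

/-- The embedding of the symmetric group, as a homomorphism. -/
def permHom (ℓ : ℕ) : Equiv.Perm (Fin ℓ) →* OrthGroup ℓ where
  toFun := perm
  map_one' := rfl
  map_mul' _ _ := rfl

theorem twist_perm_eq_iff (lam : ℕ →₀ (Fin ℓ → ℂ)) (σ : Equiv.Perm (Fin ℓ)) :
    twist (whittakerFunction lam) (perm σ) = whittakerFunction lam
      ↔ ∀ n i, lam n (σ i) = lam n i := by
  rw [twist_whittakerFunction_eq_iff]
  constructor
  · intro h n i
    have := h n (Pi.single i 1)
    rwa [perm_single, single_one_dotProduct, single_one_dotProduct] at this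
  · intro h n a
    rw [perm_apply, dotProduct, dotProduct, ← Equiv.sum_comp σ]
    simp [h]

end OrthGroup

end

theorem proposition8p1 (ℓ : ℕ) (lam : ℕ →₀ (Fin ℓ → ℂ)) :
    (∀ g : OrthGroup ℓ, IsOfFinOrder g →
      (∀ i : ℕ, 1 ≤ i → i < orderOf g →
        twist (whittakerFunction lam) (g ^ i) ≠ whittakerFunction lam) →
      IsIrreducibleWeakModule (M1.Y ℓ) (M1.vacuum ℓ) (orbifold (Subgroup.zpowers g))
        (WhittakerM1.Y lam)) ∧
    (lam ≠ 0 →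
      IsIrreducibleWeakModule (M1.Y ℓ) (M1.vacuum ℓ) (M1plus ℓ) (WhittakerM1.Y lam)) ∧
    ((∀ σ : Equiv.Perm (Fin ℓ), σ.IsSwap →
        twist (whittakerFunction lam) (OrthGroup.perm σ) ≠ whittakerFunction lam) →
      ∀ g : Equiv.Perm (Fin ℓ),
        IsIrreducibleWeakModule (M1.Y ℓ) (M1.vacuum ℓ)
          (orbifold (Subgroup.zpowers (OrthGroup.perm g))) (WhittakerM1.Y lam)) := by
  refine ⟨fun g hg hΛ => WhittakerM1.isIrreducibleWeakModule_orbifold hg hΛ, fun hlam => ?_,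
    fun hswap g => ?_⟩
  · rw [← OrthGroup.orbifold_negOne]
    refine WhittakerM1.isIrreducibleWeakModule_orbifold OrthGroup.isOfFinOrder_negOne
      fun i h1 h2 h => hlam ?_
    -- The bound on the order leaves only i = 1, where invariance of Λ reads −λ = λ.
    have h3 := orderOf_le_of_pow_eq_one two_pos (OrthGroup.negOne_sq (ℓ := ℓ))
    obtain rfl : i = 1 := by omega
    rw [pow_one, twist_whittakerFunction_eq_iff] at h
    ext n i
    have h4 := h n (Pi.single i 1)
    rw [OrthGroup.negOne_apply, neg_dotProduct, single_one_dotProduct] at h4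
    exact self_eq_neg.mp h4.symm
  · have hord : IsOfFinOrder (OrthGroup.perm g) := (OrthGroup.permHom ℓ).isOfFinOrder
      (isOfFinOrder_of_finite g)
    refine WhittakerM1.isIrreducibleWeakModule_orbifold hord fun i h1 h2 h => ?_
    have hpow : OrthGroup.perm g ^ i = OrthGroup.perm (g ^ i) := (map_pow (OrthGroup.permHom ℓ) g i).symm
    rw [hpow, OrthGroup.twist_perm_eq_iff] at h
    have hne : g ^ i ≠ 1 := by
      intro h0
      rw [h0] at hpow
      exact absurd (orderOf_le_of_pow_eq_one h1 hpow) (not_le.mpr h2)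
    obtain ⟨j, hj⟩ : ∃ j, (g ^ i) j ≠ j := by
      by_contra hc
      push Not at hc
      exact hne (Equiv.ext hc)
    -- Every λ_n is invariant under g^i, so its coordinates at j and at g^i j coincide; the
    -- transposition of these two indices then fixes Λ.
    refine hswap (Equiv.swap j ((g ^ i) j)) ⟨j, _, hj.symm, rfl⟩ ?_
    rw [OrthGroup.twist_perm_eq_iff]
    intro n k
    rw [Equiv.swap_apply_def]
    split_ifs with hk hk
    · rw [hk, h]
    · rw [hk, h]
    · rfl
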